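/- Let $M\subset\mathbb R^3$ be a compact oriented smooth, or piecewise smooth, surface with (possibly empty) boundary $\partial M$, and let $p\in\mathbb R^3\setminus M$. Piecewise smooth means: there is a finite set of vertices $V\subset M$, near each of which $M$ has finite area, such that near every other point $M$ is a smooth embedded sheet, or (exactly at the points of $\partial M\setminus V$) a smooth half-sheet with edge $\partial M$, or a union of two smooth half-sheets that meet exactly along a common smooth edge and are consistently oriented there; a vertex belongs to $\partial M$ exactly if it is a limit of points of $\partial M\setminus V$. Let $n$ be the unit normal field of the orientation (defined off the vertices and the edges along which two half-sheets meet). Let $S^2_p$ be the unit sphere centred at $p$ with its area measure. For $q\in S^2_p$ let $$\chi(q)=\sum_{r}\operatorname{sign}\big((q-p)\cdot n(r)\big),$$ where $r$ runs over the intersection points of $M$ with the ray from $p$ through $q$; and let $$w_M(p)=\frac1{4\pi}\int_M\frac{(x-p)\cdot n(x)}{|x-p|^3}\,dA(x)$$ be the generalized winding number, i.e. $\frac1{4\pi}$ times the integral of the solid angle subtended at $p$. Let $A_i$ be the connected components of the complement in $S^2_p$ of the radial projection of $\partial M$ to $S^2_p$. Then: 1. the regions $A_i$ are open, almost every ray from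 $p$ meets $M$ in finitely many points, and for each $i$ there is a constant $\chi_i\in\mathbb Z$ such that $\chi(q)=\chi_i$ for almost every $q\in A_i$; 2. the integral defining $w_M(p)$ converges absolutely, $\chi$ is integrable on $S^2_p$, $\sum_i\operatorname{Area}(A_i)\,\chi_i$ converges absolutely, and $$w_M(p)=\frac1{4\pi}\int_{S^2_p}\chi\,dA=\frac1{4\pi}\sum_i\operatorname{Area}(A_i)\,\chi_i .$$ -/

import Mathlib

open MeasureTheory Set Topology
open scoped ContDiff Matrix

noncomputable section

/-- Euclidean three-space. -/
abbrev E3 : Type := EuclideanSpace ℝ (Fin 3)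

/-- The unit sphere of directions. The unit sphere centred at `p` is identified with it by the
translation `q ↦ p + q`. -/
abbrev UnitSphere : Type := Metric.sphere (0 : E3) 1

/-- The area measure of the unit sphere (of total mass `4π`). -/
def sphereArea : Measure UnitSphere := (volume : Measure E3).toSphere

/-- The vector product `r_u × r_v` of the partial derivatives of `g : ℝ² → ℝ³`. -/
def crossPartials (g : ℝ × ℝ → E3) (y : ℝ × ℝ) : E3 :=
  WithLp.toLp 2
    (WithLp.ofLp (fderiv ℝ g y (1, 0)) ⨯₃ WithLp.ofLp (fderiv ℝ g y (0, 1)))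

/-- The unit normal `(r_u × r_v) / |r_u × r_v|` of a parametrization. -/
def paramNormal (g : ℝ × ℝ → E3) (y : ℝ × ℝ) : E3 :=
  ‖crossPartials g y‖⁻¹ • crossPartials g y

/-- `g` is a smooth regular map (an immersion) on the open set `U`. -/
structure IsRegularOn (g : ℝ × ℝ → E3) (U : Set (ℝ × ℝ)) : Prop where
  isOpen : IsOpen U
  smooth : ContDiffOn ℝ ∞ g U
  regular : ∀ y ∈ U, crossPartials g y ≠ 0

/-- Near `x` the set `M` is a smooth sheet with unit normal field `n`: some neighbourhood of `x` in
`M` is parametrized by a regular map `g` which is a homeomorphism onto its image, and `n` is the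
normal given by the orientation of the parameter plane. -/
def IsSmoothPoint (M : Set E3) (n : E3 → E3) (x : E3) : Prop :=
  ∃ (g : ℝ × ℝ → E3) (U : Set (ℝ × ℝ)) (W : Set E3),
    IsRegularOn g U ∧ IsOpen W ∧ x ∈ W ∧
    IsEmbedding (U.domRestrict g) ∧ g '' U = M ∩ W ∧
    ∀ y ∈ U, n (g y) = paramNormal g y

/-- Near `x` the set `M` is a smooth half-sheet with edge `B` and unit normal field `n`: the
parameter domain is the part of `U` in the closed upper half-plane, and the part of `U` on the line
`v = 0` parametrizes `B`. -/
def IsBoundaryPoint (M B : Set E3) (n : E3 → E3) (x : E3) : Prop :=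
  ∃ (g : ℝ × ℝ → E3) (U : Set (ℝ × ℝ)) (W : Set E3),
    IsRegularOn g U ∧ IsOpen W ∧ x ∈ W ∧
    IsEmbedding ((U ∩ {y | 0 ≤ y.2}).domRestrict g) ∧
    g '' (U ∩ {y | 0 ≤ y.2}) = M ∩ W ∧
    g '' (U ∩ {y | y.2 = 0}) = B ∩ W ∧
    ∀ y ∈ U, 0 ≤ y.2 → n (g y) = paramNormal g y

/-- Near `x` the set `M` consists of two smooth half-sheets that meet along a common smooth edge and
are consistently oriented: `g₁` parametrizes the first over `v ≥ 0`, `g₂` the second over `v ≤ 0`,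
they agree on `v = 0`, and together they are a homeomorphism onto a neighbourhood of `x` in `M`.
The normal is the one given by the orientation of the common parameter plane; it is not prescribed
on the edge itself. -/
def IsCreasePoint (M : Set E3) (n : E3 → E3) (x : E3) : Prop :=
  ∃ (g₁ g₂ : ℝ × ℝ → E3) (U : Set (ℝ × ℝ)) (W : Set E3),
    IsRegularOn g₁ U ∧ IsRegularOn g₂ U ∧ IsOpen W ∧ x ∈ W ∧
    (∀ y ∈ U, y.2 = 0 → g₁ y = g₂ y) ∧
    IsEmbedding (U.domRestrict fun y => if 0 ≤ y.2 then g₁ y else g₂ y) ∧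
    (fun y => if 0 ≤ y.2 then g₁ y else g₂ y) '' U = M ∩ W ∧
    (∀ y ∈ U, 0 < y.2 → n (g₁ y) = paramNormal g₁ y) ∧
    (∀ y ∈ U, y.2 < 0 → n (g₂ y) = paramNormal g₂ y)

/-- A compact oriented piecewise smooth surface in `ℝ³`, with (possibly empty) boundary. Away from
finitely many vertices it is, near each point, a smooth sheet, a pair of consistently oriented
smooth half-sheets meeting along a smooth edge, or, exactly at the boundary points, a smooth
half-sheet. At a vertex nothing is required beyond finite area nearby. The smooth oriented surfaces
are those with no vertices and no crease points. -/
structure PiecewiseSmoothSurface where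
  /-- the underlying set `M` -/
  carrier : Set E3
  /-- the boundary `∂M` -/
  boundary : Set E3
  /-- the unit normal field giving the orientation (only its values on `M` matter) -/
  normal : E3 → E3
  /-- the vertices -/
  vertices : Set E3
  isCompact_carrier : IsCompact carrier
  finite_vertices : vertices.Finite
  vertices_subset : vertices ⊆ carrier
  /-- a vertex lies on the boundary exactly if it is a limit of regular boundary points -/
  boundary_eq : boundary = closure (boundary \ vertices)
  interior_point : ∀ x ∈ carrier \ (boundary ∪ vertices),
    IsSmoothPoint carrier normal x ∨ IsCreasePoint carrier normal x
  boundary_point : ∀ x ∈ boundary \ vertices, IsBoundaryPoint carrier boundary normal x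
  finite_area : ∀ x ∈ vertices, ∃ W ∈ 𝓝 x, μHE[2] (carrier ∩ W) < ⊤

namespace PiecewiseSmoothSurface

variable (S : PiecewiseSmoothSurface) (p : E3)

/-- The points in which the ray from `p` in the direction `q` meets the surface. -/
def rayInter (q : UnitSphere) : Set E3 :=
  {x | x ∈ S.carrier ∧ ∃ t : ℝ, 0 < t ∧ x = p + t • (q : E3)}

/-- The number `χ(q)` of signed intersections of the surface with the ray from `p` in the direction
`q`: the sum, over the intersection points, of the signs of the inner product of the direction with
the normal. -/
def chi (q : UnitSphere) : ℤ :=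
  ∑ᶠ x ∈ S.rayInter p q, (SignType.sign (inner ℝ (q : E3) (S.normal x)) : ℤ)

/-- The density `⟪x - p, n(x)⟫ / |x - p|³` of the solid angle subtended at `p`, with respect to the
area of the surface. -/
def solidAngleDensity (x : E3) : ℝ :=
  inner ℝ (x - p) (S.normal x) / ‖x - p‖ ^ 3

/-- The generalized winding number: `1/(4π)` times the integral over the surface of the solid angle
subtended at `p`. -/
def windingNumber : ℝ :=
  1 / (4 * Real.pi) * ∫ x in S.carrier, S.solidAngleDensity p x ∂μHE[2]

/-- The radial projection of the boundary to the unit sphere around `p`. -/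
def boundaryProj : Set UnitSphere :=
  {q | ∃ x ∈ S.boundary, (q : E3) = ‖x - p‖⁻¹ • (x - p)}

/-- The regions into which the projection of the boundary splits the sphere: the connected
components of its complement. -/
def regions : Set (Set UnitSphere) :=
  {A | ∃ q ∈ (S.boundaryProj p)ᶜ, A = connectedComponentIn (S.boundaryProj p)ᶜ q}

end PiecewiseSmoothSurface

end

/-! The solid angle density is the signed Jacobian of the radial projection from `p`. If a sheet is
parametrized by `g`, its projection is `k = (g - p)/|g - p|`, and the triple product of `k` with its
partial derivatives equals `⟪g - p, g_u × g_v⟫ / |g - p|³`. Where this is nonzero the projection is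
locally injective; where it vanishes the image is null by Sard's theorem. Hence the surface is a
countable disjoint union of pieces which either project injectively onto `B i`, crossed with
constant sign `σ i`, or contribute nothing. The areas of the `B i` have sum at most the integral of
the absolute density, which is finite since `M` has finite area and positive distance from `p`. By
Borel–Cantelli almost every ray meets `M` finitely often, and `χ = ∑ σ i · 1_{B i}` almost
everywhere. Termwise integration gives the first formula for the winding number, and also its
version weighted by a bounded function of the direction (`ae_finite_rayInter_and_integral_chi`).

For constancy of `χ` on the regions, extend `χ` to space as a function homogeneous of degree zero
and show that its weak derivative vanishes off the directions of the boundary and the vertices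
(`integral_chi_fderiv_eq_zero`). By polar coordinates and the weighted formula, the pairing of `χ`
with `∂_e φ` is a flux through `M` of the field `∫ t² ∂_e φ(t(x - p)) dt · (x - p)`. Up to the exact
term `d/dt (t² φ(t(x - p)))`, which integrates to zero, the integrand is `t` times the curl of
`φ(t(x - p)) (x - p) × e`, so Stokes' theorem kills it for each `t`. Stokes' theorem is proved chart
by chart with a partition of unity; on a crease the two edge integrals cancel because the tangential
derivatives agree.

A function with vanishing weak derivative is locally almost everywhere constant, by mollification.
Vertex directions are removable: a ball minus the line through the origin and its centre is still
connected and of full measure. Connectedness then spreads the constant over each region, and the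
projected boundary is null, so summing over regions recovers the whole integral. -/

section

open scoped NNReal ENNReal Function Pointwise Convolution

/-! ### Cross products and the area formula for Hausdorff measure. -/

/-- The vector product on Euclidean three-space. -/
noncomputable def cross3 (u v : E3) : E3 :=
  WithLp.toLp 2 (WithLp.ofLp u ⨯₃ WithLp.ofLp v)

theorem crossPartials_eq (g : ℝ × ℝ → E3) (y : ℝ × ℝ) :
    crossPartials g y = cross3 (fderiv ℝ g y (1, 0)) (fderiv ℝ g y (0, 1)) := rfl

theorem inner_eq_sum3 (u v : E3) : inner ℝ u v = u 0 * v 0 + u 1 * v 1 + u 2 * v 2 := by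
  simp [PiLp.inner_apply, Fin.sum_univ_three, mul_comm]

@[simp] theorem cross3_zero (u v : E3) : cross3 u v 0 = u 1 * v 2 - u 2 * v 1 := by
  simp [cross3, cross_apply]

@[simp] theorem cross3_one (u v : E3) : cross3 u v 1 = u 2 * v 0 - u 0 * v 2 := by
  simp [cross3, cross_apply]

@[simp] theorem cross3_two (u v : E3) : cross3 u v 2 = u 0 * v 1 - u 1 * v 0 := by
  simp [cross3, cross_apply]

theorem norm_sq_eq_sum3 (u : E3) : ‖u‖ ^ 2 = u 0 ^ 2 + u 1 ^ 2 + u 2 ^ 2 := by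
  rw [← real_inner_self_eq_norm_sq, inner_eq_sum3]; ring

theorem norm_cross3_sq (u v : E3) :
    ‖cross3 u v‖ ^ 2 = inner ℝ u u * inner ℝ v v - inner ℝ u v * inner ℝ u v := by
  rw [norm_sq_eq_sum3]
  simp only [inner_eq_sum3, cross3_zero, cross3_one, cross3_two]
  ring

theorem continuous_cross3 : Continuous fun w : E3 × E3 => cross3 w.1 w.2 := by
  refine (PiLp.continuous_toLp 2 _).comp (continuous_pi fun i => ?_)
  fin_cases i <;> simp [cross_apply] <;> fun_prop

/-- By Lagrange's identity the squared norm of the cross product is the Gram determinant of the two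
columns, which is the square of the area factor of a linear map. -/
theorem euclideanHausdorffMeasure_image_linear (L : ℝ × ℝ →L[ℝ] E3) (s : Set (ℝ × ℝ)) :
    μHE[2] (L '' s) = ‖cross3 (L (1, 0)) (L (0, 1))‖ₑ * volume s := by
  -- The norm of `ℝ × ℝ` is the maximum norm; Gram determinants need the Euclidean structure, which
  -- has the same volume.
  let e : WithLp 2 (ℝ × ℝ) ≃L[ℝ] ℝ × ℝ := WithLp.prodContinuousLinearEquiv 2 ℝ ℝ ℝ
  let T : WithLp 2 (ℝ × ℝ) →ₗ[ℝ] E3 := (L ∘L (e : WithLp 2 (ℝ × ℝ) →L[ℝ] ℝ × ℝ)).toLinearMap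
  have hrank : Module.finrank ℝ (WithLp 2 (ℝ × ℝ)) = 2 := by
    rw [e.toLinearEquiv.finrank_eq]; simp
  have h1 := LinearMap.euclideanHausdorffMeasure_image_eq_normDet_mul_volume T (e ⁻¹' s)
  rw [hrank] at h1
  have h2 : T '' (e ⁻¹' s) = L '' s := by
    have : (e '' (e ⁻¹' s)) = s := image_preimage_eq _ e.surjective
    conv_rhs => rw [← this, image_image]
    rfl
  have h3 : volume (e ⁻¹' s) = volume s :=
    (WithLp.volume_preserving_ofLp ℝ ℝ).measure_preimage_emb
      (Homeomorph.measurableEmbedding e.toHomeomorph) s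
  rw [h2, h3] at h1
  rw [h1, ← ofReal_norm]
  congr 2
  have hb : Orthonormal ℝ ![WithLp.toLp 2 ((1 : ℝ), (0 : ℝ)), WithLp.toLp 2 ((0 : ℝ), (1 : ℝ))] := by
    rw [orthonormal_iff_ite]
    intro i j
    fin_cases i <;> fin_cases j <;> simp
  have hcard : Fintype.card (Fin 2) = Module.finrank ℝ (WithLp 2 (ℝ × ℝ)) := by
    rw [hrank]; simp
  let b' := basisOfOrthonormalOfCardEqFinrank hb hcard
  have hb' : Orthonormal ℝ b' := by
    rw [coe_basisOfOrthonormalOfCardEqFinrank]; exact hb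
  let b : OrthonormalBasis (Fin 2) ℝ (WithLp 2 (ℝ × ℝ)) := b'.toOrthonormalBasis hb'
  have hbe : ⇑b = ![WithLp.toLp 2 ((1 : ℝ), (0 : ℝ)), WithLp.toLp 2 ((0 : ℝ), (1 : ℝ))] := by
    simp [b, b']
  have h4 := LinearMap.normDet_sq_eq_det_gram T b
  have h5 : T.normDet ^ 2 = ‖cross3 (L (1, 0)) (L (0, 1))‖ ^ 2 := by
    rw [norm_cross3_sq]
    simp only [Matrix.det_fin_two, Matrix.gram_apply, hbe] at h4
    have h6 : T (WithLp.toLp 2 (1, 0)) = L (1, 0) := rfl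
    have h7 : T (WithLp.toLp 2 (0, 1)) = L (0, 1) := rfl
    simp only [Matrix.cons_val_zero, Matrix.cons_val_one, h6, h7] at h4
    rw [real_inner_comm (L (1, 0)) (L (0, 1))] at h4
    exact h4
  exact (sq_eq_sq₀ (LinearMap.normDet_nonneg T) (norm_nonneg _)).1 h5

/-- Lindelöf: countably many of the good neighbourhoods cover `s`, and making them disjoint keeps
the property because it passes to subsets. -/
theorem exists_measurable_partition {X : Type*} [TopologicalSpace X] [SecondCountableTopology X]
    [MeasurableSpace X] [OpensMeasurableSpace X] {s : Set X} (hs : MeasurableSet s)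
    (P : Set X → Prop) (hmono : ∀ a b, a ⊆ b → P b → P a) (h0 : P ∅)
    (hloc : ∀ x ∈ s, ∃ N ∈ 𝓝 x, P (N ∩ s)) :
    ∃ t : ℕ → Set X, Pairwise (Disjoint on t) ∧ (∀ n, MeasurableSet (t n)) ∧
      ⋃ n, t n = s ∧ ∀ n, P (t n) := by
  classical
  choose! N hN hP using hloc
  obtain ⟨c, hcs, hcc, hcov⟩ := TopologicalSpace.countable_cover_nhdsWithin
    (f := fun x => interior (N x)) (s := s)
    (fun x hx => mem_nhdsWithin_of_mem_nhds (interior_mem_nhds.2 (hN x hx)))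
  rcases c.eq_empty_or_nonempty with rfl | hne
  · have : s = ∅ := by simpa using hcov
    subst this
    exact ⟨fun _ => ∅, fun i j _ => by simp, by simp, by simp, fun _ => h0⟩
  obtain ⟨e, rfl⟩ := hcc.exists_eq_range hne
  refine ⟨fun n => disjointed (fun n => interior (N (e n)) ∩ s) n, disjoint_disjointed _,
    MeasurableSet.disjointed fun n => isOpen_interior.measurableSet.inter hs, ?_, fun n => ?_⟩
  · rw [iUnion_disjointed, ← iUnion_inter]
    refine inter_eq_right.2 ?_
    simpa using hcov
  · refine hmono _ _ (disjointed_subset _ n) (hmono _ _ ?_ (hP (e n) (hcs ⟨n, rfl⟩)))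
    exact inter_subset_inter_left _ interior_subset

/-- The map `f ∘ h⁻¹` is `C`-Lipschitz on `h '' t`. Injectivity of `h` is not needed: the estimate
makes `f` constant on the fibres of `h` in `t`. -/
theorem euclideanHausdorffMeasure_image_le_of_edist_le {X Y Z : Type*} [EMetricSpace Y]
    [MeasurableSpace Y] [BorelSpace Y] [EMetricSpace Z] [MeasurableSpace Z] [BorelSpace Z]
    [Nonempty X] {f : X → Y} {h : X → Z} {C : ℝ≥0} {t : Set X} (d : ℕ)
    (hfh : ∀ x ∈ t, ∀ y ∈ t, edist (f x) (f y) ≤ C * edist (h x) (h y)) :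
    μHE[d] (f '' t) ≤ (C : ℝ≥0∞) ^ d * μHE[d] (h '' t) := by
  have key : ∀ x ∈ t, f (Function.invFunOn h t (h x)) = f x := by
    intro x hx
    have h1 := Function.invFunOn_mem (f := h) (s := t) (b := h x) ⟨x, hx, rfl⟩
    have h2 := Function.invFunOn_eq (f := h) (s := t) (b := h x) ⟨x, hx, rfl⟩
    have := hfh _ h1 x hx
    rw [h2, edist_self, mul_zero] at this
    exact edist_le_zero.1 this
  have hL : LipschitzOnWith C (f ∘ Function.invFunOn h t) (h '' t) := by
    rintro _ ⟨x, hx, rfl⟩ _ ⟨y, hy, rfl⟩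
    simp only [Function.comp, key x hx, key y hy]
    exact hfh x hx y hy
  have him : f '' t = (f ∘ Function.invFunOn h t) '' (h '' t) := by
    rw [image_image]
    exact image_congr fun x hx => (key x hx).symm
  rw [him]
  have := hL.hausdorffMeasure_image_le (d := (d : ℝ)) (by positivity)
  simp only [Measure.euclideanHausdorffMeasure_def, Measure.smul_apply, ENNReal.smul_def,
    smul_eq_mul]
  rw [mul_left_comm]
  gcongr
  simpa using this

theorem IsRegularOn.contDiffAt {g : ℝ × ℝ → E3} {U : Set (ℝ × ℝ)} (hg : IsRegularOn g U)
    {y : ℝ × ℝ} (hy : y ∈ U) : ContDiffAt ℝ ∞ g y :=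
  hg.smooth.contDiffAt (hg.isOpen.mem_nhds hy)

theorem IsRegularOn.differentiableAt {g : ℝ × ℝ → E3} {U : Set (ℝ × ℝ)} (hg : IsRegularOn g U)
    {y : ℝ × ℝ} (hy : y ∈ U) : DifferentiableAt ℝ g y :=
  (hg.contDiffAt hy).differentiableAt (by simp)

theorem IsRegularOn.continuousOn {g : ℝ × ℝ → E3} {U : Set (ℝ × ℝ)} (hg : IsRegularOn g U) :
    ContinuousOn g U := hg.smooth.continuousOn

theorem IsRegularOn.continuousOn_fderiv {g : ℝ × ℝ → E3} {U : Set (ℝ × ℝ)}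
    (hg : IsRegularOn g U) : ContinuousOn (fderiv ℝ g) U :=
  hg.smooth.continuousOn_fderiv_of_isOpen hg.isOpen (by simp)

theorem IsRegularOn.continuousOn_crossPartials {g : ℝ × ℝ → E3} {U : Set (ℝ × ℝ)}
    (hg : IsRegularOn g U) : ContinuousOn (crossPartials g) U := by
  have h := hg.continuousOn_fderiv
  exact continuous_cross3.comp_continuousOn
    ((h.clm_apply continuousOn_const).prodMk (h.clm_apply continuousOn_const))

theorem prod_apply_eq {F : Type*} [NormedAddCommGroup F] [NormedSpace ℝ F] (L : ℝ × ℝ →L[ℝ] F)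
    (h : ℝ × ℝ) : L h = h.1 • L (1, 0) + h.2 • L (0, 1) := by
  rw [← map_smul, ← map_smul, ← map_add]; simp

theorem injective_of_cross3_ne_zero {L : ℝ × ℝ →L[ℝ] E3}
    (h : cross3 (L (1, 0)) (L (0, 1)) ≠ 0) : Function.Injective L := by
  rw [injective_iff_map_eq_zero]
  intro a ha
  rw [prod_apply_eq] at ha
  by_contra hne
  apply h
  set u := L (1, 0)
  set v := L (0, 1)
  have e (i : Fin 3) : a.1 * u i + a.2 * v i = 0 := by simpa using congrArg (fun w : E3 => w i) ha
  have hcase : a.1 ≠ 0 ∨ a.2 ≠ 0 := by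
    by_contra hc
    push Not at hc
    exact hne (Prod.ext hc.1 hc.2)
  have h01 : u 0 * v 1 - u 1 * v 0 = 0 := by
    rcases hcase with hc | hc <;> refine (mul_eq_zero.1 ?_).resolve_left hc
    · linear_combination v 1 * e 0 - v 0 * e 1
    · linear_combination u 0 * e 1 - u 1 * e 0
  have h12 : u 1 * v 2 - u 2 * v 1 = 0 := by
    rcases hcase with hc | hc <;> refine (mul_eq_zero.1 ?_).resolve_left hc
    · linear_combination v 2 * e 1 - v 1 * e 2
    · linear_combination u 1 * e 2 - u 2 * e 1
  have h20 : u 2 * v 0 - u 0 * v 2 = 0 := by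
    rcases hcase with hc | hc <;> refine (mul_eq_zero.1 ?_).resolve_left hc
    · linear_combination v 0 * e 2 - v 2 * e 0
    · linear_combination u 2 * e 0 - u 0 * e 2
  ext i
  fin_cases i
  · simpa using h12
  · simpa using h20
  · simpa using h01

/-- Near `y` the map is bi-Lipschitz comparable with its derivative `L`, with factor `C`, which
costs `C²` in area. The Jacobian varies by a further factor `C`. -/
theorem IsRegularOn.exists_nhds_area_comparison {g : ℝ × ℝ → E3} {U : Set (ℝ × ℝ)}
    (hg : IsRegularOn g U) {y : ℝ × ℝ} (hy : y ∈ U) {C : ℝ≥0} (hC : 1 < C) :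
    ∃ N ∈ 𝓝 y, ∀ t ⊆ N, MeasurableSet t →
      μHE[2] (g '' t) ≤ (C : ℝ≥0∞) ^ 3 * ∫⁻ z in t, ‖crossPartials g z‖ₑ ∧
      ∫⁻ z in t, ‖crossPartials g z‖ₑ ≤ (C : ℝ≥0∞) ^ 3 * μHE[2] (g '' t) := by
  set L := fderiv ℝ g y
  have hLinj : Function.Injective L := injective_of_cross3_ne_zero (hg.regular y hy)
  obtain ⟨K, hK0, hK⟩ := (L : ℝ × ℝ →ₗ[ℝ] E3).exists_antilipschitzWith
    (LinearMap.ker_eq_bot.2 hLinj)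
  have hCr : (1 : ℝ) < C := by exact_mod_cast hC
  have hKr : (0 : ℝ) < K := by exact_mod_cast hK0
  -- Chosen so that `1 - δ = 1 / C` and `1 + δ ≤ C`. Since `K` bounds the inverse of `L`, an error
  -- of `δ / K` relative to `a - b` is at most `δ` relative to `L a - L b`.
  set δ : ℝ := (C - 1) / C
  have hδ0 : 0 < δ := div_pos (by linarith) (by linarith)
  have hδ1 : 1 - δ = 1 / C := by simp only [δ]; field_simp; ring
  have hδ2 : 1 + δ ≤ C := by
    have : 1 + δ = (2 * C - 1) / C := by simp only [δ]; field_simp; ring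
    rw [this, div_le_iff₀ (by linarith)]
    nlinarith [sq_nonneg ((C : ℝ) - 1)]
  let c : ℝ≥0 := ⟨δ / K, by positivity⟩
  have hc : 0 < c := by
    rw [← NNReal.coe_pos]; exact div_pos hδ0 hKr
  have hstrict : HasStrictFDerivAt g L y := (hg.contDiffAt hy).hasStrictFDerivAt (by simp)
  obtain ⟨N1, hN1, happ⟩ := hstrict.approximates_deriv_on_nhds (c := c) (Or.inr hc)
  have hJ0 : 0 < ‖crossPartials g y‖ := norm_pos_iff.2 (hg.regular y hy)
  have hcont : ContinuousAt (fun z => ‖crossPartials g z‖) y :=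
    (hg.continuousOn_crossPartials.continuousAt (hg.isOpen.mem_nhds hy)).norm
  have hN2 : ∀ᶠ z in 𝓝 y, ‖crossPartials g z‖ < C * ‖crossPartials g y‖ :=
    hcont.eventually_lt continuousAt_const (by nlinarith)
  have hN3 : ∀ᶠ z in 𝓝 y, ‖crossPartials g y‖ < C * ‖crossPartials g z‖ :=
    continuousAt_const.eventually_lt (continuousAt_const.mul hcont) (by nlinarith)
  refine ⟨N1 ∩ ({z | ‖crossPartials g z‖ < C * ‖crossPartials g y‖} ∩
    {z | ‖crossPartials g y‖ < C * ‖crossPartials g z‖}),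
    Filter.inter_mem hN1 (Filter.inter_mem hN2 hN3), fun t ht htm => ?_⟩
  have hest : ∀ a ∈ t, ∀ b ∈ t, ‖g a - g b‖ ≤ C * ‖L a - L b‖ ∧ ‖L a - L b‖ ≤ C * ‖g a - g b‖ := by
    intro a ha b hb
    have h1 := happ _ (ht ha).1 _ (ht hb).1
    have h2 : ‖a - b‖ ≤ K * ‖L a - L b‖ := by
      simpa [dist_eq_norm] using hK.le_mul_dist a b
    have h3 : (c : ℝ) * ‖a - b‖ ≤ δ * ‖L a - L b‖ := by
      calc (c : ℝ) * ‖a - b‖ ≤ c * (K * ‖L a - L b‖) := by gcongr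
        _ = δ * ‖L a - L b‖ := by
          change δ / K * (K * ‖L a - L b‖) = _
          field_simp
    rw [map_sub] at h1
    have h4 := h1.trans h3
    constructor
    · calc ‖g a - g b‖ ≤ ‖L a - L b‖ + ‖g a - g b - (L a - L b)‖ := norm_le_insert' _ _
        _ ≤ (1 + δ) * ‖L a - L b‖ := by linarith
        _ ≤ C * ‖L a - L b‖ := by gcongr
    · have h5 : ‖L a - L b‖ ≤ ‖g a - g b‖ + ‖g a - g b - (L a - L b)‖ := norm_le_insert _ _
      have h6 : (1 - δ) * ‖L a - L b‖ ≤ ‖g a - g b‖ := by linarith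
      rw [hδ1, one_div, inv_mul_le_iff₀ (by linarith)] at h6
      exact h6
  have e1 : μHE[2] (g '' t) ≤ (C : ℝ≥0∞) ^ 2 * μHE[2] (L '' t) := by
    refine euclideanHausdorffMeasure_image_le_of_edist_le 2 fun a ha b hb => ?_
    rw [edist_eq_enorm_sub, edist_eq_enorm_sub, ← ofReal_norm, ← ofReal_norm,
      ← ENNReal.ofReal_coe_nnreal, ← ENNReal.ofReal_mul (by positivity)]
    exact ENNReal.ofReal_le_ofReal (hest a ha b hb).1
  have e2 : μHE[2] (L '' t) ≤ (C : ℝ≥0∞) ^ 2 * μHE[2] (g '' t) := by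
    refine euclideanHausdorffMeasure_image_le_of_edist_le 2 fun a ha b hb => ?_
    rw [edist_eq_enorm_sub, edist_eq_enorm_sub, ← ofReal_norm, ← ofReal_norm,
      ← ENNReal.ofReal_coe_nnreal, ← ENNReal.ofReal_mul (by positivity)]
    exact ENNReal.ofReal_le_ofReal (hest a ha b hb).2
  have e3 : μHE[2] (L '' t) = ∫⁻ _ in t, ‖crossPartials g y‖ₑ := by
    rw [euclideanHausdorffMeasure_image_linear, setLIntegral_const]; rfl
  have e4 : ∫⁻ _ in t, ‖crossPartials g y‖ₑ ≤ C * ∫⁻ z in t, ‖crossPartials g z‖ₑ := by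
    rw [← lintegral_const_mul' _ _ ENNReal.coe_ne_top]
    refine setLIntegral_mono' htm fun z hz => ?_
    rw [← ofReal_norm, ← ofReal_norm, ← ENNReal.ofReal_coe_nnreal,
      ← ENNReal.ofReal_mul (by positivity)]
    exact ENNReal.ofReal_le_ofReal (ht hz).2.2.le
  have e5 : ∫⁻ z in t, ‖crossPartials g z‖ₑ ≤ C * ∫⁻ _ in t, ‖crossPartials g y‖ₑ := by
    rw [← lintegral_const_mul' _ _ ENNReal.coe_ne_top]
    refine setLIntegral_mono' htm fun z hz => ?_
    rw [← ofReal_norm, ← ofReal_norm, ← ENNReal.ofReal_coe_nnreal,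
      ← ENNReal.ofReal_mul (by positivity)]
    exact ENNReal.ofReal_le_ofReal (ht hz).2.1.le
  constructor
  · calc μHE[2] (g '' t) ≤ (C : ℝ≥0∞) ^ 2 * (C * ∫⁻ z in t, ‖crossPartials g z‖ₑ) := by
          refine e1.trans ?_
          rw [e3]; gcongr
      _ = _ := by ring
  · calc ∫⁻ z in t, ‖crossPartials g z‖ₑ ≤ C * ((C : ℝ≥0∞) ^ 2 * μHE[2] (g '' t)) := by
          refine e5.trans ?_
          rw [← e3]; gcongr
      _ = _ := by ring

theorem ENNReal.le_of_forall_one_lt_le_pow_mul {a b : ℝ≥0∞} (n : ℕ)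
    (h : ∀ C : ℝ≥0, 1 < C → a ≤ (C : ℝ≥0∞) ^ n * b) : a ≤ b := by
  have h1 : Filter.Tendsto (fun C : ℝ≥0 => (C : ℝ≥0∞) ^ n * b) (𝓝[>] 1) (𝓝 ((1 : ℝ≥0∞) ^ n * b)) := by
    refine ENNReal.Tendsto.mul_const ?_ (Or.inl (by simp))
    refine Filter.Tendsto.mono_left ?_ nhdsWithin_le_nhds
    exact ENNReal.Tendsto.pow (ENNReal.continuous_coe.tendsto (1 : ℝ≥0))
  rw [one_pow, one_mul] at h1
  exact ge_of_tendsto h1 (eventually_nhdsWithin_of_forall fun C hC => h C hC)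

theorem IsRegularOn.measurableSet_image {g : ℝ × ℝ → E3} {U s : Set (ℝ × ℝ)}
    (hg : IsRegularOn g U) (hs : MeasurableSet s) (hsU : s ⊆ U) (hinj : InjOn g s) :
    MeasurableSet (g '' s) :=
  hs.image_of_continuousOn_injOn (hg.continuousOn.mono hsU) hinj

/-- The area formula for an injective regular parametrization. -/
theorem IsRegularOn.euclideanHausdorffMeasure_image {g : ℝ × ℝ → E3} {U s : Set (ℝ × ℝ)}
    (hg : IsRegularOn g U) (hs : MeasurableSet s) (hsU : s ⊆ U) (hinj : InjOn g s) :
    μHE[2] (g '' s) = ∫⁻ y in s, ‖crossPartials g y‖ₑ := by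
  -- Both comparisons hold on small pieces and add up over a countable partition; equality follows
  -- as `C` tends to `1`.
  have key : ∀ C : ℝ≥0, 1 < C →
      μHE[2] (g '' s) ≤ (C : ℝ≥0∞) ^ 3 * ∫⁻ z in s, ‖crossPartials g z‖ₑ ∧
      ∫⁻ z in s, ‖crossPartials g z‖ₑ ≤ (C : ℝ≥0∞) ^ 3 * μHE[2] (g '' s) := by
    intro C hC
    obtain ⟨t, htd, htm, htu, htP⟩ := exists_measurable_partition hs
      (fun a => ∀ t ⊆ a, MeasurableSet t →
        μHE[2] (g '' t) ≤ (C : ℝ≥0∞) ^ 3 * ∫⁻ z in t, ‖crossPartials g z‖ₑ ∧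
        ∫⁻ z in t, ‖crossPartials g z‖ₑ ≤ (C : ℝ≥0∞) ^ 3 * μHE[2] (g '' t))
      (fun a b hab hb t ht htm => hb t (ht.trans hab) htm)
      (fun t ht _ => by
        obtain rfl := subset_empty_iff.1 ht
        simp)
      (fun x hx => by
        obtain ⟨N, hN, h⟩ := hg.exists_nhds_area_comparison (hsU hx) hC
        exact ⟨N, hN, fun t ht htm => h t (ht.trans inter_subset_left) htm⟩)
    have hts (n) : t n ⊆ s := htu ▸ subset_iUnion t n
    have h1 : μHE[2] (g '' s) = ∑' n, μHE[2] (g '' t n) := by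
      conv_lhs => rw [← htu, image_iUnion]
      refine measure_iUnion (fun i j hij => ?_) fun n =>
        hg.measurableSet_image (htm n) ((hts n).trans hsU) (hinj.mono (hts n))
      exact (htd hij).image hinj (hts i) (hts j)
    have h2 : ∫⁻ z in s, ‖crossPartials g z‖ₑ = ∑' n, ∫⁻ z in t n, ‖crossPartials g z‖ₑ := by
      conv_lhs => rw [← htu]
      exact lintegral_iUnion htm htd _
    rw [h1, h2, ← ENNReal.tsum_mul_left, ← ENNReal.tsum_mul_left]
    exact ⟨ENNReal.tsum_le_tsum fun n => (htP n _ subset_rfl (htm n)).1,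
      ENNReal.tsum_le_tsum fun n => (htP n _ subset_rfl (htm n)).2⟩
  exact le_antisymm (ENNReal.le_of_forall_one_lt_le_pow_mul 3 fun C hC => (key C hC).1)
    (ENNReal.le_of_forall_one_lt_le_pow_mul 3 fun C hC => (key C hC).2)

/-! ### Radial projection and the area of subsets of the sphere. -/

/-- The point of the unit sphere in the direction of `z` (a junk value for `z = 0`). -/
noncomputable def radial (z : E3) : UnitSphere :=
  if hz : z = 0 then ⟨EuclideanSpace.single 0 1, by simp⟩
  else ⟨‖z‖⁻¹ • z, by simp [norm_smul, hz]⟩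

theorem coe_radial {z : E3} (hz : z ≠ 0) : (radial z : E3) = ‖z‖⁻¹ • z := by
  simp [radial, hz]

theorem radial_smul {t : ℝ} (ht : 0 < t) (z : E3) : radial (t • z) = radial z := by
  by_cases hz : z = 0
  · simp [hz]
  · ext1
    rw [coe_radial hz, coe_radial (smul_ne_zero ht.ne' hz), norm_smul, smul_smul]
    congr 1
    rw [Real.norm_of_nonneg ht.le, mul_inv, mul_assoc, mul_comm, mul_assoc, mul_inv_cancel₀ ht.ne',
      mul_one]

theorem radial_coe (q : UnitSphere) : radial (q : E3) = q := by
  have hq : ‖(q : E3)‖ = 1 := by simp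
  have h0 : (q : E3) ≠ 0 := by
    intro h; rw [h] at hq; simp at hq
  ext1
  rw [coe_radial h0, hq]; simp

theorem norm_smul_radial (z : E3) : ‖z‖ • (radial z : E3) = z := by
  by_cases hz : z = 0
  · simp [hz]
  · rw [coe_radial hz, smul_smul, mul_inv_cancel₀ (norm_ne_zero_iff.2 hz), one_smul]

theorem continuousOn_radial : ContinuousOn radial {0}ᶜ := by
  rw [Topology.IsInducing.subtypeVal.continuousOn_iff]
  refine ContinuousOn.congr (f := fun z : E3 => ‖z‖⁻¹ • z) ?_ fun z hz => coe_radial hz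
  exact (continuous_norm.continuousOn.inv₀ fun z hz => norm_ne_zero_iff.2 hz).smul continuousOn_id

theorem measurable_radial : Measurable radial := by
  have h : Measurable fun z : E3 => (radial z : E3) := by
    have : (fun z : E3 => (radial z : E3)) =
        fun z => if z = 0 then EuclideanSpace.single 0 1 else ‖z‖⁻¹ • z := by
      ext1 z
      by_cases hz : z = 0
      · simp [hz, radial]
      · simp [hz, coe_radial]
    rw [this]
    exact Measurable.ite (measurableSet_singleton 0) measurable_const (by fun_prop)
  exact Measurable.subtype_mk h

instance : IsFiniteMeasure sphereArea := by
  unfold sphereArea; infer_instance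

theorem measurePreserving_polar :
    MeasurePreserving (homeomorphUnitSphereProd E3) ((volume : Measure E3).comap (↑))
      (sphereArea.prod (Measure.volumeIoiPow 2)) := by
  have := (volume : Measure E3).measurePreserving_homeomorphUnitSphereProd
  simpa [sphereArea] using this

/-- In polar coordinates the unit cone over `A` is `A × (0, 1)`, whose measure is a third of the
area of `A`. No measurability of `A` is needed, since polar coordinates are a measurable embedding.
-/
theorem sphereArea_eq_zero_of_cone {A : Set UnitSphere}
    (h : volume (Ioo (0 : ℝ) 1 • (Subtype.val '' A : Set E3)) = 0) : sphereArea A = 0 := by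
  have h1 := Measure.toSphere_apply_aux (volume : Measure E3) A ⟨1, mem_Ioi.2 one_pos⟩
  rw [h] at h1
  have h2 := measurePreserving_polar.measure_preimage_emb
    (homeomorphUnitSphereProd E3).measurableEmbedding (A ×ˢ Iio ⟨1, mem_Ioi.2 one_pos⟩)
  rw [comap_subtype_coe_apply (measurableSet_singleton _).compl, h1, Measure.prod_prod,
    Measure.volumeIoiPow_apply_Iio] at h2
  refine (mul_eq_zero.1 h2.symm).resolve_right ?_
  norm_num

theorem det_eq_inner_cross3 (L : E3 →L[ℝ] E3) :
    L.det = inner ℝ (L (EuclideanSpace.single 0 1))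
      (cross3 (L (EuclideanSpace.single 1 1)) (L (EuclideanSpace.single 2 1))) := by
  rw [ContinuousLinearMap.det, ← LinearMap.det_toMatrix (EuclideanSpace.basisFun (Fin 3) ℝ).toBasis,
    Matrix.det_fin_three, inner_eq_sum3]
  simp [LinearMap.toMatrix_apply]
  ring

/-- The linear projection onto the last two coordinates. -/
noncomputable def lastTwo : E3 →L[ℝ] ℝ × ℝ :=
  (EuclideanSpace.proj (1 : Fin 3)).prod (EuclideanSpace.proj (2 : Fin 3))

theorem lastTwo_apply (z : E3) : lastTwo z = (z 1, z 2) := rfl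

/-- The cone over a parametrized surface. -/
noncomputable def coneMap (k : ℝ × ℝ → E3) (z : E3) : E3 := z 0 • k (lastTwo z)

theorem hasFDerivAt_coneMap {k : ℝ × ℝ → E3} {z : E3} (hk : DifferentiableAt ℝ k (lastTwo z)) :
    HasFDerivAt (coneMap k) (z 0 • ((fderiv ℝ k (lastTwo z)).comp lastTwo) +
      (EuclideanSpace.proj (0 : Fin 3) : E3 →L[ℝ] ℝ).smulRight (k (lastTwo z))) z := by
  have h1 : HasFDerivAt (fun z : E3 => z 0) (EuclideanSpace.proj (0 : Fin 3) : E3 →L[ℝ] ℝ) z :=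
    (EuclideanSpace.proj (0 : Fin 3) : E3 →L[ℝ] ℝ).hasFDerivAt
  have h2 : HasFDerivAt (fun z : E3 => k (lastTwo z)) ((fderiv ℝ k (lastTwo z)).comp lastTwo) z :=
    hk.hasFDerivAt.comp z lastTwo.hasFDerivAt
  exact h1.smul h2

theorem det_coneMap {k : ℝ × ℝ → E3} {z : E3} :
    (z 0 • ((fderiv ℝ k (lastTwo z)).comp lastTwo) +
      (EuclideanSpace.proj (0 : Fin 3) : E3 →L[ℝ] ℝ).smulRight (k (lastTwo z))).det =
    z 0 ^ 2 * inner ℝ (k (lastTwo z)) (crossPartials k (lastTwo z)) := by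
  rw [det_eq_inner_cross3, crossPartials_eq]
  have e0 : lastTwo (EuclideanSpace.single 0 1) = 0 := by simp [lastTwo_apply]
  have e1 : lastTwo (EuclideanSpace.single 1 1) = (1, 0) := by simp [lastTwo_apply]
  have e2 : lastTwo (EuclideanSpace.single 2 1) = (0, 1) := by simp [lastTwo_apply]
  simp [e0, e1, e2, inner_eq_sum3]
  ring

theorem volume_preserving_coords :
    ∃ e : E3 ≃ᵐ ℝ × (ℝ × ℝ), MeasurePreserving e ∧ ∀ z, e z = (z 0, lastTwo z) := by
  let e1 := (MeasurableEquiv.toLp 2 (Fin 3 → ℝ)).symm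
  let e2 := MeasurableEquiv.piFinSuccAbove (fun _ : Fin 3 => ℝ) 0
  let e3 := (MeasurableEquiv.refl ℝ).prodCongr (MeasurableEquiv.finTwoArrow (α := ℝ))
  refine ⟨e1.trans (e2.trans e3), ?_, fun z => ?_⟩
  · exact ((((MeasurePreserving.id _).prod (volume_preserving_finTwoArrow ℝ)).comp
      (volume_preserving_piFinSuccAbove (fun _ : Fin 3 => ℝ) 0))).comp
      (PiLp.volume_preserving_ofLp (Fin 3))
  · rfl

theorem cone_image {k : ℝ × ℝ → E3} {s : Set (ℝ × ℝ)} {A : Set UnitSphere}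
    (hA : Subtype.val '' A = k '' s) :
    Ioo (0 : ℝ) 1 • (Subtype.val '' A : Set E3) =
      coneMap k '' {z | z 0 ∈ Ioo (0 : ℝ) 1 ∧ lastTwo z ∈ s} := by
  obtain ⟨e, -, he⟩ := volume_preserving_coords
  rw [hA]
  ext x
  simp only [Set.mem_smul, mem_image, mem_ofPred_eq]
  constructor
  · rintro ⟨t, ht, _, ⟨y, hy, rfl⟩, rfl⟩
    have h := he (e.symm (t, y))
    rw [e.apply_symm_apply] at h
    obtain ⟨h1, h2⟩ := Prod.ext_iff.1 h
    simp only at h1 h2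
    refine ⟨e.symm (t, y), ⟨h1 ▸ ht, h2 ▸ hy⟩, ?_⟩
    rw [coneMap, ← h1, ← h2]
  · rintro ⟨z, ⟨h1, h2⟩, rfl⟩
    exact ⟨z 0, h1, _, ⟨_, h2, rfl⟩, rfl⟩

/-- The cone over `A` is the image under `coneMap k` of a null set, or of a set of critical points;
the latter image is null by Sard's theorem. -/
theorem sphereArea_eq_zero_of_param {k : ℝ × ℝ → E3} {s : Set (ℝ × ℝ)} {A : Set UnitSphere}
    (hA : Subtype.val '' A = k '' s) (hk : ∀ y ∈ s, DifferentiableAt ℝ k y)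
    (h : volume s = 0 ∨ ∀ y ∈ s, inner ℝ (k y) (crossPartials k y) = 0) : sphereArea A = 0 := by
  apply sphereArea_eq_zero_of_cone
  rw [cone_image hA]
  rcases h with h | h
  · refine addHaar_image_eq_zero_of_differentiableOn_of_addHaar_eq_zero _ (fun z hz =>
      (hasFDerivAt_coneMap (hk _ hz.2)).differentiableAt.differentiableWithinAt) ?_
    obtain ⟨e, hmp, he⟩ := volume_preserving_coords
    refine measure_mono_null (t := e ⁻¹' (univ ×ˢ s)) (fun z hz => ?_) ?_
    · simp only [mem_preimage, he]
      exact ⟨mem_univ _, hz.2⟩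
    · rw [hmp.measure_preimage_emb e.measurableEmbedding, Measure.volume_eq_prod,
        Measure.prod_prod, h, mul_zero]
  · refine addHaar_image_eq_zero_of_det_fderivWithin_eq_zero _ (fun z hz =>
      (hasFDerivAt_coneMap (hk _ hz.2)).hasFDerivWithinAt) fun z hz => ?_
    rw [det_coneMap, h _ hz.2, mul_zero]

/-- Sphere area is three times the volume of the unit cone. Changing variables in the cone gives the
Jacobian `t² ⟪k, k_u × k_v⟫`, and `∫ t² = 1/3` cancels the factor three. -/
theorem sphereArea_param {k : ℝ × ℝ → E3} {s : Set (ℝ × ℝ)} {A : Set UnitSphere}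
    (hAm : MeasurableSet A) (hA : Subtype.val '' A = k '' s) (hs : MeasurableSet s)
    (hk : ∀ y ∈ s, DifferentiableAt ℝ k y) (hinj : InjOn k s)
    (hJ : AEMeasurable (fun y => ‖inner ℝ (k y) (crossPartials k y)‖ₑ) (volume.restrict s)) :
    sphereArea A = ∫⁻ y in s, ‖inner ℝ (k y) (crossPartials k y)‖ₑ := by
  have hk1 : ∀ y ∈ s, ‖k y‖ = 1 := by
    intro y hy
    obtain ⟨q, -, hq⟩ := hA ▸ mem_image_of_mem k hy
    rw [← hq]; simp
  obtain ⟨e, hmp, he⟩ := volume_preserving_coords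
  set D : Set E3 := {z | z 0 ∈ Ioo (0 : ℝ) 1 ∧ lastTwo z ∈ s}
  have hDe : D = e ⁻¹' (Ioo 0 1 ×ˢ s) := by
    ext z; simp only [mem_preimage, he]; rfl
  have hDm : MeasurableSet D := hDe ▸ e.measurable (measurableSet_Ioo.prod hs)
  have hDinj : InjOn (coneMap k) D := by
    intro z hz w hw hzw
    have h0 : z 0 = w 0 := by
      have := congrArg norm hzw
      simpa [coneMap, norm_smul, hk1 _ hz.2, hk1 _ hw.2, abs_of_pos hz.1.1, abs_of_pos hw.1.1]
        using this
    have h1 : lastTwo z = lastTwo w := by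
      apply hinj hz.2 hw.2
      simp only [coneMap, h0] at hzw
      exact smul_right_injective E3 hw.1.1.ne' hzw
    apply e.injective
    rw [he, he, h0, h1]
  have h1 := lintegral_abs_det_fderiv_eq_addHaar_image volume hDm (fun z hz =>
      (hasFDerivAt_coneMap (hk _ hz.2)).hasFDerivWithinAt) hDinj
  have h2 : ∀ z, ENNReal.ofReal |(z 0 ^ 2 * inner ℝ (k (lastTwo z)) (crossPartials k (lastTwo z)) : ℝ)|
      = (fun w : ℝ × (ℝ × ℝ) => ENNReal.ofReal (w.1 ^ 2) *
        ‖inner ℝ (k w.2) (crossPartials k w.2)‖ₑ) (e z) := by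
    intro z
    simp only [he]
    rw [abs_mul, abs_of_nonneg (sq_nonneg _), ENNReal.ofReal_mul (sq_nonneg _),
      Real.enorm_eq_ofReal_abs]
  simp only [det_coneMap, h2] at h1
  rw [sphereArea, Measure.toSphere_apply' _ hAm, cone_image hA, ← h1, hDe,
    hmp.setLIntegral_comp_preimage_emb e.measurableEmbedding (fun w : ℝ × (ℝ × ℝ) =>
      ENNReal.ofReal (w.1 ^ 2) * ‖inner ℝ (k w.2) (crossPartials k w.2)‖ₑ), Measure.volume_eq_prod,
    ← Measure.prod_restrict, lintegral_prod_mul (f := fun t : ℝ => ENNReal.ofReal (t ^ 2))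
      (g := fun y => ‖inner ℝ (k y) (crossPartials k y)‖ₑ) (by fun_prop) hJ, ← mul_assoc]
  have h3 : ∫⁻ t in Ioo (0 : ℝ) 1, ENNReal.ofReal (t ^ 2) = ENNReal.ofReal (1 / 3) := by
    rw [← ofReal_integral_eq_lintegral_ofReal]
    · rw [← integral_Ioc_eq_integral_Ioo, ← intervalIntegral.integral_of_le zero_le_one]
      norm_num
    · exact (continuous_pow 2).integrableOn_Icc.mono_set Ioo_subset_Icc_self
    · exact Filter.Eventually.of_forall fun t => sq_nonneg t
  rw [h3]
  have h4 : (Module.finrank ℝ E3 : ℝ≥0∞) * ENNReal.ofReal (1 / 3) = 1 := by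
    rw [finrank_euclideanSpace_fin, ← ENNReal.ofReal_natCast, ← ENNReal.ofReal_mul (by positivity)]
    norm_num
  rw [h4, one_mul]

/-! ### The solid angle as the Jacobian of the radial projection. -/

/-- The radial projection of a parametrized surface to the unit sphere around `p`, as a map into
space. -/
noncomputable def radialParam (g : ℝ × ℝ → E3) (p : E3) (y : ℝ × ℝ) : E3 :=
  ‖g y - p‖⁻¹ • (g y - p)

/-- The solid angle density of a parametrized surface with respect to the parameter. -/
noncomputable def solidAngleJacobian (g : ℝ × ℝ → E3) (p : E3) (y : ℝ × ℝ) : ℝ :=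
  inner ℝ (g y - p) (crossPartials g y) / ‖g y - p‖ ^ 3

theorem contDiffAt_radialParam {g : ℝ × ℝ → E3} {p : E3} {y : ℝ × ℝ} {n : WithTop ℕ∞}
    (hg : ContDiffAt ℝ n g y) (hp : g y ≠ p) : ContDiffAt ℝ n (radialParam g p) y := by
  have h1 : ContDiffAt ℝ n (fun y => g y - p) y := hg.sub contDiffAt_const
  have h0 : g y - p ≠ 0 := sub_ne_zero.2 hp
  exact ((h1.norm ℝ h0).inv (norm_ne_zero_iff.2 h0)).smul h1

/-- Differentiating the factor `|g - p|⁻¹` only adds multiples of `g - p` to the partial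
derivatives, and these drop out of the triple product with `g - p`. -/
theorem inner_crossPartials_radialParam {g : ℝ × ℝ → E3} {p : E3} {y : ℝ × ℝ}
    (hg : DifferentiableAt ℝ g y) (hp : g y ≠ p) :
    inner ℝ (radialParam g p y) (crossPartials (radialParam g p) y) =
      solidAngleJacobian g p y := by
  have h0 : g y - p ≠ 0 := sub_ne_zero.2 hp
  have h1 : DifferentiableAt ℝ (fun y => g y - p) y := hg.sub_const p
  have h2 : DifferentiableAt ℝ (fun y => ‖g y - p‖⁻¹) y :=
    (h1.norm ℝ h0).inv (norm_ne_zero_iff.2 h0)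
  have h3 : fderiv ℝ (radialParam g p) y = ‖g y - p‖⁻¹ • fderiv ℝ g y +
      (fderiv ℝ (fun y => ‖g y - p‖⁻¹) y).smulRight (g y - p) := by
    have := fderiv_fun_smul h2 h1
    rw [fderiv_sub_const] at this
    exact this
  rw [crossPartials_eq, h3, solidAngleJacobian, crossPartials_eq]
  have h4 : ‖g y - p‖ ≠ 0 := norm_ne_zero_iff.2 h0
  simp only [inner_eq_sum3, cross3_zero, cross3_one, cross3_two, radialParam,
    add_apply, smul_apply,
    ContinuousLinearMap.smulRight_apply, PiLp.add_apply, PiLp.smul_apply, PiLp.sub_apply,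
    smul_eq_mul]
  field_simp
  ring

theorem coe_radial_param {g : ℝ × ℝ → E3} {p : E3} {y : ℝ × ℝ} (hp : g y ≠ p) :
    (radial (g y - p) : E3) = radialParam g p y := coe_radial (sub_ne_zero.2 hp)

theorem coe_image_radial {g : ℝ × ℝ → E3} {p : E3} {s : Set (ℝ × ℝ)} (hp : ∀ y ∈ s, g y ≠ p) :
    Subtype.val '' ((fun y => radial (g y - p)) '' s) = radialParam g p '' s := by
  rw [image_image]
  exact image_congr fun y hy => coe_radial_param (hp y hy)

theorem IsRegularOn.continuousOn_solidAngleJacobian {g : ℝ × ℝ → E3} {U s : Set (ℝ × ℝ)} {p : E3}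
    (hg : IsRegularOn g U) (hsU : s ⊆ U) (hp : ∀ y ∈ s, g y ≠ p) :
    ContinuousOn (solidAngleJacobian g p) s := by
  have h1 : ContinuousOn (fun y => g y - p) s := (hg.continuousOn.mono hsU).sub continuousOn_const
  refine (h1.inner (hg.continuousOn_crossPartials.mono hsU)).div (h1.norm.pow 3) fun y hy => ?_
  exact pow_ne_zero _ (norm_ne_zero_iff.2 (sub_ne_zero.2 (hp y hy)))

theorem IsRegularOn.sphereArea_image {g : ℝ × ℝ → E3} {U s : Set (ℝ × ℝ)} {p : E3}
    (hg : IsRegularOn g U) (hs : MeasurableSet s) (hsU : s ⊆ U) (hp : ∀ y ∈ s, g y ≠ p)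
    (hinj : InjOn (fun y => radial (g y - p)) s) :
    MeasurableSet ((fun y => radial (g y - p)) '' s) ∧
    sphereArea ((fun y => radial (g y - p)) '' s) = ∫⁻ y in s, ‖solidAngleJacobian g p y‖ₑ := by
  have hcont : ContinuousOn (fun y => radial (g y - p)) s :=
    continuousOn_radial.comp ((hg.continuousOn.mono hsU).sub continuousOn_const)
      fun y hy => sub_ne_zero.2 (hp y hy)
  have hm := hs.image_of_continuousOn_injOn hcont hinj
  have heq : ∀ y ∈ s, inner ℝ (radialParam g p y) (crossPartials (radialParam g p) y) =
      solidAngleJacobian g p y := fun y hy =>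
    inner_crossPartials_radialParam (hg.differentiableAt (hsU hy)) (hp y hy)
  refine ⟨hm, ?_⟩
  rw [sphereArea_param hm (coe_image_radial hp) hs]
  · exact setLIntegral_congr_fun hs fun y hy => by simp only [heq y hy]
  · exact fun y hy => (contDiffAt_radialParam (hg.contDiffAt (hsU hy)) (hp y hy)).differentiableAt
      (by simp)
  · intro y hy z hz hyz
    apply hinj hy hz
    ext1
    simpa only [coe_radial_param (hp y hy), coe_radial_param (hp z hz)] using hyz
  · refine AEMeasurable.congr (f := fun y => ‖solidAngleJacobian g p y‖ₑ) ?_ ?_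
    · exact ((hg.continuousOn_solidAngleJacobian hsU hp).aemeasurable hs).enorm
    · filter_upwards [ae_restrict_mem hs] with y hy
      rw [heq y hy]

theorem sphereArea_image_eq_zero {g : ℝ × ℝ → E3} {s : Set (ℝ × ℝ)} {p : E3}
    (hg : ∀ y ∈ s, DifferentiableAt ℝ g y) (hp : ∀ y ∈ s, g y ≠ p)
    (h : volume s = 0 ∨ ∀ y ∈ s, solidAngleJacobian g p y = 0) :
    sphereArea ((fun y => radial (g y - p)) '' s) = 0 := by
  refine sphereArea_eq_zero_of_param (coe_image_radial hp) (fun y hy => ?_)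
    (h.imp_right fun h y hy => ?_)
  · have h1 : DifferentiableAt ℝ (fun y => g y - p) y := (hg y hy).sub_const p
    have h0 : g y - p ≠ 0 := sub_ne_zero.2 (hp y hy)
    exact ((h1.norm ℝ h0).inv (norm_ne_zero_iff.2 h0)).smul h1
  · rw [inner_crossPartials_radialParam (hg y hy) (hp y hy), h y hy]

theorem sphereArea_singleton (q : UnitSphere) : sphereArea {q} = 0 := by
  have h := sphereArea_image_eq_zero (g := fun _ => (q : E3)) (s := {0}) (p := 0)
    (fun y _ => differentiableAt_const _) (fun y _ h => ?_) (Or.inl (by simp))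
  · simpa [radial_coe] using h
  · have := congrArg norm h
    simp at this

/-- A nonzero solid angle Jacobian makes the projected map an immersion at `y`, hence injective
nearby. -/
theorem IsRegularOn.exists_injOn_radial {g : ℝ × ℝ → E3} {U : Set (ℝ × ℝ)} {p : E3}
    (hg : IsRegularOn g U) {y : ℝ × ℝ} (hy : y ∈ U) (hp : g y ≠ p)
    (hJ : solidAngleJacobian g p y ≠ 0) :
    ∃ N ∈ 𝓝 y, InjOn (fun y => radial (g y - p)) N := by
  have hreg : crossPartials (radialParam g p) y ≠ 0 := by
    intro h
    rw [← inner_crossPartials_radialParam (hg.differentiableAt hy) hp, h, inner_zero_right] at hJ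
    exact hJ rfl
  set L := fderiv ℝ (radialParam g p) y
  have hLinj : Function.Injective L := injective_of_cross3_ne_zero hreg
  obtain ⟨K, hK0, hK⟩ := (L : ℝ × ℝ →ₗ[ℝ] E3).exists_antilipschitzWith
    (LinearMap.ker_eq_bot.2 hLinj)
  have hKr : (0 : ℝ) < K := by exact_mod_cast hK0
  have hstrict : HasStrictFDerivAt (radialParam g p) L y :=
    (contDiffAt_radialParam (hg.contDiffAt hy) hp).hasStrictFDerivAt (by simp)
  -- With this constant, two points having the same projection satisfy `|a - b| ≤ |a - b| / 2`.
  obtain ⟨N, hN, happ⟩ := hstrict.approximates_deriv_on_nhds (c := (2 * K)⁻¹)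
    (Or.inr (by positivity))
  have hN2 : ∀ᶠ z in 𝓝 y, g z ≠ p :=
    (hg.differentiableAt hy).continuousAt.eventually_ne hp
  refine ⟨N ∩ {z | g z ≠ p}, Filter.inter_mem hN hN2, fun a ha b hb hab => ?_⟩
  have hab' : radialParam g p a = radialParam g p b := by
    rw [← coe_radial_param ha.2, ← coe_radial_param hb.2]
    exact congrArg _ hab
  have h1 := happ _ ha.1 _ hb.1
  rw [hab', sub_self, zero_sub, norm_neg] at h1
  have h2 : ‖a - b‖ ≤ K * ‖L (a - b)‖ := by
    simpa [dist_eq_norm] using hK.le_mul_dist a b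
  have h3 : ‖a - b‖ ≤ 1 / 2 * ‖a - b‖ := by
    calc ‖a - b‖ ≤ K * (((2 * K)⁻¹ : ℝ≥0) * ‖a - b‖) := h2.trans (by gcongr)
      _ = 1 / 2 * ‖a - b‖ := by
        push_cast
        field_simp
  have h4 : ‖a - b‖ = 0 := by linarith [norm_nonneg (a - b)]
  exact sub_eq_zero.1 (norm_eq_zero.1 h4)

theorem ContinuousOn.measurableSet_inter_preimage {X Y : Type*} [TopologicalSpace X]
    [MeasurableSpace X] [OpensMeasurableSpace X] [TopologicalSpace Y] [MeasurableSpace Y]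
    [BorelSpace Y] {f : X → Y} {s : Set X} (hf : ContinuousOn f s) (hs : MeasurableSet s)
    {B : Set Y} (hB : MeasurableSet B) : MeasurableSet (s ∩ f ⁻¹' B) := by
  have h1 : Measurable (s.domRestrict f) := (continuousOn_iff_continuous_domRestrict.1 hf).measurable
  have h2 := (MeasurableEmbedding.subtype_coe hs).measurableSet_image.2 (h1 hB)
  convert h2 using 1
  ext y; simp [and_comm]

/-! ### Integration over parametrized surfaces. -/

section AreaFormula

variable {g : ℝ × ℝ → E3} {U s : Set (ℝ × ℝ)}

/-- The area formula as an identity of measures. The parametrization is a measurable embedding, so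
integrals of arbitrary functions can be transported without a measurability assumption. -/
theorem IsRegularOn.map_domRestrict (hg : IsRegularOn g U) (hs : MeasurableSet s) (hsU : s ⊆ U)
    (hinj : InjOn g s) :
    Measure.map (s.domRestrict g)
      (Measure.comap (↑) ((volume : Measure (ℝ × ℝ)).withDensity fun y => ‖crossPartials g y‖₊)) =
      (μHE[2] : Measure E3).restrict (g '' s) := by
  have hcont : ContinuousOn g s := hg.continuousOn.mono hsU
  have hemb := hcont.measurableEmbedding hs hinj
  ext t ht
  rw [hemb.map_apply, (MeasurableEmbedding.subtype_coe hs).comap_apply, Measure.restrict_apply ht]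
  have h1 : Subtype.val '' (s.domRestrict g ⁻¹' t) = s ∩ g ⁻¹' t := by
    ext y; simp [and_comm]
  have hm : MeasurableSet (s ∩ g ⁻¹' t) := by
    rw [← h1]; exact (MeasurableEmbedding.subtype_coe hs).measurableSet_image.2 (hemb.measurable ht)
  have h2 : t ∩ g '' s = g '' (s ∩ g ⁻¹' t) := by
    rw [inter_comm, image_inter_preimage]
  rw [h1, h2, withDensity_apply _ hm, hg.euclideanHausdorffMeasure_image hm
    (inter_subset_left.trans hsU) (hinj.mono inter_subset_left)]
  rfl

theorem IsRegularOn.aemeasurable_nnnorm_crossPartials (hg : IsRegularOn g U)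
    (hs : MeasurableSet s) (hsU : s ⊆ U) :
    AEMeasurable (fun y => ‖crossPartials g y‖₊) (volume.restrict s) :=
  ((hg.continuousOn_crossPartials.mono hsU).aemeasurable hs).nnnorm

theorem IsRegularOn.lintegral_image (hg : IsRegularOn g U) (hs : MeasurableSet s) (hsU : s ⊆ U)
    (hinj : InjOn g s) (f : E3 → ℝ≥0∞) :
    ∫⁻ x in g '' s, f x ∂μHE[2] = ∫⁻ y in s, ‖crossPartials g y‖ₑ * f (g y) := by
  have hemb := (hg.continuousOn.mono hsU).measurableEmbedding hs hinj
  rw [← hg.map_domRestrict hs hsU hinj, hemb.lintegral_map]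
  simp only [Set.domRestrict_apply, ← Function.comp_apply (f := f)]
  rw [← (MeasurableEmbedding.subtype_coe hs).lintegral_map, map_comap_subtype_coe hs,
    setLIntegral_withDensity_eq_setLIntegral_mul_non_measurable₀ _ _ _ hs]
  · simp only [Pi.mul_apply]; rfl
  · simp
  · exact (hg.aemeasurable_nnnorm_crossPartials hs hsU).coe_nnreal_ennreal

theorem IsRegularOn.integral_image (hg : IsRegularOn g U) (hs : MeasurableSet s) (hsU : s ⊆ U)
    (hinj : InjOn g s) (f : E3 → ℝ) :
    ∫ x in g '' s, f x ∂μHE[2] = ∫ y in s, ‖crossPartials g y‖ * f (g y) := by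
  have hemb := (hg.continuousOn.mono hsU).measurableEmbedding hs hinj
  rw [← hg.map_domRestrict hs hsU hinj, hemb.integral_map]
  simp only [Set.domRestrict_apply, ← Function.comp_apply (f := f)]
  rw [← (MeasurableEmbedding.subtype_coe hs).integral_map, map_comap_subtype_coe hs,
    setIntegral_withDensity_eq_setIntegral_smul₀
      (hg.aemeasurable_nnnorm_crossPartials hs hsU) _ hs]
  rfl

end AreaFormula

/-! ### Sheets and their decomposition into radial pieces. -/

/-- A measurable set parametrized by an injective regular map inducing the normal field `n`. -/
structure IsSheet (n : E3 → E3) (g : ℝ × ℝ → E3) (U s : Set (ℝ × ℝ)) : Prop where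
  regular : IsRegularOn g U
  measurableSet : MeasurableSet s
  subset : s ⊆ U
  injOn : InjOn g s
  normal : ∀ y ∈ s, n (g y) = paramNormal g y

theorem IsSheet.mono {n : E3 → E3} {g : ℝ × ℝ → E3} {U s t : Set (ℝ × ℝ)} (h : IsSheet n g U s)
    (ht : MeasurableSet t) (hts : t ⊆ s) : IsSheet n g U t :=
  ⟨h.regular, ht, hts.trans h.subset, h.injOn.mono hts, fun y hy => h.normal y (hts hy)⟩

section Sheet

variable {n : E3 → E3} {g : ℝ × ℝ → E3} {U s : Set (ℝ × ℝ)} (h : IsSheet n g U s)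
include h

theorem IsSheet.measurableSet_image : MeasurableSet (g '' s) :=
  h.regular.measurableSet_image h.measurableSet h.subset h.injOn

theorem IsSheet.continuousOn_paramNormal : ContinuousOn (paramNormal g) s := by
  have h1 := h.regular.continuousOn_crossPartials.mono h.subset
  exact (h1.norm.inv₀ fun y hy => norm_ne_zero_iff.2 (h.regular.regular y (h.subset hy))).smul h1

theorem IsSheet.norm_normal {x : E3} (hx : x ∈ g '' s) : ‖n x‖ = 1 := by
  obtain ⟨y, hy, rfl⟩ := hx
  rw [h.normal y hy, paramNormal, norm_smul, norm_inv, norm_norm,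
    inv_mul_cancel₀ (norm_ne_zero_iff.2 (h.regular.regular y (h.subset hy)))]

theorem IsSheet.measurableSet_preimage {b : Set E3} (hb : MeasurableSet b) :
    MeasurableSet (s ∩ g ⁻¹' b) :=
  (h.regular.continuousOn.mono h.subset).measurableSet_inter_preimage h.measurableSet hb

/-- The normal field is an arbitrary function, but on a sheet it is the continuous `paramNormal g`
read through `g`, and injective continuous images of measurable sets are measurable. -/
theorem IsSheet.aemeasurable_normal :
    AEMeasurable n ((μHE[2] : Measure E3).restrict (g '' s)) := by
  have hm : Measurable ((g '' s).indicator n) := by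
    intro B hB
    have h0 : MeasurableSet (s ∩ paramNormal g ⁻¹' B) :=
      h.continuousOn_paramNormal.measurableSet_inter_preimage h.measurableSet hB
    have h1 : (g '' s).indicator n ⁻¹' B =
        g '' (s ∩ paramNormal g ⁻¹' B) ∪ ((g '' s)ᶜ ∩ {x | (0 : E3) ∈ B}) := by
      ext x
      by_cases hx : x ∈ g '' s
      · simp only [mem_preimage, indicator_of_mem hx, mem_union, mem_inter_iff, mem_compl_iff, hx,
          not_true_eq_false, false_and, or_false]
        constructor
        · intro hxB
          obtain ⟨y, hy, rfl⟩ := hx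
          exact ⟨y, ⟨hy, by rw [mem_preimage, ← h.normal y hy]; exact hxB⟩, rfl⟩
        · rintro ⟨y, ⟨hy, hyB⟩, rfl⟩
          rw [h.normal y hy]; exact hyB
      · have : x ∉ g '' (s ∩ paramNormal g ⁻¹' B) := fun hx' =>
          hx (image_mono inter_subset_left hx')
        simp [this, hx]
    rw [h1]
    refine MeasurableSet.union ?_ (h.measurableSet_image.compl.inter (MeasurableSet.const _))
    exact h.regular.measurableSet_image h0 (inter_subset_left.trans h.subset)
      (h.injOn.mono inter_subset_left)
  exact (aemeasurable_indicator_iff h.measurableSet_image).1 hm.aemeasurable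

theorem IsSheet.inner_normal {y : ℝ × ℝ} (hy : y ∈ s) (v : E3) :
    ‖crossPartials g y‖ * inner ℝ v (n (g y)) = inner ℝ v (crossPartials g y) := by
  rw [h.normal y hy, paramNormal, inner_smul_right, mul_inv_cancel_left₀
    (norm_ne_zero_iff.2 (h.regular.regular y (h.subset hy)))]

end Sheet

/-- The density of the solid angle subtended at `p` by a surface with normal field `n`. -/
noncomputable def angleDensity (n : E3 → E3) (p x : E3) : ℝ := inner ℝ (x - p) (n x) / ‖x - p‖ ^ 3

theorem IsSheet.angleDensity_eq {n : E3 → E3} {g : ℝ × ℝ → E3} {U s : Set (ℝ × ℝ)}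
    (h : IsSheet n g U s) (p : E3) {y : ℝ × ℝ} (hy : y ∈ s) :
    ‖crossPartials g y‖ * angleDensity n p (g y) = solidAngleJacobian g p y := by
  rw [angleDensity, solidAngleJacobian, ← mul_div_assoc, h.inner_normal hy]

/-- A measurable set on which the radial projection from `p` is injective, the surface is crossed
with constant sign `σ`, and the area of the projection is the solid angle. -/
structure IsRadialPiece (n : E3 → E3) (p : E3) (σ : SignType) (a : Set E3) : Prop where
  injOn : InjOn (fun x => radial (x - p)) a
  sign_eq : ∀ x ∈ a, SignType.sign (inner ℝ (x - p) (n x)) = σ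
  measurableSet_image : ∀ b ⊆ a, MeasurableSet b → MeasurableSet ((fun x => radial (x - p)) '' b)
  area_image : ∀ b ⊆ a, MeasurableSet b →
    sphereArea ((fun x => radial (x - p)) '' b) = ∫⁻ x in b, ‖angleDensity n p x‖ₑ ∂μHE[2]

/-- A piece of a surface: negligible as seen from `p`, or a radial piece. -/
structure IsPiece (n : E3 → E3) (p : E3) (a : Set E3) : Prop where
  measurableSet : MeasurableSet a
  aemeasurable : AEMeasurable n ((μHE[2] : Measure E3).restrict a)
  norm_eq : ∀ᵐ x ∂((μHE[2] : Measure E3).restrict a), ‖n x‖ = 1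
  cases' : (∃ σ, IsRadialPiece n p σ a) ∨ (sphereArea ((fun x => radial (x - p)) '' a) = 0 ∧
    ∀ᵐ x ∂((μHE[2] : Measure E3).restrict a), angleDensity n p x = 0)

theorem IsPiece.mono {n : E3 → E3} {p : E3} {a b : Set E3} (h : IsPiece n p a)
    (hb : MeasurableSet b) (hba : b ⊆ a) : IsPiece n p b where
  measurableSet := hb
  aemeasurable := h.aemeasurable.mono_set hba
  norm_eq := ae_restrict_of_ae_restrict_of_subset hba h.norm_eq
  cases' := by
    rcases h.cases' with ⟨σ, h1⟩ | ⟨h1, h2⟩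
    · exact Or.inl ⟨σ, h1.injOn.mono hba, fun x hx => h1.sign_eq x (hba hx),
        fun c hc => h1.measurableSet_image c (hc.trans hba),
        fun c hc => h1.area_image c (hc.trans hba)⟩
    · exact Or.inr ⟨measure_mono_null (image_mono hba) h1,
        ae_restrict_of_ae_restrict_of_subset hba h2⟩

theorem isPiece_of_null {n : E3 → E3} {p : E3} {a : Set E3} (ha : MeasurableSet a)
    (h0 : (μHE[2] : Measure E3) a = 0) (h1 : sphereArea ((fun x => radial (x - p)) '' a) = 0) :
    IsPiece n p a := by
  have : (μHE[2] : Measure E3).restrict a = 0 := Measure.restrict_eq_zero.2 h0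
  exact ⟨ha, by simp [this], by simp [this], Or.inr ⟨h1, by simp [this]⟩⟩

/-- A countable union of pieces. -/
def IsCountablePiece (n : E3 → E3) (p : E3) (a : Set E3) : Prop :=
  ∃ t : ℕ → Set E3, ⋃ i, t i = a ∧ ∀ i, IsPiece n p (t i)

theorem IsPiece.isCountablePiece {n : E3 → E3} {p : E3} {a : Set E3} (h : IsPiece n p a) :
    IsCountablePiece n p a := ⟨fun _ => a, iUnion_const a, fun _ => h⟩

theorem isCountablePiece_iUnion {n : E3 → E3} {p : E3} {a : ℕ → Set E3}
    (h : ∀ i, IsCountablePiece n p (a i)) : IsCountablePiece n p (⋃ i, a i) := by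
  choose t ht htp using h
  refine ⟨fun k => t (Nat.unpair k).1 (Nat.unpair k).2, ?_, fun k => htp _ _⟩
  ext x
  simp only [mem_iUnion, ← ht]
  constructor
  · rintro ⟨k, hk⟩; exact ⟨_, _, hk⟩
  · rintro ⟨i, j, hij⟩; exact ⟨Nat.pair i j, by simpa using hij⟩

theorem isPiece_empty (n : E3 → E3) (p : E3) : IsPiece n p ∅ :=
  isPiece_of_null MeasurableSet.empty (by simp) (by simp)

theorem isCountablePiece_union {n : E3 → E3} {p : E3} {a b : Set E3}
    (ha : IsCountablePiece n p a) (hb : IsCountablePiece n p b) :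
    IsCountablePiece n p (a ∪ b) := by
  rw [union_eq_iUnion]
  have : (⋃ c : Bool, cond c a b) = ⋃ i : ℕ, if i = 0 then a else b := by
    ext x
    simp only [mem_iUnion, Bool.exists_bool]
    constructor
    · rintro (h | h)
      · exact ⟨1, by simpa using h⟩
      · exact ⟨0, by simpa using h⟩
    · rintro ⟨i, h⟩
      split_ifs at h
      · exact Or.inr h
      · exact Or.inl h
  rw [this]
  refine isCountablePiece_iUnion fun i => ?_
  split_ifs
  exacts [ha, hb]

theorem IsCountablePiece.biUnion {n : E3 → E3} {p : E3} {ι : Type*} {c : Set ι} (hc : c.Countable)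
    {a : ι → Set E3} (h : ∀ i ∈ c, IsCountablePiece n p (a i)) :
    IsCountablePiece n p (⋃ i ∈ c, a i) := by
  rcases c.eq_empty_or_nonempty with rfl | hne
  · simpa using (isPiece_empty n p).isCountablePiece
  · obtain ⟨e, rfl⟩ := hc.exists_eq_range hne
    rw [biUnion_range]
    exact isCountablePiece_iUnion fun i => h _ ⟨i, rfl⟩

theorem IsSheet.isRadialPiece {n : E3 → E3} {g : ℝ × ℝ → E3} {U s : Set (ℝ × ℝ)} {p : E3}
    {σ : SignType} (h : IsSheet n g U s) (hp : ∀ y ∈ s, g y ≠ p)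
    (hinj : InjOn (fun y => radial (g y - p)) s)
    (hσ : ∀ y ∈ s, SignType.sign (solidAngleJacobian g p y) = σ) :
    IsRadialPiece n p σ (g '' s) := by
  have key : ∀ b ⊆ g '' s, MeasurableSet b → MeasurableSet ((fun x => radial (x - p)) '' b) ∧
      sphereArea ((fun x => radial (x - p)) '' b) = ∫⁻ x in b, ‖angleDensity n p x‖ₑ ∂μHE[2] := by
    intro b hb hbm
    have hs' := h.measurableSet_preimage hbm
    have hbe : b = g '' (s ∩ g ⁻¹' b) := by
      rw [image_inter_preimage, inter_eq_right.2 hb]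
    have h1 := h.regular.sphereArea_image (p := p) hs' (inter_subset_left.trans h.subset)
      (fun y hy => hp y hy.1) (hinj.mono inter_subset_left)
    have h2 := h.regular.lintegral_image hs' (inter_subset_left.trans h.subset)
      (h.injOn.mono inter_subset_left) (fun x => ‖angleDensity n p x‖ₑ)
    rw [← hbe] at h2
    have h3 : (fun x => radial (x - p)) '' b = (fun y => radial (g y - p)) '' (s ∩ g ⁻¹' b) := by
      conv_lhs => rw [hbe, image_image]
    rw [h3, h2]
    refine ⟨h1.1, h1.2.trans (setLIntegral_congr_fun hs' fun y hy => ?_)⟩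
    simp only [← h.angleDensity_eq p hy.1, enorm_mul, enorm_norm]
  refine ⟨?_, ?_, fun b hb hbm => (key b hb hbm).1, fun b hb hbm => (key b hb hbm).2⟩
  · rintro _ ⟨y, hy, rfl⟩ _ ⟨z, hz, rfl⟩ hyz
    rw [hinj hy hz hyz]
  · rintro _ ⟨y, hy, rfl⟩
    have hc : 0 < ‖crossPartials g y‖ := norm_pos_iff.2 (h.regular.regular y (h.subset hy))
    have hr : 0 < ‖g y - p‖ := norm_pos_iff.2 (sub_ne_zero.2 (hp y hy))
    rw [← hσ y hy, solidAngleJacobian, ← h.inner_normal hy, div_eq_mul_inv, sign_mul, sign_mul,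
      sign_pos hc, sign_pos (by positivity : 0 < (‖g y - p‖ ^ 3)⁻¹), one_mul, mul_one]

theorem IsSheet.isPiece_of_cases {n : E3 → E3} {g : ℝ × ℝ → E3} {U s : Set (ℝ × ℝ)} {p : E3}
    (h : IsSheet n g U s)
    (hc : (∃ σ, IsRadialPiece n p σ (g '' s)) ∨
      (sphereArea ((fun x => radial (x - p)) '' (g '' s)) = 0 ∧
        ∀ᵐ x ∂((μHE[2] : Measure E3).restrict (g '' s)), angleDensity n p x = 0)) :
    IsPiece n p (g '' s) :=
  ⟨h.measurableSet_image, h.aemeasurable_normal, by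
    filter_upwards [ae_restrict_mem h.measurableSet_image] with x hx using h.norm_normal hx, hc⟩

theorem IsSheet.isCountablePiece_of_sign {n : E3 → E3} {g : ℝ × ℝ → E3} {U s : Set (ℝ × ℝ)}
    {p : E3} {σ : SignType} (hσ0 : σ ≠ 0) (h : IsSheet n g U s) (hp : ∀ y ∈ s, g y ≠ p)
    (hσ : ∀ y ∈ s, SignType.sign (solidAngleJacobian g p y) = σ) :
    IsCountablePiece n p (g '' s) := by
  obtain ⟨t, -, htm, htu, ht⟩ := exists_measurable_partition h.measurableSet
    (fun a => InjOn (fun y => radial (g y - p)) a) (fun a b hab hb => hb.mono hab)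
    (injOn_empty _) (fun y hy => by
      obtain ⟨N, hN, hNi⟩ := h.regular.exists_injOn_radial (h.subset hy) (hp y hy)
        (fun h0 => hσ0 (by rw [← hσ y hy, h0, sign_zero]))
      exact ⟨N, hN, hNi.mono inter_subset_left⟩)
  have hts (i) : t i ⊆ s := htu ▸ subset_iUnion t i
  refine ⟨fun i => g '' t i, by rw [← image_iUnion, htu], fun i => ?_⟩
  have hi := h.mono (htm i) (hts i)
  exact hi.isPiece_of_cases (Or.inl ⟨σ, hi.isRadialPiece (fun y hy => hp y (hts i hy)) (ht i)
    fun y hy => hσ y (hts i hy)⟩)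

/-- Split by the sign of the Jacobian. Where it is nonzero the projection is locally injective and
countably many pieces suffice; the zero set has null projection and zero density. -/
theorem IsSheet.isCountablePiece {n : E3 → E3} {g : ℝ × ℝ → E3} {U s : Set (ℝ × ℝ)}
    {p : E3} (h : IsSheet n g U s) (hp : ∀ y ∈ s, g y ≠ p) : IsCountablePiece n p (g '' s) := by
  have hm (σ : SignType) :
      MeasurableSet (s ∩ {y | SignType.sign (solidAngleJacobian g p y) = σ}) := by
    have h2 : MeasurableSet {r : ℝ | SignType.sign r = σ} := by
      rcases σ with _ | _ | _
      · convert measurableSet_singleton (0 : ℝ) using 1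
        ext r; exact sign_eq_zero_iff
      · convert measurableSet_Iio (a := (0 : ℝ)) using 1
        ext r; exact sign_eq_neg_one_iff
      · convert measurableSet_Ioi (a := (0 : ℝ)) using 1
        ext r; exact sign_eq_one_iff
    exact (h.regular.continuousOn_solidAngleJacobian h.subset hp).measurableSet_inter_preimage
      h.measurableSet h2
  have hsu : s = (s ∩ {y | SignType.sign (solidAngleJacobian g p y) = 1}) ∪
      ((s ∩ {y | SignType.sign (solidAngleJacobian g p y) = -1}) ∪
      (s ∩ {y | SignType.sign (solidAngleJacobian g p y) = 0})) := by
    ext y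
    rcases lt_trichotomy (solidAngleJacobian g p y) 0 with h | h | h
    · simp [h, h.ne]
    · simp [h]
    · simp [h, h.ne']
  rw [hsu, image_union, image_union]
  refine isCountablePiece_union ?_ (isCountablePiece_union ?_ ?_)
  · exact (h.mono (hm 1) inter_subset_left).isCountablePiece_of_sign one_ne_zero
      (fun y hy => hp y hy.1) fun y hy => hy.2
  · exact (h.mono (hm (-1)) inter_subset_left).isCountablePiece_of_sign (by decide)
      (fun y hy => hp y hy.1) fun y hy => hy.2
  · have h0 := h.mono (hm 0) inter_subset_left
    refine (h0.isPiece_of_cases (Or.inr ⟨?_, ?_⟩)).isCountablePiece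
    · rw [image_image]
      exact sphereArea_image_eq_zero (fun y hy => h.regular.differentiableAt (h.subset hy.1))
        (fun y hy => hp y hy.1) (Or.inr fun y hy => sign_eq_zero_iff.1 hy.2)
    · filter_upwards [ae_restrict_mem h0.measurableSet_image] with x hx
      obtain ⟨y, hy, rfl⟩ := hx
      have h2 := h.angleDensity_eq p hy.1
      rw [sign_eq_zero_iff.1 hy.2] at h2
      exact (mul_eq_zero.1 h2).resolve_left
        (norm_ne_zero_iff.2 (h.regular.regular y (h.subset hy.1)))

theorem isPiece_image_null {n : E3 → E3} {g : ℝ × ℝ → E3} {U s : Set (ℝ × ℝ)} {p : E3}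
    (hg : IsRegularOn g U) (hs : MeasurableSet s) (hsU : s ⊆ U) (hinj : InjOn g s)
    (hp : ∀ y ∈ s, g y ≠ p) (h0 : volume s = 0) : IsPiece n p (g '' s) := by
  refine isPiece_of_null (hg.measurableSet_image hs hsU hinj) ?_ ?_
  · rw [hg.euclideanHausdorffMeasure_image hs hsU hinj, Measure.restrict_eq_zero.2 h0]; simp
  · rw [image_image]
    exact sphereArea_image_eq_zero (fun y hy => hg.differentiableAt (hsU hy)) hp (Or.inl h0)

instance : NullSingletonClass (μHE[2] : Measure E3) where
  measure_singleton x := by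
    rw [Measure.euclideanHausdorffMeasure_def, Measure.smul_apply]
    have := Measure.nullSingletonClass_hausdorff E3 (d := ((2 : ℕ) : ℝ)) (by norm_num)
    simp

theorem isPiece_singleton (n : E3 → E3) (p x : E3) : IsPiece n p {x} :=
  isPiece_of_null (measurableSet_singleton x) (measure_singleton x)
    (by rw [image_singleton]; exact sphereArea_singleton _)

/-! ### Charts of a piecewise smooth surface. -/

/-- Two maps glued along the line `v = 0`. -/
noncomputable def glue {F : Type*} (f₁ f₂ : ℝ × ℝ → F) (y : ℝ × ℝ) : F :=
  if 0 ≤ y.2 then f₁ y else f₂ y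

theorem glue_of_nonneg {F : Type*} (f₁ f₂ : ℝ × ℝ → F) {y : ℝ × ℝ} (hy : 0 ≤ y.2) :
    glue f₁ f₂ y = f₁ y := if_pos hy

theorem glue_of_neg {F : Type*} (f₁ f₂ : ℝ × ℝ → F) {y : ℝ × ℝ} (hy : y.2 < 0) :
    glue f₁ f₂ y = f₂ y := if_neg (not_le.2 hy)

/-- A chart of a piecewise smooth surface, made of two regular maps glued along the line `v = 0` and
restricted to `D`. -/
structure IsChart (M : Set E3) (n : E3 → E3) (g₁ g₂ : ℝ × ℝ → E3) (U D : Set (ℝ × ℝ))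
    (W : Set E3) : Prop where
  regular₁ : IsRegularOn g₁ U
  regular₂ : IsRegularOn g₂ U
  isOpen : IsOpen W
  isClosed : IsClosed D
  agree : ∀ y ∈ U, y.2 = 0 → g₁ y = g₂ y
  isEmbedding : IsEmbedding ((U ∩ D).domRestrict (glue g₁ g₂))
  image_eq : glue g₁ g₂ '' (U ∩ D) = M ∩ W
  normal₁ : ∀ y ∈ U ∩ D, 0 < y.2 → n (g₁ y) = paramNormal g₁ y
  normal₂ : ∀ y ∈ U ∩ D, y.2 < 0 → n (g₂ y) = paramNormal g₂ y

/-- Taking the same map on both sides reduces all interior points to a single kind of chart. -/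
theorem IsSmoothPoint.isCreasePoint {M : Set E3} {n : E3 → E3} {x : E3}
    (h : IsSmoothPoint M n x) : IsCreasePoint M n x := by
  obtain ⟨g, U, W, hg, hW, hx, hemb, him, hn⟩ := h
  have hglue : (fun y : ℝ × ℝ => if 0 ≤ y.2 then g y else g y) = g := by
    ext1 y; exact ite_self _
  exact ⟨g, g, U, W, hg, hg, hW, hx, fun _ _ _ => rfl, by rwa [hglue], by rwa [hglue],
    fun y hy _ => hn y hy, fun y hy _ => hn y hy⟩

theorem IsCreasePoint.exists_isChart {M : Set E3} {n : E3 → E3} {x : E3}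
    (h : IsCreasePoint M n x) : ∃ g₁ g₂ U W, IsChart M n g₁ g₂ U univ W ∧ x ∈ W := by
  obtain ⟨g₁, g₂, U, W, h₁, h₂, hW, hx, hag, hemb, him, hn₁, hn₂⟩ := h
  exact ⟨g₁, g₂, U, W, ⟨h₁, h₂, hW, isClosed_univ, hag, by rw [inter_univ]; exact hemb,
    by rw [inter_univ]; exact him, fun y hy => hn₁ y hy.1, fun y hy => hn₂ y hy.1⟩, hx⟩

theorem IsBoundaryPoint.exists_isChart {M B : Set E3} {n : E3 → E3} {x : E3}
    (h : IsBoundaryPoint M B n x) : ∃ g U W, IsChart M n g g U {y | 0 ≤ y.2} W ∧ x ∈ W := by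
  obtain ⟨g, U, W, hg, hW, hx, hemb, him, -, hn⟩ := h
  have hglue : glue g g = g := by
    ext1 y; exact ite_self _
  exact ⟨g, U, W, ⟨hg, hg, hW, isClosed_le continuous_const continuous_snd, fun _ _ _ => rfl,
    by rwa [hglue], by rwa [hglue], fun y hy _ => hn y hy.1 hy.2, fun y hy _ => hn y hy.1 hy.2⟩, hx⟩

theorem volume_line : volume {y : ℝ × ℝ | y.2 = 0} = 0 := by
  have : {y : ℝ × ℝ | y.2 = 0} = univ ×ˢ {0} := by ext y; simp
  rw [this, Measure.volume_eq_prod, Measure.prod_prod]; simp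

namespace IsChart

variable {M : Set E3} {n : E3 → E3} {g₁ g₂ : ℝ × ℝ → E3} {U D : Set (ℝ × ℝ)} {W : Set E3}
  (h : IsChart M n g₁ g₂ U D W)
include h

theorem measurableSet : MeasurableSet (U ∩ D) :=
  h.regular₁.isOpen.measurableSet.inter h.isClosed.measurableSet

theorem injOn : InjOn (glue g₁ g₂) (U ∩ D) := injOn_iff_injective.2 h.isEmbedding.injective

theorem isSheet₁ : IsSheet n g₁ U (U ∩ D ∩ {y | 0 < y.2}) where
  regular := h.regular₁
  measurableSet := h.measurableSet.inter (measurableSet_lt measurable_const measurable_snd)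
  subset := inter_subset_left.trans inter_subset_left
  injOn := (h.injOn.mono inter_subset_left).congr fun _ hy => glue_of_nonneg _ _ (le_of_lt hy.2)
  normal := fun y hy => h.normal₁ y hy.1 hy.2

theorem isSheet₂ : IsSheet n g₂ U (U ∩ D ∩ {y | y.2 < 0}) where
  regular := h.regular₂
  measurableSet := h.measurableSet.inter (measurableSet_lt measurable_snd measurable_const)
  subset := inter_subset_left.trans inter_subset_left
  injOn := (h.injOn.mono inter_subset_left).congr fun _ hy => glue_of_neg _ _ hy.2
  normal := fun y hy => h.normal₂ y hy.1 hy.2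

theorem inter_eq : M ∩ W = g₁ '' (U ∩ D ∩ {y | 0 < y.2}) ∪ (g₂ '' (U ∩ D ∩ {y | y.2 < 0}) ∪
    g₁ '' (U ∩ D ∩ {y | y.2 = 0})) := by
  have h1 : U ∩ D = (U ∩ D ∩ {y | 0 < y.2}) ∪ ((U ∩ D ∩ {y | y.2 < 0}) ∪
      (U ∩ D ∩ {y | y.2 = 0})) := by
    ext y
    rcases lt_trichotomy y.2 0 with h | h | h
    · simp [h, h.ne, h.le]
    · simp [h]
    · simp [h, h.ne', h.le]
  rw [← h.image_eq, h1, image_union, image_union, ← h1]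
  congr 1
  · exact image_congr fun y hy => glue_of_nonneg _ _ (le_of_lt hy.2)
  congr 1
  · exact image_congr fun y hy => glue_of_neg _ _ hy.2
  · exact image_congr fun y hy => glue_of_nonneg _ _ (le_of_eq (Eq.symm hy.2))

theorem injOn_edge : InjOn g₁ (U ∩ D ∩ {y | y.2 = 0}) :=
  (h.injOn.mono inter_subset_left).congr fun _ hy => glue_of_nonneg _ _ (le_of_eq (Eq.symm hy.2))

theorem measurableSet_edge : MeasurableSet (U ∩ D ∩ {y | y.2 = 0}) :=
  h.measurableSet.inter (measurableSet_eq_fun measurable_snd measurable_const)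

theorem isCountablePiece {p : E3} (hp : p ∉ M) : IsCountablePiece n p (M ∩ W) := by
  have hM := h.inter_eq
  have hsub : M ∩ W ⊆ M := inter_subset_left
  have h1 : ∀ y ∈ U ∩ D ∩ {y | 0 < y.2}, g₁ y ≠ p := fun y hy he =>
    hp (hsub (hM ▸ Or.inl ⟨y, hy, he⟩))
  have h2 : ∀ y ∈ U ∩ D ∩ {y | y.2 < 0}, g₂ y ≠ p := fun y hy he =>
    hp (hsub (hM ▸ Or.inr (Or.inl ⟨y, hy, he⟩)))
  have h3 : ∀ y ∈ U ∩ D ∩ {y | y.2 = 0}, g₁ y ≠ p := fun y hy he =>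
    hp (hsub (hM ▸ Or.inr (Or.inr ⟨y, hy, he⟩)))
  rw [hM]
  exact isCountablePiece_union (h.isSheet₁.isCountablePiece h1) (isCountablePiece_union
    (h.isSheet₂.isCountablePiece h2) (isPiece_image_null h.regular₁ h.measurableSet_edge
      (inter_subset_left.trans inter_subset_left) h.injOn_edge h3
      (measure_mono_null inter_subset_right volume_line)).isCountablePiece)

/-- The Jacobian is bounded on a closed ball of parameters. That the chart is an embedding, not
merely injective, ensures that points of `M` near `x` have parameters in this ball. -/
theorem exists_finite_area {x : E3} (hxM : x ∈ M) (hxW : x ∈ W) :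
    ∃ N ∈ 𝓝 x, μHE[2] (M ∩ N) < ⊤ := by
  obtain ⟨y, hy, rfl⟩ : x ∈ glue g₁ g₂ '' (U ∩ D) := h.image_eq ▸ ⟨hxM, hxW⟩
  obtain ⟨r, hr, hrU⟩ := Metric.nhds_basis_closedBall.mem_iff.1 (h.regular₁.isOpen.mem_nhds hy.1)
  have hK : IsCompact (Metric.closedBall y r) := isCompact_closedBall y r
  have fin : ∀ g, IsRegularOn g U → ∀ s, MeasurableSet s → s ⊆ Metric.closedBall y r → InjOn g s →
      μHE[2] (g '' s) < ⊤ := by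
    intro g hg s hs hsK hinj
    rw [hg.euclideanHausdorffMeasure_image hs (hsK.trans hrU) hinj]
    obtain ⟨C, hC⟩ := hK.exists_bound_of_continuousOn (hg.continuousOn_crossPartials.mono hrU)
    calc ∫⁻ z in s, ‖crossPartials g z‖ₑ ≤ ∫⁻ _ in s, ENNReal.ofReal C := by
          refine setLIntegral_mono' hs fun z hz => ?_
          rw [← ofReal_norm]
          exact ENNReal.ofReal_le_ofReal (hC z (hsK hz))
      _ = ENNReal.ofReal C * volume s := by rw [setLIntegral_const]
      _ < ⊤ := ENNReal.mul_lt_top ENNReal.ofReal_lt_top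
          ((measure_mono hsK).trans_lt hK.measure_lt_top)
  have hball : (Subtype.val ⁻¹' Metric.closedBall y r : Set (U ∩ D : Set (ℝ × ℝ))) ∈
      𝓝 (⟨y, hy⟩ : (U ∩ D : Set (ℝ × ℝ))) :=
    continuous_subtype_val.continuousAt.preimage_mem_nhds (Metric.closedBall_mem_nhds y hr)
  rw [h.isEmbedding.nhds_eq_comap, Filter.mem_comap] at hball
  obtain ⟨N, hN, hNs⟩ := hball
  refine ⟨N ∩ W, Filter.inter_mem hN (h.isOpen.mem_nhds hxW), ?_⟩
  have hsub : M ∩ (N ∩ W) ⊆ g₁ '' (Metric.closedBall y r ∩ (U ∩ D ∩ {y | 0 < y.2})) ∪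
      (g₂ '' (Metric.closedBall y r ∩ (U ∩ D ∩ {y | y.2 < 0})) ∪
       g₁ '' (Metric.closedBall y r ∩ (U ∩ D ∩ {y | y.2 = 0}))) := by
    rintro z ⟨hzM, hzN, hzW⟩
    obtain ⟨w, hw, rfl⟩ : z ∈ glue g₁ g₂ '' (U ∩ D) := h.image_eq ▸ ⟨hzM, hzW⟩
    have hwb : w ∈ Metric.closedBall y r := hNs (a := ⟨w, hw⟩) hzN
    rcases lt_trichotomy w.2 0 with h | h | h
    · exact Or.inr (Or.inl ⟨w, ⟨hwb, hw, h⟩, (glue_of_neg _ _ h).symm⟩)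
    · exact Or.inr (Or.inr ⟨w, ⟨hwb, hw, h⟩, (glue_of_nonneg _ _ h.ge).symm⟩)
    · exact Or.inl ⟨w, ⟨hwb, hw, h⟩, (glue_of_nonneg _ _ h.le).symm⟩
  have hbm : MeasurableSet (Metric.closedBall y r) := Metric.isClosed_closedBall.measurableSet
  refine (measure_mono hsub).trans_lt ((measure_union_le _ _).trans_lt
    (ENNReal.add_lt_top.2 ⟨?_, (measure_union_le _ _).trans_lt (ENNReal.add_lt_top.2 ⟨?_, ?_⟩)⟩))
  · exact fin _ h.regular₁ _ (hbm.inter h.isSheet₁.measurableSet) inter_subset_left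
      (h.isSheet₁.injOn.mono inter_subset_right)
  · exact fin _ h.regular₂ _ (hbm.inter h.isSheet₂.measurableSet) inter_subset_left
      (h.isSheet₂.injOn.mono inter_subset_right)
  · exact fin _ h.regular₁ _ (hbm.inter h.measurableSet_edge) inter_subset_left
      (h.injOn_edge.mono inter_subset_right)

end IsChart

/-! ### Finite area, covering by pieces, and the projected boundary. -/

namespace PiecewiseSmoothSurface

variable (S : PiecewiseSmoothSurface)

theorem exists_isChart {x : E3} (hx : x ∈ S.carrier) (hxv : x ∉ S.vertices) :
    ∃ g₁ g₂ U D W, IsChart S.carrier S.normal g₁ g₂ U D W ∧ x ∈ W := by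
  by_cases hb : x ∈ S.boundary
  · obtain ⟨g, U, W, h⟩ := (S.boundary_point x ⟨hb, hxv⟩).exists_isChart
    exact ⟨g, g, U, _, W, h⟩
  · have hc : IsCreasePoint S.carrier S.normal x :=
      (S.interior_point x ⟨hx, by simp [hb, hxv]⟩).elim (·.isCreasePoint) id
    obtain ⟨g₁, g₂, U, W, h⟩ := hc.exists_isChart
    exact ⟨g₁, g₂, U, _, W, h⟩

theorem measure_carrier_lt_top : μHE[2] S.carrier < ⊤ := by
  refine S.isCompact_carrier.induction_on (p := fun s => μHE[2] s < ⊤) (by simp)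
    (fun s t hst ht => (measure_mono hst).trans_lt ht)
    (fun s t hs ht => (measure_union_le _ _).trans_lt (ENNReal.add_lt_top.2 ⟨hs, ht⟩))
    fun x hx => ?_
  have : ∃ N ∈ 𝓝 x, μHE[2] (S.carrier ∩ N) < ⊤ := by
    by_cases hxv : x ∈ S.vertices
    · exact S.finite_area x hxv
    · obtain ⟨g₁, g₂, U, D, W, h, hxW⟩ := S.exists_isChart hx hxv
      exact h.exists_finite_area hx hxW
  obtain ⟨N, hN, h⟩ := this
  exact ⟨S.carrier ∩ N, inter_comm N _ ▸ Filter.inter_mem (mem_nhdsWithin_of_mem_nhds hN)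
    self_mem_nhdsWithin, h⟩

/-- Charts cover everything but the vertices, and countably many suffice by Lindelöf. A vertex is a
single point, negligible both on the surface and on the sphere. -/
theorem isCountablePiece_carrier {p : E3} (hp : p ∉ S.carrier) :
    IsCountablePiece S.normal p S.carrier := by
  classical
  have hloc : ∀ x ∈ S.carrier \ S.vertices, ∃ W, IsOpen W ∧ x ∈ W ∧
      IsCountablePiece S.normal p (S.carrier ∩ W) := by
    rintro x ⟨hx, hxv⟩
    obtain ⟨g₁, g₂, U, D, W, h, hxW⟩ := S.exists_isChart hx hxv
    exact ⟨W, h.isOpen, hxW, h.isCountablePiece hp⟩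
  choose! W hWo hxW hW using hloc
  obtain ⟨c, hcs, hcc, hcov⟩ := TopologicalSpace.countable_cover_nhdsWithin
    (f := W) (s := S.carrier \ S.vertices)
    (fun x hx => mem_nhdsWithin_of_mem_nhds ((hWo x hx).mem_nhds (hxW x hx)))
  have h1 : S.carrier = (⋃ x ∈ c, S.carrier ∩ W x) ∪ ⋃ x ∈ S.vertices, {x} := by
    ext x
    simp only [mem_union, mem_iUnion, mem_inter_iff, exists_prop, mem_singleton_iff,
      exists_eq_right']
    constructor
    · intro hx
      by_cases hxv : x ∈ S.vertices
      · exact Or.inr hxv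
      · obtain ⟨i, hi, hxi⟩ := mem_iUnion₂.1 (hcov ⟨hx, hxv⟩)
        exact Or.inl ⟨i, hi, hx, hxi⟩
    · rintro (⟨i, -, hx, -⟩ | hx)
      · exact hx
      · exact S.vertices_subset hx
  rw [h1]
  exact isCountablePiece_union (IsCountablePiece.biUnion hcc fun x hx => hW x (hcs hx))
    (IsCountablePiece.biUnion S.finite_vertices.countable fun x _ =>
      (isPiece_singleton _ _ _).isCountablePiece)

theorem boundary_subset : S.boundary ⊆ S.carrier := by
  rw [S.boundary_eq]
  refine closure_minimal (fun x hx => ?_) S.isCompact_carrier.isClosed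
  obtain ⟨g, U, W, -, -, hxW, -, him, hbd, -⟩ := S.boundary_point x hx
  have h1 : x ∈ g '' (U ∩ {y | y.2 = 0}) := hbd ▸ ⟨hx.1, hxW⟩
  obtain ⟨y, hy, rfl⟩ := h1
  have h2 : g y ∈ g '' (U ∩ {y | 0 ≤ y.2}) := ⟨y, ⟨hy.1, le_of_eq (Eq.symm hy.2)⟩, rfl⟩
  rw [him] at h2
  exact h2.1

theorem isCompact_boundary : IsCompact S.boundary :=
  S.isCompact_carrier.of_isClosed_subset (S.boundary_eq ▸ isClosed_closure) S.boundary_subset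

/-- Off the vertices the boundary is locally the image of a part of the line `v = 0`, which is null
in the parameter plane. -/
theorem sphereArea_boundary {p : E3} (hp : p ∉ S.carrier) :
    sphereArea ((fun x => radial (x - p)) '' S.boundary) = 0 := by
  classical
  have hloc : ∀ x ∈ S.boundary \ S.vertices, ∃ W, IsOpen W ∧ x ∈ W ∧
      sphereArea ((fun x => radial (x - p)) '' (S.boundary ∩ W)) = 0 := by
    intro x hx
    obtain ⟨g, U, W, hg, hW, hxW, -, -, hbd, -⟩ := S.boundary_point x hx
    refine ⟨W, hW, hxW, ?_⟩
    rw [← hbd, image_image]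
    refine sphereArea_image_eq_zero (fun y hy => hg.differentiableAt hy.1) (fun y hy he => ?_)
      (Or.inl (measure_mono_null inter_subset_right volume_line))
    have : g y ∈ S.boundary ∩ W := hbd ▸ mem_image_of_mem g hy
    exact hp (S.boundary_subset (he ▸ this.1))
  choose! W hWo hxW hW using hloc
  obtain ⟨c, hcs, hcc, hcov⟩ := TopologicalSpace.countable_cover_nhdsWithin
    (f := W) (s := S.boundary \ S.vertices)
    (fun x hx => mem_nhdsWithin_of_mem_nhds ((hWo x hx).mem_nhds (hxW x hx)))
  have h1 : S.boundary ⊆ (⋃ x ∈ c, S.boundary ∩ W x) ∪ ⋃ x ∈ S.vertices, {x} := by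
    intro x hx
    by_cases hxv : x ∈ S.vertices
    · exact Or.inr (mem_iUnion₂.2 ⟨x, hxv, rfl⟩)
    · obtain ⟨i, hi, hxi⟩ := mem_iUnion₂.1 (hcov ⟨hx, hxv⟩)
      exact Or.inl (mem_iUnion₂.2 ⟨i, hi, hx, hxi⟩)
  refine measure_mono_null (image_mono h1) ?_
  rw [image_union, image_iUnion₂, image_iUnion₂]
  refine measure_union_null ((measure_biUnion_null_iff hcc).2 fun x hx => hW x (hcs hx))
    ((measure_biUnion_null_iff S.finite_vertices.countable).2 fun x _ => ?_)
  rw [image_singleton]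
  exact sphereArea_singleton _

theorem boundaryProj_eq {p : E3} (hp : p ∉ S.carrier) :
    S.boundaryProj p = (fun x => radial (x - p)) '' S.boundary := by
  ext q
  constructor
  · rintro ⟨x, hx, hq⟩
    refine ⟨x, hx, ?_⟩
    ext1
    rw [coe_radial (sub_ne_zero.2 fun h : x = p => hp (h ▸ S.boundary_subset hx)), hq]
  · rintro ⟨x, hx, rfl⟩
    exact ⟨x, hx, coe_radial (sub_ne_zero.2 fun h : x = p => hp (h ▸ S.boundary_subset hx))⟩

theorem isClosed_boundaryProj {p : E3} (hp : p ∉ S.carrier) : IsClosed (S.boundaryProj p) := by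
  rw [S.boundaryProj_eq hp]
  refine (S.isCompact_boundary.image_of_continuousOn ?_).isClosed
  exact continuousOn_radial.comp (continuous_id.sub continuous_const).continuousOn
    fun x hx => sub_ne_zero.2 fun h : x = p => hp (h ▸ S.boundary_subset hx)

end PiecewiseSmoothSurface

/-! ### Integrating the signed intersection number over the sphere. -/

theorem measurable_radial_sub (p : E3) : Measurable fun x : E3 => radial (x - p) :=
  measurable_radial.comp (measurable_id.sub_const p)

/-- On a radial piece, the surface measure weighted by the absolute density pushes forward to sphere
area. -/
theorem IsRadialPiece.setIntegral_eq {n : E3 → E3} {p : E3} {σ : SignType} {a : Set E3}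
    (h : IsRadialPiece n p σ a) (ha : MeasurableSet a)
    (hn : AEMeasurable (angleDensity n p) ((μHE[2] : Measure E3).restrict a))
    {f : UnitSphere → ℝ} (hf : Measurable f) :
    ∫ q in (fun x => radial (x - p)) '' a, f q ∂sphereArea =
      ∫ x in a, f (radial (x - p)) * ‖angleDensity n p x‖ ∂μHE[2] := by
  have hmap : sphereArea.restrict ((fun x => radial (x - p)) '' a) =
      Measure.map (fun x => radial (x - p))
        (((μHE[2] : Measure E3).restrict a).withDensity fun x => ‖angleDensity n p x‖₊) := by
    ext B hB
    have hpre : MeasurableSet ((fun x => radial (x - p)) ⁻¹' B) := measurable_radial_sub p hB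
    rw [Measure.restrict_apply hB, Measure.map_apply (measurable_radial_sub p) hB,
      withDensity_apply _ hpre, Measure.restrict_restrict hpre]
    have h1 : B ∩ (fun x => radial (x - p)) '' a =
        (fun x => radial (x - p)) '' ((fun x => radial (x - p)) ⁻¹' B ∩ a) := by
      rw [image_preimage_inter]
    rw [h1, h.area_image _ inter_subset_right (hpre.inter ha)]
    rfl
  rw [hmap, integral_map (measurable_radial_sub p).aemeasurable hf.aestronglyMeasurable,
    integral_withDensity_eq_integral_smul₀ hn.nnnorm]
  refine integral_congr_ae (Filter.Eventually.of_forall fun x => ?_)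
  simp [NNReal.smul_def, mul_comm]

theorem norm_angleDensity_le {n : E3 → E3} {p x : E3} (hn : ‖n x‖ = 1) :
    ‖angleDensity n p x‖ ≤ (‖x - p‖ ^ 2)⁻¹ := by
  rw [angleDensity, norm_div, norm_pow, norm_norm]
  by_cases h0 : ‖x - p‖ = 0
  · simp [h0]
  have h1 := norm_inner_le_norm (𝕜 := ℝ) (x - p) (n x)
  rw [hn, mul_one] at h1
  have h2 : 0 < ‖x - p‖ := lt_of_le_of_ne (norm_nonneg _) (Ne.symm h0)
  rw [div_le_iff₀ (by positivity)]
  calc ‖(inner ℝ (x - p) (n x) : ℝ)‖ ≤ ‖x - p‖ := h1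
    _ = (‖x - p‖ ^ 2)⁻¹ * ‖x - p‖ ^ 3 := by field_simp

theorem sign_mul_norm (r : ℝ) : (SignType.sign r : ℝ) * ‖r‖ = r := by
  rw [Real.norm_eq_abs, sign_mul_abs]

theorem integrable_tsum_of_summable_integral_norm {α : Type*} [MeasurableSpace α] {μ : Measure α}
    {F : ℕ → α → ℝ} (hF : ∀ i, Integrable (F i) μ) (hs : Summable fun i => ∫ a, ‖F i a‖ ∂μ)
    {G : α → ℝ} (hG : ∀ᵐ a ∂μ, HasSum (fun i => F i a) (G a)) :
    Integrable G μ ∧ HasSum (fun i => ∫ a, F i a ∂μ) (∫ a, G a ∂μ) := by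
  have hae : G =ᵐ[μ] fun a => ∑' i, F i a := by
    filter_upwards [hG] with a ha using ha.tsum_eq.symm
  refine ⟨⟨?_, ?_⟩, ?_⟩
  · refine aestronglyMeasurable_of_tendsto_ae Filter.atTop
      (f := fun (s : Finset ℕ) a => ∑ i ∈ s, F i a) (fun s => ?_) ?_
    · exact Finset.aestronglyMeasurable_fun_sum s fun i _ => (hF i).aestronglyMeasurable
    · filter_upwards [hG] with a ha using ha
  · rw [HasFiniteIntegral]
    calc ∫⁻ a, ‖G a‖ₑ ∂μ ≤ ∫⁻ a, ∑' i, ‖F i a‖ₑ ∂μ := by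
          refine lintegral_mono_ae ?_
          filter_upwards [hG] with a ha
          rw [← ha.tsum_eq]
          exact enorm_tsum_le_tsum_enorm
      _ = ∑' i, ∫⁻ a, ‖F i a‖ₑ ∂μ := lintegral_tsum fun i => (hF i).aestronglyMeasurable.enorm
      _ = ∑' i, ENNReal.ofReal (∫ a, ‖F i a‖ ∂μ) := by
          congr 1
          ext1 i
          rw [ofReal_integral_norm_eq_lintegral_enorm (hF i)]
      _ < ⊤ := (ENNReal.ofReal_tsum_of_nonneg (fun i => by positivity) hs) ▸ ENNReal.ofReal_lt_top
  · rw [integral_congr_ae hae]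
    exact hasSum_integral_of_summable_integral_norm hF hs

namespace PiecewiseSmoothSurface

variable (S : PiecewiseSmoothSurface) {p : E3}

theorem ae_norm_normal (hp : p ∉ S.carrier) :
    AEMeasurable S.normal ((μHE[2] : Measure E3).restrict S.carrier) ∧
    ∀ᵐ x ∂((μHE[2] : Measure E3).restrict S.carrier), ‖S.normal x‖ = 1 := by
  obtain ⟨t, htu, ht⟩ := S.isCountablePiece_carrier hp
  rw [← htu]
  exact ⟨aemeasurable_iUnion_iff.2 fun i => (ht i).aemeasurable,
    (ae_restrict_iUnion_iff _ _).2 fun i => (ht i).norm_eq⟩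

theorem exists_pos_le_norm_sub (hp : p ∉ S.carrier) : ∃ d > 0, ∀ x ∈ S.carrier, d ≤ ‖x - p‖ := by
  obtain ⟨d, hd, h⟩ := Metric.isOpen_iff.1 S.isCompact_carrier.isClosed.isOpen_compl p hp
  refine ⟨d, hd, fun x hx => ?_⟩
  by_contra hlt
  rw [not_le, ← dist_eq_norm] at hlt
  exact h hlt hx

theorem aemeasurable_angleDensity (hp : p ∉ S.carrier) :
    AEMeasurable (angleDensity S.normal p) ((μHE[2] : Measure E3).restrict S.carrier) := by
  have h1 := (S.ae_norm_normal hp).1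
  have h2 : AEMeasurable (fun x : E3 => x - p) ((μHE[2] : Measure E3).restrict S.carrier) :=
    (measurable_id.sub_const p).aemeasurable
  exact (h2.inner h1).div (h2.norm.pow_const 3)

instance : IsFiniteMeasure ((μHE[2] : Measure E3).restrict S.carrier) :=
  ⟨by rw [Measure.restrict_apply_univ]; exact S.measure_carrier_lt_top⟩

/-- The density is at most `d⁻²`, with `d` a positive lower bound for the distance from `p` to `M`,
and the area is finite. -/
theorem integrableOn_angleDensity (hp : p ∉ S.carrier) :
    IntegrableOn (angleDensity S.normal p) S.carrier μHE[2] := by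
  obtain ⟨d, hd, hdist⟩ := S.exists_pos_le_norm_sub hp
  refine Integrable.of_bound (S.aemeasurable_angleDensity hp).aestronglyMeasurable (d ^ 2)⁻¹ ?_
  filter_upwards [(S.ae_norm_normal hp).2,
    ae_restrict_mem S.isCompact_carrier.measurableSet] with x hx hxM
  refine (norm_angleDensity_le hx).trans ?_
  have := hdist x hxM
  gcongr

theorem rayInter_eq (hp : p ∉ S.carrier) (q : UnitSphere) :
    S.rayInter p q = {x | x ∈ S.carrier ∧ radial (x - p) = q} := by
  ext x
  constructor
  · rintro ⟨hx, t, ht, rfl⟩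
    refine ⟨hx, ?_⟩
    rw [add_sub_cancel_left, radial_smul ht, radial_coe]
  · rintro ⟨hx, rfl⟩
    have h0 : x - p ≠ 0 := sub_ne_zero.2 fun h : x = p => hp (h ▸ hx)
    exact ⟨hx, ‖x - p‖, norm_pos_iff.2 h0, by rw [norm_smul_radial, add_sub_cancel]⟩

theorem sign_inner_radial {z : E3} (hz : z ≠ 0) (v : E3) :
    SignType.sign (inner ℝ (radial z : E3) v) = SignType.sign (inner ℝ z v) := by
  have hr : 0 < ‖z‖⁻¹ := inv_pos.2 (norm_pos_iff.2 hz)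
  rw [coe_radial hz, inner_smul_left, sign_mul]
  simp [sign_pos hr]

/-- The main structural fact: up to null sets, the surface decomposes into countably many disjoint
pieces, each projecting injectively, and `χ` is the signed count of the projections. -/
theorem exists_decomposition (hp : p ∉ S.carrier) :
    ∃ (t : ℕ → Set E3) (σ : ℕ → SignType), Pairwise (Disjoint on t) ∧ ⋃ i, t i = S.carrier ∧
      (∀ i, MeasurableSet (t i)) ∧
      (∀ i, (IsRadialPiece S.normal p (σ i) (t i)) ∨ (σ i = 0 ∧
        sphereArea ((fun x => radial (x - p)) '' t i) = 0 ∧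
        ∀ᵐ x ∂((μHE[2] : Measure E3).restrict (t i)), angleDensity S.normal p x = 0)) := by
  obtain ⟨t, htu, ht⟩ := S.isCountablePiece_carrier hp
  have hm : ∀ i, MeasurableSet (disjointed t i) :=
    MeasurableSet.disjointed fun i => (ht i).measurableSet
  have hd (i) := (ht i).mono (hm i) (disjointed_subset t i)
  have hσ : ∀ i, ∃ σ : SignType, IsRadialPiece S.normal p σ (disjointed t i) ∨ (σ = 0 ∧
      sphereArea ((fun x => radial (x - p)) '' disjointed t i) = 0 ∧
      ∀ᵐ x ∂((μHE[2] : Measure E3).restrict (disjointed t i)), angleDensity S.normal p x = 0) := by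
    intro i
    rcases (hd i).cases' with ⟨σ, h⟩ | h
    · exact ⟨σ, Or.inl h⟩
    · exact ⟨0, Or.inr ⟨rfl, h⟩⟩
  choose σ hσ using hσ
  exact ⟨disjointed t, σ, disjoint_disjointed t, by rw [iUnion_disjointed, htu], hm, hσ⟩

/-- For almost every `q` the points of the ray on `M` correspond to the indices `i` with `q ∈ B i`,
so `χ` is the countable sum of the `σ i · 1_{B i}`, which may be integrated termwise. -/
theorem ae_finite_rayInter_and_integral_chi (hp : p ∉ S.carrier) :
    (∀ᵐ q ∂sphereArea, (S.rayInter p q).Finite) ∧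
    Integrable (fun q => (S.chi p q : ℝ)) sphereArea ∧
    ∀ f : UnitSphere → ℝ, Measurable f → (∃ C, ∀ q, ‖f q‖ ≤ C) →
      Integrable (fun q => (S.chi p q : ℝ) * f q) sphereArea ∧
      ∫ q, (S.chi p q : ℝ) * f q ∂sphereArea =
        ∫ x in S.carrier, f (radial (x - p)) * angleDensity S.normal p x ∂μHE[2] := by
  obtain ⟨t, σ, htd, htu, htm, hσ⟩ := S.exists_decomposition hp
  have hts (i) : t i ⊆ S.carrier := htu ▸ subset_iUnion t i
  set B : ℕ → Set UnitSphere := fun i => (fun x => radial (x - p)) '' t i with hB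
  have hint := S.integrableOn_angleDensity hp
  have hmeas := S.aemeasurable_angleDensity hp
  have harea : ∀ i, sphereArea (B i) ≤ ∫⁻ x in t i, ‖angleDensity S.normal p x‖ₑ ∂μHE[2] := by
    intro i
    rcases hσ i with h | ⟨-, h, -⟩
    · exact (h.area_image _ subset_rfl (htm i)).le
    · exact h.le.trans zero_le
  have hsum : ∑' i, sphereArea (B i) ≠ ⊤ := by
    refine ne_top_of_le_ne_top ?_ (ENNReal.tsum_le_tsum harea)
    rw [← lintegral_iUnion htm htd, htu]
    exact hint.2.ne
  -- Borel–Cantelli.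
  have hfin : ∀ᵐ q ∂sphereArea, {i | q ∈ B i}.Finite := ae_finite_setOfPred_mem hsum
  have hneg : ∀ᵐ q ∂sphereArea, ∀ i, q ∈ B i → IsRadialPiece S.normal p (σ i) (t i) := by
    refine ae_all_iff.2 fun i => ?_
    rcases hσ i with h | ⟨-, h, -⟩
    · exact Filter.Eventually.of_forall fun _ _ => h
    · filter_upwards [measure_eq_zero_iff_ae_notMem.1 h] with q hq hq' using absurd hq' hq
  -- Disjointness of the pieces makes `e` injective; injectivity of the projection on each piece
  -- makes it surjective onto the ray intersection.
  have hbij : ∀ q, (∀ i, q ∈ B i → IsRadialPiece S.normal p (σ i) (t i)) →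
      ∃ e : ℕ → E3, BijOn e {i | q ∈ B i} (S.rayInter p q) ∧ ∀ i, q ∈ B i →
        (SignType.sign (inner ℝ (q : E3) (S.normal (e i))) : ℤ) = (σ i : ℤ) := by
    intro q hq
    have : ∀ i, ∃ x, q ∈ B i → x ∈ t i ∧ radial (x - p) = q := fun i => by
      by_cases h : q ∈ B i
      · obtain ⟨x, hx, hxq⟩ := h
        exact ⟨x, fun _ => ⟨hx, hxq⟩⟩
      · exact ⟨0, fun h' => absurd h' h⟩
    choose e he using this
    refine ⟨e, ⟨fun i hi => ?_, fun i hi j hj hij => ?_, fun x hx => ?_⟩, fun i hi => ?_⟩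
    · rw [S.rayInter_eq hp]
      exact ⟨hts i (he i hi).1, (he i hi).2⟩
    · by_contra hne
      exact disjoint_left.1 (htd hne) (he i hi).1 (hij ▸ (he j hj).1)
    · rw [S.rayInter_eq hp, ← htu] at hx
      obtain ⟨hx, hxq⟩ := hx
      obtain ⟨i, hi⟩ := mem_iUnion.1 hx
      have hiB : q ∈ B i := ⟨x, hi, hxq⟩
      exact ⟨i, hiB, (hq i hiB).injOn (he i hiB).1 hi ((he i hiB).2.trans hxq.symm)⟩
    · have h0 : e i - p ≠ 0 := sub_ne_zero.2 fun h : e i = p => hp (h ▸ hts i (he i hi).1)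
      rw [← (hq i hi).sign_eq _ (he i hi).1, ← sign_inner_radial h0, (he i hi).2]
  have hchi : ∀ᵐ q ∂sphereArea, HasSum (fun i => (B i).indicator (fun _ => (σ i : ℝ)) q)
      (S.chi p q : ℝ) := by
    filter_upwards [hfin, hneg] with q hq1 hq2
    obtain ⟨e, he, hes⟩ := hbij q hq2
    have h1 : S.chi p q = ∑ᶠ i ∈ {i | q ∈ B i}, (σ i : ℤ) :=
      (finsum_mem_eq_of_bijOn e he fun i hi => (hes i hi).symm).symm
    rw [h1, finsum_mem_eq_finite_toFinset_sum _ hq1]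
    push_cast
    have h2 : ∑ i ∈ hq1.toFinset, (σ i : ℝ) =
        ∑ i ∈ hq1.toFinset, (B i).indicator (fun _ => (σ i : ℝ)) q := by
      refine Finset.sum_congr rfl fun i hi => ?_
      rw [indicator_of_mem (by simpa using hi)]
    rw [h2]
    refine hasSum_sum_of_ne_finset_zero fun i hi => ?_
    exact indicator_of_notMem (by simpa using hi) _
  -- The weight `f = 1` gives the winding number; other weights serve to pair `χ` with derivatives
  -- of test functions.
  have main : ∀ f : UnitSphere → ℝ, Measurable f → (∃ C, ∀ q, ‖f q‖ ≤ C) →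
      Integrable (fun q => (S.chi p q : ℝ) * f q) sphereArea ∧
      ∫ q, (S.chi p q : ℝ) * f q ∂sphereArea =
        ∫ x in S.carrier, f (radial (x - p)) * angleDensity S.normal p x ∂μHE[2] := by
    rintro f hf ⟨C, hC⟩
    have hfint : Integrable f sphereArea :=
      Integrable.of_bound hf.aestronglyMeasurable C (Filter.Eventually.of_forall hC)
    have hBm : ∀ i, σ i ≠ 0 → MeasurableSet (B i) := fun i hi => by
      rcases hσ i with h | ⟨h, -, -⟩
      · exact h.measurableSet_image _ subset_rfl (htm i)
      · exact absurd h hi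
    have hFeq : ∀ i q, (B i).indicator (fun _ => (σ i : ℝ)) q * f q =
        (σ i : ℝ) * (B i).indicator f q := by
      intro i q
      by_cases hq : q ∈ B i <;> simp [hq]
    have hFint : ∀ i, Integrable (fun q => (B i).indicator (fun _ => (σ i : ℝ)) q * f q)
        sphereArea := by
      intro i
      simp only [hFeq]
      -- If `σ i = 0` the projection `B i` need not be measurable, but then the term is identically
      -- zero.
      by_cases hi : σ i = 0
      · simp [hi]
      · exact (hfint.indicator (hBm i hi)).const_mul _
    have hFval : ∀ i, ∀ g : UnitSphere → ℝ, Measurable g →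
        (σ i : ℝ) * ∫ q, (B i).indicator g q ∂sphereArea =
        ∫ x in t i, g (radial (x - p)) * angleDensity S.normal p x ∂μHE[2] := by
      intro i g hg
      rcases hσ i with h | ⟨h0, -, h⟩
      · rw [integral_indicator (h.measurableSet_image _ subset_rfl (htm i)),
          h.setIntegral_eq (htm i) (hmeas.mono_set (hts i)) hg, ← integral_const_mul]
        refine setIntegral_congr_fun (htm i) fun x hx => ?_
        have hxp : 0 < ‖x - p‖ :=
          norm_pos_iff.2 (sub_ne_zero.2 fun h : x = p => hp (h ▸ hts i hx))
        have hs : SignType.sign (angleDensity S.normal p x) = σ i := by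
          rw [angleDensity, div_eq_mul_inv, sign_mul, h.sign_eq x hx,
            sign_pos (by positivity : 0 < (‖x - p‖ ^ 3)⁻¹), mul_one]
        calc (σ i : ℝ) * (g (radial (x - p)) * ‖angleDensity S.normal p x‖)
            = g (radial (x - p)) * ((SignType.sign (angleDensity S.normal p x) : ℝ) *
              ‖angleDensity S.normal p x‖) := by rw [hs]; ring
          _ = _ := by rw [sign_mul_norm]
      · rw [h0, SignType.coe_zero, zero_mul, eq_comm]
        refine integral_eq_zero_of_ae ?_
        filter_upwards [h] with x hx
        simp [hx]
    -- The terms are dominated by `C` times the integrals of the absolute density over the disjoint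
    -- pieces.
    have hFsum : Summable fun i =>
        ∫ q, ‖(B i).indicator (fun _ => (σ i : ℝ)) q * f q‖ ∂sphereArea := by
      refine Summable.of_nonneg_of_le (fun i => by positivity) (fun i => ?_)
        ((hasSum_integral_iUnion htm htd (htu.symm ▸ hint.norm)).summable.mul_left C)
      have hle : ∀ q, ‖(B i).indicator (fun _ => (σ i : ℝ)) q * f q‖ ≤
          C * (B i).indicator (fun _ => |(σ i : ℝ)|) q := by
        intro q
        by_cases hq : q ∈ B i
        · simp only [indicator_of_mem hq, norm_mul, Real.norm_eq_abs, mul_comm C]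
          gcongr
          exact hC q
        · simp [hq]
      have hreal : |(σ i : ℝ)| * sphereArea.real (B i) ≤
          ∫ x in t i, ‖angleDensity S.normal p x‖ ∂μHE[2] := by
        have h1 : sphereArea.real (B i) ≤ ∫ x in t i, ‖angleDensity S.normal p x‖ ∂μHE[2] := by
          rw [integral_norm_eq_lintegral_enorm (hint.mono_set (hts i)).aestronglyMeasurable]
          exact ENNReal.toReal_mono (hint.mono_set (hts i)).2.ne (harea i)
        refine (mul_le_of_le_one_left measureReal_nonneg ?_).trans h1
        rcases σ i with _ | _ | _ <;> simp
      have hCnn : 0 ≤ C := (norm_nonneg _).trans (hC (radial 0))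
      by_cases hi : σ i = 0
      · have : (0 : ℝ) ≤ ∫ x in t i, ‖angleDensity S.normal p x‖ ∂μHE[2] := by positivity
        simp only [hi, SignType.coe_zero, indicator_zero, zero_mul, norm_zero, integral_zero]
        positivity
      · calc ∫ q, ‖(B i).indicator (fun _ => (σ i : ℝ)) q * f q‖ ∂sphereArea
            ≤ ∫ q, C * (B i).indicator (fun _ => |(σ i : ℝ)|) q ∂sphereArea := by
              refine integral_mono (hFint i).norm (Integrable.const_mul ?_ _) hle
              exact (integrable_const _).indicator (hBm i hi)
          _ = C * (|(σ i : ℝ)| * sphereArea.real (B i)) := by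
              rw [integral_const_mul, integral_indicator_const _ (hBm i hi), smul_eq_mul, mul_comm
                (sphereArea.real (B i))]
          _ ≤ _ := by gcongr
    obtain ⟨h1, h2⟩ := integrable_tsum_of_summable_integral_norm hFint hFsum
      (G := fun q => (S.chi p q : ℝ) * f q) (by
        filter_upwards [hchi] with q hq using hq.mul_right (f q))
    refine ⟨h1, ?_⟩
    have hfd : IntegrableOn (fun x => f (radial (x - p)) * angleDensity S.normal p x)
        (⋃ i, t i) μHE[2] := by
      rw [htu]
      exact hint.bdd_mul (hf.comp (measurable_radial_sub p)).aestronglyMeasurable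
        (Filter.Eventually.of_forall fun x => hC _)
    have h3 := hasSum_integral_iUnion htm htd hfd
    rw [htu] at h3
    have h4 : ∀ i, ∫ q, (B i).indicator (fun _ => (σ i : ℝ)) q * f q ∂sphereArea =
        ∫ x in t i, f (radial (x - p)) * angleDensity S.normal p x ∂μHE[2] := fun i => by
      simp only [hFeq]
      rw [integral_const_mul, hFval i f hf]
    simp only [h4] at h2
    exact h2.unique h3
  refine ⟨?_, ?_, main⟩
  · filter_upwards [hfin, hneg] with q hq1 hq2
    obtain ⟨e, he, -⟩ := hbij q hq2
    rw [← he.image_eq]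
    exact hq1.image e
  · simpa using (main (fun _ => 1) measurable_const ⟨1, fun _ => by simp⟩).1

end PiecewiseSmoothSurface

/-! ### Green's theorem on two half-planes glued along an edge. -/

section Green

variable {f : ℝ × ℝ → ℝ} {U K : Set (ℝ × ℝ)} {I : Set ℝ}

theorem fderiv_eq_zero_of_eqOn_sdiff (hU : IsOpen U) (hK : IsCompact K) (hI : IsOpen I)
    (h0 : ∀ y ∈ U, y.2 ∈ I → y ∉ K → f y = 0) {y : ℝ × ℝ} (hy : y ∈ U) (hyI : y.2 ∈ I)
    (hyK : y ∉ K) : fderiv ℝ f y = 0 := by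
  have : f =ᶠ[𝓝 y] fun _ => 0 := by
    filter_upwards [hU.mem_nhds hy, (hI.preimage continuous_snd).mem_nhds hyI,
      hK.isClosed.isOpen_compl.mem_nhds hyK] with z h1 h2 h3 using h0 z h1 h2 h3
  rw [this.fderiv_eq, fderiv_fun_const]; rfl

theorem integrableOn_fderiv_apply (hU : IsOpen U) (hK : IsCompact K) (hKU : K ⊆ U)
    (hI : IsOpen I) (hf : ContDiffOn ℝ 1 f U) (v : ℝ × ℝ) :
    Integrable ((K ∩ {y | y.2 ∈ I}).indicator fun y => fderiv ℝ f y v) := by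
  have hc : ContinuousOn (fun y => fderiv ℝ f y v) K :=
    ((hf.continuousOn_fderiv_of_isOpen hU le_rfl).clm_apply continuousOn_const).mono hKU
  rw [integrable_indicator_iff (show MeasurableSet (K ∩ {y | y.2 ∈ I}) from
    hK.measurableSet.inter (hI.preimage continuous_snd).measurableSet)]
  exact (hc.integrableOn_compact hK).mono_set inter_subset_left

theorem indicator_fderiv_eq (hU : IsOpen U) (hK : IsCompact K) (hKU : K ⊆ U)
    (hI : IsOpen I) (h0 : ∀ y ∈ U, y.2 ∈ I → y ∉ K → f y = 0) (v : ℝ × ℝ) :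
    ((U ∩ {y | y.2 ∈ I}).indicator fun y => fderiv ℝ f y v) =
      (K ∩ {y | y.2 ∈ I}).indicator fun y => fderiv ℝ f y v := by
  ext y
  by_cases hyI : y.2 ∈ I
  · by_cases hyK : y ∈ K
    · simp [hyI, hyK, hKU hyK]
    · by_cases hyU : y ∈ U
      · simp [hyI, hyK, hyU, fderiv_eq_zero_of_eqOn_sdiff hU hK hI h0 hyU hyI hyK]
      · simp [hyK, hyU]
  · simp [hyI]

theorem setIntegral_fderiv_eq (hU : IsOpen U) (hK : IsCompact K) (hKU : K ⊆ U)
    (hI : IsOpen I) (h0 : ∀ y ∈ U, y.2 ∈ I → y ∉ K → f y = 0) (v : ℝ × ℝ) :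
    ∫ y in U ∩ {y | y.2 ∈ I}, fderiv ℝ f y v =
      ∫ y, (K ∩ {y | y.2 ∈ I}).indicator (fun y => fderiv ℝ f y v) y := by
  have hIm : MeasurableSet {y : ℝ × ℝ | y.2 ∈ I} := (hI.preimage continuous_snd).measurableSet
  rw [← integral_indicator (hU.measurableSet.inter hIm), indicator_fderiv_eq hU hK hKU hI h0]

/-- At points of `K` the extension by zero agrees locally with the smooth `f`; off `K` it vanishes
locally. Vanishing is required only for `y.2 ∈ I`, because each half-sheet map is defined beyond the
edge, where nothing controls the test field. -/
theorem hasDerivAt_indicator_comp (hU : IsOpen U) (hK : IsCompact K) (hKU : K ⊆ U)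
    (hI : IsOpen I) (hf : ContDiffOn ℝ 1 f U) (h0 : ∀ y ∈ U, y.2 ∈ I → y ∉ K → f y = 0)
    {c : ℝ → ℝ × ℝ} {v : ℝ × ℝ} {t : ℝ} (hc : HasDerivAt c v t) (ht : (c t).2 ∈ I) :
    HasDerivAt (fun t => U.indicator f (c t))
      ((K ∩ {y | y.2 ∈ I}).indicator (fun y => fderiv ℝ f y v) (c t)) t := by
  by_cases hyK : c t ∈ K
  · rw [indicator_of_mem (show c t ∈ K ∩ {y | y.2 ∈ I} from ⟨hyK, ht⟩)]
    have hd : DifferentiableAt ℝ f (c t) :=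
      (hf.contDiffAt (hU.mem_nhds (hKU hyK))).differentiableAt (by simp)
    refine (hd.hasFDerivAt.comp_hasDerivAt t hc).congr_of_eventuallyEq ?_
    filter_upwards [hc.continuousAt.preimage_mem_nhds (hU.mem_nhds (hKU hyK))] with s hs
    exact indicator_of_mem (s := U) hs f
  · rw [indicator_of_notMem (fun h => hyK h.1)]
    refine (hasDerivAt_const t (0 : ℝ)).congr_of_eventuallyEq ?_
    filter_upwards [hc.continuousAt.preimage_mem_nhds (hK.isClosed.isOpen_compl.mem_nhds hyK),
      hc.continuousAt.preimage_mem_nhds ((hI.preimage continuous_snd).mem_nhds ht)] with s hs hsI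
    by_cases hsU : c s ∈ U
    · rw [indicator_of_mem hsU, h0 _ hsU hsI hs]
    · rw [indicator_of_notMem hsU]

/-- By Fubini, the inner integral along each horizontal line is that of the derivative of a
compactly supported function. -/
theorem setIntegral_fderiv_fst_eq_zero (hU : IsOpen U) (hK : IsCompact K) (hKU : K ⊆ U)
    (hI : IsOpen I) (hf : ContDiffOn ℝ 1 f U) (h0 : ∀ y ∈ U, y.2 ∈ I → y ∉ K → f y = 0) :
    ∫ y in U ∩ {y | y.2 ∈ I}, fderiv ℝ f y (1, 0) = 0 := by
  have hint := integrableOn_fderiv_apply hU hK hKU hI hf (1, 0)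
  rw [setIntegral_fderiv_eq hU hK hKU hI h0, Measure.volume_eq_prod, integral_prod_symm _ hint]
  refine integral_eq_zero_of_ae ?_
  filter_upwards [hint.prod_left_ae] with v hv
  by_cases hvI : v ∈ I
  · have hd : ∀ u : ℝ, HasDerivAt (fun u => U.indicator f (u, v))
        ((K ∩ {y | y.2 ∈ I}).indicator (fun y => fderiv ℝ f y (1, 0)) (u, v)) u := fun u =>
      hasDerivAt_indicator_comp hU hK hKU hI hf h0
        ((hasDerivAt_id u).prodMk (hasDerivAt_const u v)) hvI
    refine integral_eq_zero_of_hasDerivAt_of_integrable hd hv ?_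
    have hcont : Continuous fun u => U.indicator f (u, v) :=
      continuous_iff_continuousAt.2 fun u => (hd u).continuousAt
    refine hcont.integrable_of_hasCompactSupport ?_
    refine HasCompactSupport.intro (hK.image continuous_fst) fun u hu => ?_
    have huK : (u, v) ∉ K := fun h => hu ⟨_, h, rfl⟩
    by_cases huU : (u, v) ∈ U
    · rw [indicator_of_mem huU, h0 _ huU hvI huK]
    · rw [indicator_of_notMem huU]
  · simp [hvI]

/-- Integrating vertically from the edge to infinity leaves minus the value on the edge. -/
theorem setIntegral_fderiv_snd_pos (hU : IsOpen U) (hK : IsCompact K) (hKU : K ⊆ U)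
    (hf : ContDiffOn ℝ 1 f U) (h0 : ∀ y ∈ U, 0 ≤ y.2 → y ∉ K → f y = 0) :
    ∫ y in U ∩ {y | 0 < y.2}, fderiv ℝ f y (0, 1) = -∫ u : ℝ, U.indicator f (u, 0) := by
  have hI : IsOpen (Ioi (0 : ℝ)) := isOpen_Ioi
  have h0' : ∀ y ∈ U, y.2 ∈ Ioi (0 : ℝ) → y ∉ K → f y = 0 := fun y hy hyI =>
    h0 y hy (le_of_lt hyI)
  have hint := integrableOn_fderiv_apply hU hK hKU hI hf (0, 1)
  have h1 := setIntegral_fderiv_eq hU hK hKU hI h0' (0, 1)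
  rw [Measure.volume_eq_prod] at hint h1
  rw [integral_prod _ hint] at h1
  rw [Measure.volume_eq_prod]
  refine h1.trans ?_
  rw [← integral_neg]
  refine integral_congr_ae ?_
  filter_upwards [hint.prod_right_ae] with u hu
  have h2 : ∫ v, (K ∩ {y : ℝ × ℝ | y.2 ∈ Ioi (0 : ℝ)}).indicator (fun y => fderiv ℝ f y (0, 1)) (u, v)
      = ∫ v in Ioi (0 : ℝ), (K ∩ {y : ℝ × ℝ | y.2 ∈ Ioi (0 : ℝ)}).indicator
        (fun y => fderiv ℝ f y (0, 1)) (u, v) := by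
    rw [← integral_indicator measurableSet_Ioi]
    congr 1
    ext v
    by_cases hv : v ∈ Ioi (0 : ℝ)
    · rw [indicator_of_mem hv]
    · rw [indicator_of_notMem hv, indicator_of_notMem fun h => hv h.2]
  rw [h2]
  have hzero : ∀ v, 0 ≤ v → (u, v) ∉ K → U.indicator f (u, v) = 0 := fun v hv hK => by
    by_cases hvU : (u, v) ∈ U
    · rw [indicator_of_mem hvU, h0 _ hvU hv hK]
    · rw [indicator_of_notMem hvU]
  have hline : Continuous fun v : ℝ => (u, v) := by fun_prop
  have h3 := integral_Ioi_of_hasDerivAt_of_tendsto (a := (0 : ℝ)) (m := 0)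
    (f := fun v => U.indicator f (u, v))
    (f' := fun v => (K ∩ {y | y.2 ∈ Ioi (0 : ℝ)}).indicator (fun y => fderiv ℝ f y (0, 1)) (u, v))
    ?_ (fun v hv => hasDerivAt_indicator_comp hU hK hKU hI hf h0'
        ((hasDerivAt_const v u).prodMk (hasDerivAt_id v)) hv) hu.integrableOn ?_
  · rw [h3, zero_sub]
  -- Continuity from the right at the edge: on `K` it comes from `f` itself, off `K` the extension
  -- vanishes for all nearby `v ≥ 0`.
  · by_cases hk : (u, (0 : ℝ)) ∈ K
    · have hcf : ContinuousAt f (u, 0) := hf.continuousOn.continuousAt (hU.mem_nhds (hKU hk))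
      have : ContinuousAt (fun v => f (u, v)) 0 := hcf.comp (f := fun v : ℝ => (u, v)) hline.continuousAt
      refine (this.congr ?_).continuousWithinAt
      filter_upwards [hline.continuousAt.preimage_mem_nhds (hU.mem_nhds (hKU hk))] with v hv
      exact (indicator_of_mem (s := U) hv f).symm
    · refine ContinuousWithinAt.congr_of_eventuallyEq (continuousWithinAt_const (b := (0 : ℝ))) ?_
        (hzero 0 le_rfl hk)
      filter_upwards [self_mem_nhdsWithin, mem_nhdsWithin_of_mem_nhds
        (hline.continuousAt.preimage_mem_nhds (hK.isClosed.isOpen_compl.mem_nhds hk))] with v hv hvK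
      exact hzero v hv hvK
  · obtain ⟨R, hR⟩ := (hK.image continuous_snd).isBounded.bddAbove
    refine tendsto_const_nhds.congr' ?_
    filter_upwards [Filter.eventually_gt_atTop (max R 0)] with v hv
    refine (hzero v ((le_max_right _ _).trans hv.le) fun h => ?_).symm
    exact absurd (hR ⟨_, h, rfl⟩) (not_le.2 ((le_max_left _ _).trans_lt hv))

theorem setIntegral_fderiv_snd_neg (hU : IsOpen U) (hK : IsCompact K) (hKU : K ⊆ U)
    (hf : ContDiffOn ℝ 1 f U) (h0 : ∀ y ∈ U, y.2 ≤ 0 → y ∉ K → f y = 0) :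
    ∫ y in U ∩ {y | y.2 < 0}, fderiv ℝ f y (0, 1) = ∫ u : ℝ, U.indicator f (u, 0) := by
  -- Reflection in the edge reduces to the upper half-plane.
  let r : (ℝ × ℝ) ≃L[ℝ] ℝ × ℝ := (ContinuousLinearEquiv.refl ℝ ℝ).prodCongr (ContinuousLinearEquiv.neg ℝ)
  have hr : ∀ y, r y = (y.1, -y.2) := fun y => rfl
  have hrm : MeasurePreserving r volume volume :=
    (MeasurePreserving.id (volume : Measure ℝ)).prod (Measure.measurePreserving_neg volume)
  have hrK : IsCompact (r ⁻¹' K) := r.toHomeomorph.isCompact_preimage.2 hK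
  have h1 := setIntegral_fderiv_snd_pos (f := f ∘ r) (hU.preimage r.continuous) hrK
    (preimage_mono hKU) (hf.comp r.contDiff.contDiffOn fun _ h => h)
    (fun y hy hy2 hyK => h0 (r y) hy (by rw [hr]; simpa using hy2) hyK)
  have h2 : r ⁻¹' U ∩ {y | 0 < y.2} = r ⁻¹' (U ∩ {y | y.2 < 0}) := by
    ext y; simp [hr]
  have h3 : ∀ y, fderiv ℝ (f ∘ r) y (0, 1) = -fderiv ℝ f (r y) (0, 1) := by
    intro y
    rw [r.comp_right_fderiv]
    have : r (0, 1) = -(0, 1) := by simp [hr]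
    rw [ContinuousLinearMap.comp_apply, ContinuousLinearEquiv.coe_coe, this, map_neg]
  simp only [h3] at h1
  rw [h2, hrm.setIntegral_preimage_emb r.toHomeomorph.measurableEmbedding
    (fun y => -fderiv ℝ f y (0, 1)), integral_neg, neg_inj] at h1
  rw [h1]
  refine integral_congr_ae (Filter.Eventually.of_forall fun u => ?_)
  have h4 : r (u, 0) = (u, 0) := by simp [hr]
  simp only
  by_cases hu : (u, (0 : ℝ)) ∈ U
  · rw [indicator_of_mem hu, indicator_of_mem (by rw [mem_preimage, h4]; exact hu)]
    simp [h4]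
  · rw [indicator_of_notMem hu, indicator_of_notMem (by rw [mem_preimage, h4]; exact hu)]

/-- Green's theorem for a pair of one-forms `P du + Q dv` over the two half-planes whose
tangential components agree on the common edge. -/
theorem green_glued {P₁ P₂ Q₁ Q₂ : ℝ × ℝ → ℝ} (hU : IsOpen U) (hK : IsCompact K) (hKU : K ⊆ U)
    (hP₁ : ContDiffOn ℝ 1 P₁ U) (hP₂ : ContDiffOn ℝ 1 P₂ U) (hQ₁ : ContDiffOn ℝ 1 Q₁ U)
    (hQ₂ : ContDiffOn ℝ 1 Q₂ U)
    (h₁ : ∀ y ∈ U, 0 ≤ y.2 → y ∉ K → P₁ y = 0 ∧ Q₁ y = 0)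
    (h₂ : ∀ y ∈ U, y.2 ≤ 0 → y ∉ K → P₂ y = 0 ∧ Q₂ y = 0)
    (he : ∀ y ∈ U, y.2 = 0 → P₁ y = P₂ y) :
    (∫ y in U ∩ {y | 0 < y.2}, (fderiv ℝ Q₁ y (1, 0) - fderiv ℝ P₁ y (0, 1))) +
      ∫ y in U ∩ {y | y.2 < 0}, (fderiv ℝ Q₂ y (1, 0) - fderiv ℝ P₂ y (0, 1)) = 0 := by
  have hi : ∀ f : ℝ × ℝ → ℝ, ContDiffOn ℝ 1 f U → ∀ I : Set ℝ, IsOpen I →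
      (∀ y ∈ U, y.2 ∈ I → y ∉ K → f y = 0) → ∀ v,
      IntegrableOn (fun y => fderiv ℝ f y v) (U ∩ {y | y.2 ∈ I}) := by
    intro f hf I hI h0 v
    have hIm : MeasurableSet {y : ℝ × ℝ | y.2 ∈ I} := (hI.preimage continuous_snd).measurableSet
    rw [← integrable_indicator_iff (hU.measurableSet.inter hIm)]
    rw [indicator_fderiv_eq hU hK hKU hI h0]
    exact integrableOn_fderiv_apply hU hK hKU hI hf v
  have z1 : ∀ y ∈ U, y.2 ∈ Ioi (0 : ℝ) → y ∉ K → P₁ y = 0 ∧ Q₁ y = 0 := fun y hy hI =>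
    h₁ y hy (le_of_lt hI)
  have z2 : ∀ y ∈ U, y.2 ∈ Iio (0 : ℝ) → y ∉ K → P₂ y = 0 ∧ Q₂ y = 0 := fun y hy hI =>
    h₂ y hy (le_of_lt hI)
  have e1 := integral_sub (hi Q₁ hQ₁ (Ioi 0) isOpen_Ioi (fun y a b c => (z1 y a b c).2) (1, 0))
    (hi P₁ hP₁ (Ioi 0) isOpen_Ioi (fun y a b c => (z1 y a b c).1) (0, 1))
  have e2 := integral_sub (hi Q₂ hQ₂ (Iio 0) isOpen_Iio (fun y a b c => (z2 y a b c).2) (1, 0))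
    (hi P₂ hP₂ (Iio 0) isOpen_Iio (fun y a b c => (z2 y a b c).1) (0, 1))
  have a1 := setIntegral_fderiv_fst_eq_zero hU hK hKU isOpen_Ioi hQ₁ (fun y a b c => (z1 y a b c).2)
  have a2 := setIntegral_fderiv_fst_eq_zero hU hK hKU isOpen_Iio hQ₂ (fun y a b c => (z2 y a b c).2)
  have b1 := setIntegral_fderiv_snd_pos hU hK hKU hP₁ (fun y a b c => (h₁ y a b c).1)
  have b2 := setIntegral_fderiv_snd_neg hU hK hKU hP₂ (fun y a b c => (h₂ y a b c).1)
  -- The edge terms have opposite signs and cancel. Only the `du` components enter, so `Q₁` and `Q₂`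
  -- need not agree.
  have b3 : ∫ u : ℝ, U.indicator P₁ (u, 0) = ∫ u : ℝ, U.indicator P₂ (u, 0) := by
    congr 1
    ext u
    by_cases hu : (u, (0 : ℝ)) ∈ U
    · rw [indicator_of_mem hu, indicator_of_mem hu, he _ hu rfl]
    · rw [indicator_of_notMem hu, indicator_of_notMem hu]
  simp only [mem_Ioi, mem_Iio] at e1 e2 a1 a2
  rw [e1, e2, a1, a2, b1, b2, b3]
  ring

end Green

/-! ### Curl, pullbacks of one-forms and Stokes' theorem. -/

/-- The curl of a vector field, as a function of its derivative. -/
noncomputable def curlVec : (E3 →L[ℝ] E3) →ₗ[ℝ] E3 where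
  toFun A := WithLp.toLp 2
    ![A (EuclideanSpace.single 1 1) 2 - A (EuclideanSpace.single 2 1) 1,
      A (EuclideanSpace.single 2 1) 0 - A (EuclideanSpace.single 0 1) 2,
      A (EuclideanSpace.single 0 1) 1 - A (EuclideanSpace.single 1 1) 0]
  map_add' A B := by
    ext i
    fin_cases i <;> simp <;> ring
  map_smul' c A := by
    ext i
    fin_cases i <;> simp <;> ring

theorem apply_eq_sum3 (A : E3 →L[ℝ] E3) (u : E3) (i : Fin 3) :
    A u i = u 0 * A (EuclideanSpace.single 0 1) i + u 1 * A (EuclideanSpace.single 1 1) i +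
      u 2 * A (EuclideanSpace.single 2 1) i := by
  have hu : u = u 0 • EuclideanSpace.single 0 (1 : ℝ) + u 1 • EuclideanSpace.single 1 (1 : ℝ) +
      u 2 • EuclideanSpace.single 2 (1 : ℝ) := by
    ext j
    fin_cases j <;> simp
  conv_lhs => rw [hu]
  simp only [map_add, map_smul, PiLp.add_apply, PiLp.smul_apply, smul_eq_mul]

/-- The curl is the vector representing the antisymmetric part of the derivative. -/
theorem inner_curlVec_cross3 (A : E3 →L[ℝ] E3) (u w : E3) :
    inner ℝ (curlVec A) (cross3 u w) = inner ℝ (A u) w - inner ℝ (A w) u := by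
  rw [inner_eq_sum3, inner_eq_sum3, inner_eq_sum3]
  simp only [apply_eq_sum3 A u, apply_eq_sum3 A w, cross3_zero, cross3_one, cross3_two]
  simp only [curlVec, LinearMap.coe_mk, AddHom.coe_mk, Matrix.cons_val_zero, Matrix.cons_val_one,
    Matrix.cons_val]
  ring

theorem continuous_curlVec : Continuous curlVec := LinearMap.continuous_of_finiteDimensional _

/-- A component of the pullback of the one-form dual to `H` under a parametrization. -/
noncomputable def pullbackForm (H : E3 → E3) (g : ℝ × ℝ → E3) (v y : ℝ × ℝ) : ℝ :=
  inner ℝ (H (g y)) (fderiv ℝ g y v)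

theorem IsRegularOn.contDiffOn_pullbackForm {H : E3 → E3} {g : ℝ × ℝ → E3} {U : Set (ℝ × ℝ)}
    (hg : IsRegularOn g U) (hH : ContDiff ℝ 1 H) (v : ℝ × ℝ) :
    ContDiffOn ℝ 1 (pullbackForm H g v) U := by
  have h1 : ContDiffOn ℝ 1 (fderiv ℝ g) U := hg.smooth.fderiv_of_isOpen hg.isOpen
    (by rw [one_add_one_eq_two]; exact WithTop.coe_le_coe.2 le_top)
  exact (hH.comp_contDiffOn (hg.smooth.of_le (by simp))).inner ℝ (h1.clm_apply contDiffOn_const)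

theorem IsRegularOn.fderiv_pullbackForm {H : E3 → E3} {g : ℝ × ℝ → E3} {U : Set (ℝ × ℝ)}
    (hg : IsRegularOn g U) (hH : ContDiff ℝ 1 H) (v w : ℝ × ℝ) {y : ℝ × ℝ} (hy : y ∈ U) :
    fderiv ℝ (pullbackForm H g v) y w = inner ℝ (H (g y)) (fderiv ℝ (fderiv ℝ g) y w v) +
      inner ℝ (fderiv ℝ H (g y) (fderiv ℝ g y w)) (fderiv ℝ g y v) := by
  have h1 : ContDiffOn ℝ 1 (fderiv ℝ g) U := hg.smooth.fderiv_of_isOpen hg.isOpen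
    (by rw [one_add_one_eq_two]; exact WithTop.coe_le_coe.2 le_top)
  have h2 : DifferentiableAt ℝ (fderiv ℝ g) y :=
    (h1.contDiffAt (hg.isOpen.mem_nhds hy)).differentiableAt (by simp)
  have h3 : HasFDerivAt (fun y => fderiv ℝ g y v)
      ((ContinuousLinearMap.apply ℝ E3 v).comp (fderiv ℝ (fderiv ℝ g) y)) y :=
    (ContinuousLinearMap.apply ℝ E3 v).hasFDerivAt.comp y h2.hasFDerivAt
  have h4 : HasFDerivAt (fun y => H (g y)) ((fderiv ℝ H (g y)).comp (fderiv ℝ g y)) y :=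
    ((hH.differentiable (by simp)) (g y)).hasFDerivAt.comp y (hg.differentiableAt hy).hasFDerivAt
  have h5 := h4.inner ℝ h3
  rw [show pullbackForm H g v = fun y => inner ℝ (H (g y)) (fderiv ℝ g y v) from rfl, h5.fderiv]
  simp

/-- Pullback commutes with the exterior derivative: the terms with second derivatives of `g` cancel
by symmetry. -/
theorem IsRegularOn.fderiv_pullbackForm_sub {H : E3 → E3} {g : ℝ × ℝ → E3} {U : Set (ℝ × ℝ)}
    (hg : IsRegularOn g U) (hH : ContDiff ℝ 1 H) {y : ℝ × ℝ} (hy : y ∈ U) :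
    fderiv ℝ (pullbackForm H g (0, 1)) y (1, 0) - fderiv ℝ (pullbackForm H g (1, 0)) y (0, 1) =
      inner ℝ (curlVec (fderiv ℝ H (g y))) (crossPartials g y) := by
  have hsymm : IsSymmSndFDerivAt ℝ g y :=
    (hg.contDiffAt hy).isSymmSndFDerivAt
      (by rw [minSmoothness_of_isRCLikeNormedField]; exact WithTop.coe_le_coe.2 le_top)
  rw [hg.fderiv_pullbackForm hH _ _ hy, hg.fderiv_pullbackForm hH _ _ hy, crossPartials_eq,
    inner_curlVec_cross3, hsymm (0, 1) (1, 0)]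
  ring

namespace IsChart

variable {M : Set E3} {n : E3 → E3} {g₁ g₂ : ℝ × ℝ → E3} {U : Set (ℝ × ℝ)} {W : Set E3}

/-- Supplies the compact set outside which the pulled back forms vanish, as Green's theorem
requires. -/
theorem isCompact_preimage (h : IsChart M n g₁ g₂ U univ W) {T : Set E3} (hT : IsCompact (M ∩ T))
    (hTW : M ∩ T ⊆ W) : IsCompact {y | y ∈ U ∧ glue g₁ g₂ y ∈ T} := by
  have h1 : IsCompact {y : (U ∩ univ : Set (ℝ × ℝ)) | glue g₁ g₂ y ∈ T} := by
    rw [h.isEmbedding.isInducing.isCompact_iff]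
    convert hT using 1
    ext x
    constructor
    · rintro ⟨⟨y, hy⟩, hyT, rfl⟩
      have : glue g₁ g₂ y ∈ M ∩ W := h.image_eq ▸ mem_image_of_mem _ hy
      exact ⟨this.1, hyT⟩
    · rintro ⟨hxM, hxT⟩
      obtain ⟨y, hy, rfl⟩ : x ∈ glue g₁ g₂ '' (U ∩ univ) := h.image_eq ▸ ⟨hxM, hTW ⟨hxM, hxT⟩⟩
      exact ⟨⟨y, hy⟩, hxT, rfl⟩
  convert h1.image continuous_subtype_val using 1
  ext y
  simp [and_comm]

/-- The two maps coincide along the edge, hence so do their derivatives along it. The transverse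
derivatives may differ, which is what a crease is. -/
theorem fderiv_edge_eq {D : Set (ℝ × ℝ)} (h : IsChart M n g₁ g₂ U D W) {y : ℝ × ℝ} (hy : y ∈ U)
    (hy0 : y.2 = 0) : fderiv ℝ g₁ y (1, 0) = fderiv ℝ g₂ y (1, 0) := by
  have hline : HasDerivAt (fun t : ℝ => (t, (0 : ℝ))) (1, 0) y.1 :=
    (hasDerivAt_id y.1).prodMk (hasDerivAt_const y.1 (0 : ℝ))
  have hye : ((y.1, 0) : ℝ × ℝ) = y := Prod.ext rfl hy0.symm
  have d : ∀ g, IsRegularOn g U →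
      HasDerivAt (fun t : ℝ => g (t, 0)) (fderiv ℝ g y (1, 0)) y.1 := fun g hg => by
    have := (hg.differentiableAt hy).hasFDerivAt
    rw [← hye] at this
    have h2 := this.comp_hasDerivAt y.1 hline
    rw [hye] at h2
    exact h2
  refine (d g₁ h.regular₁).unique ((d g₂ h.regular₂).congr_of_eventuallyEq ?_)
  have : ∀ᶠ t in 𝓝 y.1, (t, (0 : ℝ)) ∈ U :=
    hline.continuousAt.preimage_mem_nhds (by rw [hye]; exact h.regular₁.isOpen.mem_nhds hy)
  filter_upwards [this] with t ht using h.agree _ ht rfl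

/-- Stokes' theorem for a vector field supported in an interior chart. -/
theorem stokes (h : IsChart M n g₁ g₂ U univ W) (hM : IsCompact M) {H : E3 → E3}
    (hH : ContDiff ℝ 1 H) (hsupp : M ∩ tsupport H ⊆ W)
    (hint : IntegrableOn (fun x => inner ℝ (curlVec (fderiv ℝ H x)) (n x)) M μHE[2]) :
    ∫ x in M, inner ℝ (curlVec (fderiv ℝ H x)) (n x) ∂μHE[2] = 0 := by
  set F : E3 → ℝ := fun x => inner ℝ (curlVec (fderiv ℝ H x)) (n x)
  have hF0 : ∀ x, x ∉ tsupport H → F x = 0 := fun x hx => by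
    have : fderiv ℝ H x = 0 := by
      by_contra hne
      exact hx (support_fderiv_subset ℝ hne)
    simp [F, this]
  have h1 : ∫ x in M, F x ∂μHE[2] = ∫ x in M ∩ W, F x ∂μHE[2] :=
    (setIntegral_eq_of_subset_of_forall_sdiff_eq_zero hM.measurableSet inter_subset_left
      fun x hx => hF0 x fun hxs => hx.2 ⟨hx.1, hsupp ⟨hx.1, hxs⟩⟩)
  have hs1 := h.isSheet₁
  have hs2 := h.isSheet₂
  have hMW := h.inter_eq
  have hint' : IntegrableOn F (M ∩ W) μHE[2] := hint.mono_set inter_subset_left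
  rw [hMW] at hint' h1
  have hnull : μHE[2] (g₁ '' (U ∩ univ ∩ {y | y.2 = 0})) = 0 := by
    rw [h.regular₁.euclideanHausdorffMeasure_image h.measurableSet_edge
      (inter_subset_left.trans inter_subset_left) h.injOn_edge, Measure.restrict_eq_zero.2
      (measure_mono_null inter_subset_right volume_line)]
    simp
  have hd1 : Disjoint (g₁ '' (U ∩ univ ∩ {y | 0 < y.2})) (g₂ '' (U ∩ univ ∩ {y | y.2 < 0})) := by
    rw [disjoint_left]
    rintro _ ⟨y, hy, rfl⟩ ⟨z, hz, hzy⟩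
    rw [← glue_of_nonneg g₁ g₂ (le_of_lt hy.2), ← glue_of_neg g₁ g₂ hz.2] at hzy
    have := h.injOn hz.1 hy.1 hzy
    subst this
    exact lt_asymm (show z.2 < 0 from hz.2) (show 0 < z.2 from hy.2)
  have hmeas : MeasurableSet (g₂ '' (U ∩ univ ∩ {y | y.2 < 0})) := hs2.measurableSet_image
  have h2 : ∫ x in M, F x ∂μHE[2] = ∫ x in g₁ '' (U ∩ univ ∩ {y | 0 < y.2}), F x ∂μHE[2] +
      ∫ x in g₂ '' (U ∩ univ ∩ {y | y.2 < 0}), F x ∂μHE[2] := by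
    rw [h1, ← union_assoc, setIntegral_congr_set (union_ae_eq_left_of_ae_eq_empty
      (ae_eq_empty.2 hnull)), setIntegral_union hd1 hmeas (hint'.mono_set subset_union_left)
      (hint'.mono_set (subset_union_left.trans subset_union_right))]
  have key : ∀ g s, IsSheet n g U s → ∫ x in g '' s, F x ∂μHE[2] =
      ∫ y in s, (fderiv ℝ (pullbackForm H g (0, 1)) y (1, 0) -
        fderiv ℝ (pullbackForm H g (1, 0)) y (0, 1)) := by
    intro g s hs
    rw [hs.regular.integral_image hs.measurableSet hs.subset hs.injOn]
    refine setIntegral_congr_fun hs.measurableSet fun y hy => ?_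
    simp only [F]
    rw [hs.inner_normal hy, hs.regular.fderiv_pullbackForm_sub hH (hs.subset hy)]
  rw [h2, key _ _ hs1, key _ _ hs2]
  have hz : ∀ v y, ∀ g, g y ∉ tsupport H → pullbackForm H g v y = 0 := fun v y g hy => by
    rw [pullbackForm, image_eq_zero_of_notMem_tsupport hy, inner_zero_left]
  have hgreen := green_glued h.regular₁.isOpen
    (h.isCompact_preimage (hM.inter_right (isClosed_tsupport H)) hsupp) (fun y hy => hy.1)
    (h.regular₁.contDiffOn_pullbackForm hH (1, 0)) (h.regular₂.contDiffOn_pullbackForm hH (1, 0))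
    (h.regular₁.contDiffOn_pullbackForm hH (0, 1)) (h.regular₂.contDiffOn_pullbackForm hH (0, 1))
    (fun y hyU hy hyK => ?_) (fun y hyU hy hyK => ?_) (fun y hyU hy => ?_)
  · simpa only [inter_univ] using hgreen
  · have : g₁ y ∉ tsupport H := fun hg => hyK ⟨hyU, by rwa [glue_of_nonneg _ _ hy]⟩
    exact ⟨hz _ _ _ this, hz _ _ _ this⟩
  · have : g₂ y ∉ tsupport H := fun hg => hyK ⟨hyU, by
      rcases hy.lt_or_eq with hlt | heq
      · rwa [glue_of_neg _ _ hlt]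
      · rwa [glue_of_nonneg _ _ heq.ge, h.agree y hyU heq]⟩
    exact ⟨hz _ _ _ this, hz _ _ _ this⟩
  · rw [pullbackForm, pullbackForm, h.agree y hyU hy, h.fderiv_edge_eq hyU hy]

end IsChart

namespace PiecewiseSmoothSurface

variable (S : PiecewiseSmoothSurface) {p : E3}

theorem integrableOn_inner_normal (hp : p ∉ S.carrier) {v : E3 → E3} (hv : Continuous v) :
    IntegrableOn (fun x => inner ℝ (v x) (S.normal x)) S.carrier μHE[2] := by
  obtain ⟨hm, hn⟩ := S.ae_norm_normal hp
  obtain ⟨C, hC⟩ := S.isCompact_carrier.exists_bound_of_continuousOn hv.continuousOn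
  refine Integrable.of_bound (hv.measurable.aemeasurable.inner hm).aestronglyMeasurable C ?_
  filter_upwards [hn, ae_restrict_mem S.isCompact_carrier.measurableSet] with x hx hxM
  calc ‖(inner ℝ (v x) (S.normal x) : ℝ)‖ ≤ ‖v x‖ * ‖S.normal x‖ := norm_inner_le_norm _ _
    _ ≤ C := by rw [hx, mul_one]; exact hC x hxM

/-- Stokes' theorem for a vector field supported away from the boundary and the vertices. -/
theorem stokes (hp : p ∉ S.carrier) {H : E3 → E3} (hH : ContDiff ℝ ∞ H)
    (hsupp : ∀ x ∈ tsupport H, x ∉ S.boundary ∧ x ∉ S.vertices) :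
    ∫ x in S.carrier, inner ℝ (curlVec (fderiv ℝ H x)) (S.normal x) ∂μHE[2] = 0 := by
  have hloc : ∀ x ∈ S.carrier ∩ tsupport H, ∃ W, x ∈ W ∧ ∃ g₁ g₂ U,
      IsChart S.carrier S.normal g₁ g₂ U univ W := by
    rintro x ⟨hx, hxs⟩
    have hc : IsCreasePoint S.carrier S.normal x :=
      (S.interior_point x ⟨hx, by simp [hsupp x hxs]⟩).elim (·.isCreasePoint) id
    obtain ⟨g₁, g₂, U, W, h, hxW⟩ := hc.exists_isChart
    exact ⟨W, hxW, g₁, g₂, U, h⟩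
  choose! W hxW hW using hloc
  set K := S.carrier ∩ tsupport H
  have hK : IsCompact K := S.isCompact_carrier.inter_right (isClosed_tsupport H)
  have hWo : ∀ x ∈ K, IsOpen (W x) := fun x hx => by
    obtain ⟨g₁, g₂, U, h⟩ := hW x hx
    exact h.isOpen
  obtain ⟨c, hcK, hcov⟩ := hK.elim_nhds_subcover W fun x hx => (hWo x hx).mem_nhds (hxW x hx)
  -- The index `none` stands for the complement of `M ∩ tsupport H`; the part of `H` assigned to it
  -- has no support on `M`.
  let V : Option c → Set E3 := fun o => o.elim Kᶜ fun x => W x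
  have hVo : ∀ o, IsOpen (V o) := fun o => by
    rcases o with _ | x
    · exact hK.isClosed.isOpen_compl
    · exact hWo x (hcK x x.2)
  have hVcov : (univ : Set E3) ⊆ ⋃ o, V o := by
    intro x _
    by_cases hx : x ∈ K
    · obtain ⟨i, hi, hxi⟩ := mem_iUnion₂.1 (hcov hx)
      exact mem_iUnion.2 ⟨some ⟨i, hi⟩, hxi⟩
    · exact mem_iUnion.2 ⟨none, hx⟩
  obtain ⟨ρ, hρ⟩ := SmoothPartitionOfUnity.exists_isSubordinate (modelWithCornersSelf ℝ E3)
    isClosed_univ V hVo hVcov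
  have hρs : ∀ o, ContDiff ℝ ∞ (ρ o) := fun o => (ρ o).contMDiff.contDiff
  have hsum : H = fun x => ∑ o, ρ o x • H x := by
    ext1 x
    rw [← Finset.sum_smul, ← finsum_eq_sum_of_fintype, ρ.sum_eq_one (mem_univ x), one_smul]
  have hsm : ∀ o, ContDiff ℝ ∞ fun x => ρ o x • H x := fun o => (hρs o).smul hH
  have hderiv : ∀ x, fderiv ℝ H x = ∑ o, fderiv ℝ (fun x => ρ o x • H x) x := by
    intro x
    conv_lhs => rw [hsum]
    exact fderiv_fun_sum fun o _ => ((hsm o).differentiable (by simp)) x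
  have hint : ∀ o, IntegrableOn
      (fun x => inner ℝ (curlVec (fderiv ℝ (fun x => ρ o x • H x) x)) (S.normal x))
      S.carrier μHE[2] := fun o =>
    S.integrableOn_inner_normal hp (continuous_curlVec.comp ((hsm o).continuous_fderiv (by simp)))
  simp only [hderiv, map_sum, sum_inner]
  rw [integral_finsetSum _ fun o _ => hint o]
  refine Finset.sum_eq_zero fun o _ => ?_
  have ht1 : tsupport (fun x => ρ o x • H x) ⊆ tsupport (ρ o) := tsupport_smul_subset_left _ _
  have ht2 : tsupport (fun x => ρ o x • H x) ⊆ tsupport H := tsupport_smul_subset_right _ _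
  rcases o with _ | x
  · refine setIntegral_eq_zero_of_forall_eq_zero fun x hx => ?_
    have hxn : x ∉ tsupport (fun x => ρ none x • H x) := fun hxs =>
      (hρ none (ht1 hxs)) ⟨hx, ht2 hxs⟩
    have : fderiv ℝ (fun x => ρ none x • H x) x = 0 := by
      by_contra hne
      exact hxn (support_fderiv_subset ℝ hne)
    rw [this, map_zero, inner_zero_left]
  · obtain ⟨g₁, g₂, U, h⟩ := hW x (hcK x x.2)
    exact h.stokes S.isCompact_carrier ((hsm _).of_le (by simp))
      (fun z hz => hρ (some x) (ht1 hz.2)) (hint _)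

end PiecewiseSmoothSurface

/-! ### Polar coordinates and the weak derivative of the intersection number. -/

theorem integral_volumeIoiPow_two (f : ℝ → ℝ) :
    ∫ t, f t ∂Measure.volumeIoiPow 2 = ∫ t in Ioi (0 : ℝ), t ^ 2 * f t := by
  simp only [Measure.volumeIoiPow, ENNReal.ofReal]
  rw [integral_withDensity_eq_integral_smul,
    integral_subtype_comap measurableSet_Ioi fun a ↦ Real.toNNReal (a ^ 2) • f a,
    setIntegral_congr_fun measurableSet_Ioi fun x hx ↦ ?_]
  · rw [NNReal.smul_def, Real.coe_toNNReal _ (pow_nonneg hx.out.le _), smul_eq_mul]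
  · exact (measurable_subtype_coe.pow_const _).real_toNNReal

theorem homeomorphUnitSphereProd_eq (z : ({0}ᶜ : Set E3)) :
    homeomorphUnitSphereProd E3 z =
      (radial z, ⟨‖(z : E3)‖, mem_Ioi.2 (norm_pos_iff.2 (mem_compl_singleton_iff.1 z.2))⟩) := by
  refine Prod.ext (Subtype.ext ?_) (Subtype.ext ?_)
  · rw [coe_radial z.2]; simp
  · simp

/-- Integration in polar coordinates. -/
theorem integral_polar {g : E3 → ℝ} (hg : Integrable g) :
    ∫ z, g z = ∫ q, ∫ t in Ioi (0 : ℝ), t ^ 2 * g (t • (q : E3)) ∂volume ∂sphereArea := by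
  have hgc : ∀ z : ({0}ᶜ : Set E3), g z = (fun y : UnitSphere × Ioi (0 : ℝ) =>
      g ((y.2 : ℝ) • (y.1 : E3))) (homeomorphUnitSphereProd E3 z) := fun z => by
    rw [homeomorphUnitSphereProd_eq]
    exact congrArg g (norm_smul_radial (z : E3)).symm
  have hi : Integrable (fun y : UnitSphere × Ioi (0 : ℝ) => g ((y.2 : ℝ) • (y.1 : E3)))
      (sphereArea.prod (Measure.volumeIoiPow 2)) := by
    rw [← measurePreserving_polar.integrable_comp_emb (Homeomorph.measurableEmbedding _)]
    refine Integrable.congr (f := fun z : ({0}ᶜ : Set E3) => g z) ?_ (.of_forall hgc)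
    have := (integrableOn_iff_comap_subtypeVal (μ := volume) (f := g)
      (measurableSet_singleton (0 : E3)).compl).1 hg.integrableOn
    exact this
  calc ∫ z, g z = ∫ z : ({0}ᶜ : Set E3), g z ∂((volume : Measure E3).comap (↑)) := by
        rw [integral_subtype_comap (measurableSet_singleton _).compl g, restrict_compl_singleton]
    _ = ∫ y, g ((y.2 : ℝ) • (y.1 : E3)) ∂(sphereArea.prod (Measure.volumeIoiPow 2)) := by
        rw [← measurePreserving_polar.integral_comp (Homeomorph.measurableEmbedding _)]
        exact integral_congr_ae (.of_forall hgc)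
    _ = _ := by
        rw [integral_prod _ hi]
        refine integral_congr_ae (.of_forall fun q => ?_)
        exact integral_volumeIoiPow_two fun t => g (t • (q : E3))

/-- Extending homogeneously of degree zero allows weak derivatives to be taken in flat space instead
of on the sphere. -/
theorem locallyIntegrable_comp_radial {c : UnitSphere → ℝ} (hc : Integrable c sphereArea) :
    LocallyIntegrable fun z : E3 => c (radial z) := by
  have hball : ∀ R : ℝ, 0 < R → IntegrableOn (fun z : E3 => c (radial z)) (Metric.ball 0 R) := by
    intro R hR
    have h1 : Integrable (fun r : Ioi (0 : ℝ) =>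
        (Iio (⟨R, hR⟩ : Ioi (0 : ℝ))).indicator (1 : Ioi (0 : ℝ) → ℝ) r)
        (Measure.volumeIoiPow 2) := by
      refine (integrable_indicator_iff measurableSet_Iio).2 (integrableOn_const ?_)
      rw [Measure.volumeIoiPow_apply_Iio]
      exact ENNReal.ofReal_ne_top
    have h2 := (measurePreserving_polar.integrable_comp_emb
      (Homeomorph.measurableEmbedding _)).2 (hc.mul_prod h1)
    rw [← integrable_indicator_iff Metric.isOpen_ball.measurableSet,
      ← restrict_compl_singleton (μ := volume) (0 : E3)]
    refine (integrableOn_iff_comap_subtypeVal (measurableSet_singleton (0 : E3)).compl).2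
      (h2.congr (.of_forall fun z => ?_))
    simp only [Function.comp_apply, homeomorphUnitSphereProd_eq]
    by_cases hz : ‖(z : E3)‖ < R
    · rw [indicator_of_mem (mem_ball_zero_iff.2 hz), indicator_of_mem (by exact hz)]
      simp
    · rw [indicator_of_notMem (fun h => hz (mem_ball_zero_iff.1 h)),
        indicator_of_notMem (by exact hz), mul_zero]
  intro x
  refine ⟨Metric.ball 0 (‖x‖ + 1), Metric.isOpen_ball.mem_nhds (by simp), hball _ (by positivity)⟩

/-- The double vector product `∇l × (z × e) = (∇l · e) z - (∇l · z) e`. -/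
theorem curlVec_smulRight_cross3 (l : E3 →L[ℝ] ℝ) (z e : E3) :
    curlVec (l.smulRight (cross3 z e)) = l e • z - l z • e := by
  have hl : ∀ u : E3, l u = u 0 * l (EuclideanSpace.single 0 1) +
      u 1 * l (EuclideanSpace.single 1 1) + u 2 * l (EuclideanSpace.single 2 1) := by
    intro u
    have hu : u = u 0 • EuclideanSpace.single 0 (1 : ℝ) + u 1 • EuclideanSpace.single 1 (1 : ℝ) +
        u 2 • EuclideanSpace.single 2 (1 : ℝ) := by
      ext j
      fin_cases j <;> simp
    conv_lhs => rw [hu]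
    simp only [map_add, map_smul, smul_eq_mul]
  ext i
  rw [hl e, hl z]
  fin_cases i <;> simp [curlVec] <;> ring

/-- The cross product with a fixed vector. -/
noncomputable def crossRight (e : E3) : E3 →L[ℝ] E3 :=
  LinearMap.toContinuousLinearMap
    { toFun := fun z => cross3 z e
      map_add' := fun a b => by ext i; fin_cases i <;> simp <;> ring
      map_smul' := fun c a => by ext i; fin_cases i <;> simp <;> ring }

theorem crossRight_apply (e z : E3) : crossRight e z = cross3 z e := rfl

theorem curlVec_crossRight (e : E3) : curlVec (crossRight e) = -(2 : ℝ) • e := by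
  ext i
  fin_cases i <;> simp [curlVec, crossRight_apply] <;> ring

/-- The field whose curl is tangent, up to an exact derivative, to the cone from `p`. -/
noncomputable def coneField (φ : E3 → ℝ) (p e : E3) (t : ℝ) (x : E3) : E3 :=
  φ (t • (x - p)) • crossRight e (x - p)

theorem contDiff_coneField {φ : E3 → ℝ} (hφ : ContDiff ℝ ∞ φ) (p e : E3) (t : ℝ) :
    ContDiff ℝ ∞ (coneField φ p e t) := by
  have h1 : ContDiff ℝ ∞ fun x : E3 => x - p := contDiff_id.sub contDiff_const
  exact (hφ.comp (h1.const_smul t)).smul ((crossRight e).contDiff.comp h1)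

theorem curlVec_fderiv_coneField {φ : E3 → ℝ} (hφ : Differentiable ℝ φ) (p e : E3) (t : ℝ)
    (x : E3) : curlVec (fderiv ℝ (coneField φ p e t) x) =
      (t * fderiv ℝ φ (t • (x - p)) e) • (x - p) -
        (t * fderiv ℝ φ (t • (x - p)) (x - p) + 2 * φ (t • (x - p))) • e := by
  have h1 : HasFDerivAt (fun x : E3 => x - p) (ContinuousLinearMap.id ℝ E3) x :=
    (hasFDerivAt_id x).sub_const p
  have h2 : HasFDerivAt (fun x : E3 => φ (t • (x - p))) (t • fderiv ℝ φ (t • (x - p))) x := by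
    refine ((hφ _).hasFDerivAt.comp x (h1.const_smul t)).congr_fderiv ?_
    ext w; simp
  have h3 : HasFDerivAt (fun x : E3 => crossRight e (x - p)) (crossRight e) x :=
    ((crossRight e).hasFDerivAt.comp x h1).congr_fderiv (by ext1 w; rfl)
  have h4 : HasFDerivAt (coneField φ p e t) _ x := h2.smul h3
  rw [h4.fderiv, map_add, map_smul, crossRight_apply, curlVec_smulRight_cross3,
    curlVec_crossRight]
  simp only [smul_apply, smul_eq_mul]
  module

theorem tsupport_coneField_subset (φ : E3 → ℝ) (p e : E3) (t : ℝ) :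
    tsupport (coneField φ p e t) ⊆ {x | t • (x - p) ∈ tsupport φ} := by
  refine closure_minimal (fun x hx => subset_tsupport _ fun h => hx ?_)
    ((isClosed_tsupport φ).preimage (by fun_prop))
  rw [coneField, h, zero_smul]

/-- The integrand is the derivative of `t² φ(t z)` in `t`. For `T` so large that `φ(T z) = 0`, the
`e`-component of `rayField` integrates to zero. -/
theorem integral_fderiv_ray {φ : E3 → ℝ} (hφ : ContDiff ℝ 1 φ) (z : E3) (T : ℝ) :
    ∫ t in (0 : ℝ)..T, (t ^ 2 * fderiv ℝ φ (t • z) z + 2 * t * φ (t • z)) = T ^ 2 * φ (T • z) := by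
  have hd : ∀ t : ℝ, HasDerivAt (fun t => t ^ 2 * φ (t • z))
      (t ^ 2 * fderiv ℝ φ (t • z) z + 2 * t * φ (t • z)) t := by
    intro t
    have h1 : HasDerivAt (fun t : ℝ => t • z) z t := by
      simpa using (hasDerivAt_id t).smul_const z
    have h2 : HasDerivAt (fun t : ℝ => φ (t • z)) (fderiv ℝ φ (t • z) z) t :=
      (hφ.differentiable (by simp) _).hasFDerivAt.comp_hasDerivAt t h1
    refine ((hasDerivAt_pow 2 t).mul h2).congr_deriv ?_
    simp; ring
  have hc : Continuous fun t : ℝ => t ^ 2 * fderiv ℝ φ (t • z) z + 2 * t * φ (t • z) := by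
    have h3 := hφ.continuous_fderiv (by simp)
    have h4 := hφ.continuous
    fun_prop
  rw [intervalIntegral.integral_eq_sub_of_hasDerivAt (fun t _ => hd t) (hc.intervalIntegrable _ _)]
  simp

/-- The integrand that relates the derivative of a test function along rays to the curl of
`coneField`. -/
noncomputable def rayField (φ : E3 → ℝ) (e : E3) (t : ℝ) (z : E3) : E3 :=
  (t ^ 2 * fderiv ℝ φ (t • z) e) • z -
    (t ^ 2 * fderiv ℝ φ (t • z) z + 2 * t * φ (t • z)) • e

theorem continuous_rayField {φ : E3 → ℝ} (hφ : ContDiff ℝ 1 φ) (e : E3) :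
    Continuous fun y : E3 × ℝ => rayField φ e y.2 y.1 := by
  have h3 := hφ.continuous_fderiv (by simp)
  have h4 := hφ.continuous
  unfold rayField
  fun_prop

namespace PiecewiseSmoothSurface

variable (S : PiecewiseSmoothSurface) {p : E3}

/-- The vector `rayField φ e t (x - p)` is `t` times the curl of `coneField φ p e t` at `x`.
Dilation by `t > 0` preserves directions, so a condition on the directions in the support of `φ`
keeps all these fields off the boundary and the vertices. -/
theorem integral_rayField_eq_zero (hp : p ∉ S.carrier) {φ : E3 → ℝ} (hφ : ContDiff ℝ ∞ φ)
    (hsupp : ∀ z ∈ tsupport φ, radial z ∉ (fun x => radial (x - p)) '' (S.boundary ∪ S.vertices))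
    (e : E3) {t : ℝ} (ht : 0 < t) :
    ∫ x in S.carrier, inner ℝ (rayField φ e t (x - p)) (S.normal x) ∂μHE[2] = 0 := by
  have h := S.stokes hp (contDiff_coneField hφ p e t) fun x hx => by
    have h1 := hsupp _ (tsupport_coneField_subset φ p e t hx)
    rw [radial_smul ht] at h1
    exact ⟨fun hb => h1 ⟨x, .inl hb, rfl⟩, fun hb => h1 ⟨x, .inr hb, rfl⟩⟩
  have h2 : ∀ x, inner ℝ (rayField φ e t (x - p)) (S.normal x) =
      t * inner ℝ (curlVec (fderiv ℝ (coneField φ p e t) x)) (S.normal x) := fun x => by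
    rw [← real_inner_smul_left, curlVec_fderiv_coneField (hφ.differentiable (by simp)), rayField]
    congr 1
    module
  simp only [h2]
  rw [integral_const_mul, h, mul_zero]

theorem integrable_rayField (hp : p ∉ S.carrier) {φ : E3 → ℝ} (hφ : ContDiff ℝ 1 φ) (e : E3)
    (T : ℝ) : Integrable (fun y : E3 × ℝ => inner ℝ (rayField φ e y.2 (y.1 - p)) (S.normal y.1))
      ((μHE[2].restrict S.carrier).prod (volume.restrict (Ioc 0 T))) := by
  obtain ⟨hm, hn⟩ := S.ae_norm_normal hp
  have hc : Continuous fun y : E3 × ℝ => rayField φ e y.2 (y.1 - p) :=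
    (continuous_rayField hφ e).comp ((continuous_fst.sub continuous_const).prodMk continuous_snd)
  obtain ⟨C, hC⟩ := (S.isCompact_carrier.prod (isCompact_Icc (a := (0 : ℝ)) (b := T))
    ).exists_bound_of_continuousOn hc.continuousOn
  refine Integrable.of_bound
    (hc.measurable.aemeasurable.inner hm.comp_fst).aestronglyMeasurable C ?_
  have h1 : ∀ᵐ y ∂((μHE[2].restrict S.carrier).prod (volume.restrict (Ioc 0 T))),
      ‖S.normal y.1‖ = 1 ∧ y.1 ∈ S.carrier :=
    Measure.quasiMeasurePreserving_fst.ae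
      (hn.and (ae_restrict_mem S.isCompact_carrier.measurableSet))
  have h2 : ∀ᵐ y ∂((μHE[2].restrict S.carrier).prod (volume.restrict (Ioc 0 T))),
      y.2 ∈ Ioc 0 T :=
    Measure.quasiMeasurePreserving_snd.ae (ae_restrict_mem measurableSet_Ioc)
  filter_upwards [h1, h2] with y hy1 hy2
  calc _ ≤ ‖rayField φ e y.2 (y.1 - p)‖ * ‖S.normal y.1‖ := norm_inner_le_norm _ _
    _ ≤ C := by rw [hy1.1, mul_one]; exact hC y ⟨hy1.2, Ioc_subset_Icc_self hy2⟩

/-- The number of signed intersections has vanishing weak derivative, as a function homogeneous of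
degree zero, off the directions of the boundary and the vertices. -/
theorem integral_chi_fderiv_eq_zero (hp : p ∉ S.carrier) {φ : E3 → ℝ} (hφ : ContDiff ℝ ∞ φ)
    (hφc : HasCompactSupport φ)
    (hsupp : ∀ z ∈ tsupport φ, radial z ∉ (fun x => radial (x - p)) '' (S.boundary ∪ S.vertices))
    (e : E3) : ∫ z, (S.chi p (radial z) : ℝ) * fderiv ℝ φ z e = 0 := by
  obtain ⟨-, hchi, hmain⟩ := S.ae_finite_rayInter_and_integral_chi hp
  have hφ1 : ContDiff ℝ 1 φ := hφ.of_le (by simp)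
  have hD : Continuous fun z => fderiv ℝ φ z e :=
    (hφ1.continuous_fderiv (by simp)).clm_apply continuous_const
  have hDc : HasCompactSupport fun z => fderiv ℝ φ z e := hφc.fderiv_apply ℝ e
  have hint : Integrable fun z => (S.chi p (radial z) : ℝ) * fderiv ℝ φ z e := by
    have := (locallyIntegrable_comp_radial hchi).integrable_smul_right_of_hasCompactSupport hD hDc
    simpa [mul_comm] using this
  obtain ⟨R, hR0, hR⟩ : ∃ R : ℝ, 0 < R ∧ ∀ z, R ≤ ‖z‖ → φ z = 0 ∧ fderiv ℝ φ z e = 0 := by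
    obtain ⟨R, hR0, hR⟩ := (hφc.isCompact.isBounded.subset_ball_lt 0 0)
    refine ⟨R, hR0, fun z hz => ?_⟩
    have hzt : z ∉ tsupport φ := fun h => by
      have := hR h
      rw [mem_ball_zero_iff] at this
      exact absurd hz this.not_ge
    refine ⟨image_eq_zero_of_notMem_tsupport hzt, ?_⟩
    have : fderiv ℝ φ z = 0 := by
      by_contra hne
      exact hzt (support_fderiv_subset ℝ hne)
    rw [this]; rfl
  obtain ⟨C, hC⟩ := hDc.exists_bound_of_continuous hD
  -- The radial part of the polar integral; the angular part then pairs `χ` with the weight `f`.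
  set f : UnitSphere → ℝ := fun q => ∫ t in Ioi (0 : ℝ), t ^ 2 * fderiv ℝ φ (t • (q : E3)) e
  have hfm : Measurable f := by
    have : Continuous fun y : UnitSphere × ℝ => y.2 ^ 2 * fderiv ℝ φ (y.2 • (y.1 : E3)) e := by
      fun_prop
    exact (this.stronglyMeasurable.integral_prod_right (ν := volume.restrict (Ioi 0))).measurable
  have hfR : ∀ (z : E3) (T : ℝ), 0 < T → R ≤ T * ‖z‖ →
      ∫ t in Ioi (0 : ℝ), t ^ 2 * fderiv ℝ φ (t • z) e =
        ∫ t in Ioc 0 T, t ^ 2 * fderiv ℝ φ (t • z) e := by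
    intro z T hT0 hT
    refine setIntegral_eq_of_subset_of_forall_sdiff_eq_zero measurableSet_Ioi
      (fun t ht => ht.1) fun t ht => ?_
    have htT : T < t := by
      by_contra hle
      exact ht.2 ⟨ht.1, not_lt.1 hle⟩
    rw [(hR (t • z) ?_).2, mul_zero]
    rw [norm_smul, Real.norm_of_nonneg (hT0.trans htT).le]
    exact hT.trans (mul_le_mul_of_nonneg_right htT.le (norm_nonneg z))
  have hfb : ∃ C, ∀ q, ‖f q‖ ≤ C := by
    refine ⟨R ^ 2 * C * volume.real (Ioc 0 R), fun q => ?_⟩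
    simp only [f]
    rw [hfR q R hR0 (by simp)]
    refine norm_setIntegral_le_of_norm_le_const (by simp) fun t ht => ?_
    rw [norm_mul, norm_pow, Real.norm_of_nonneg ht.1.le]
    gcongr
    · exact ht.1.le
    · exact ht.2
    · exact hC _
  have h1 : ∫ z, (S.chi p (radial z) : ℝ) * fderiv ℝ φ z e = ∫ q, S.chi p q * f q ∂sphereArea := by
    rw [integral_polar hint]
    refine integral_congr_ae (.of_forall fun q => ?_)
    simp only [f]
    rw [← integral_const_mul]
    refine setIntegral_congr_fun measurableSet_Ioi fun t ht => ?_
    simp only [radial_smul ht, radial_coe]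
    ring
  rw [h1, (hmain f hfm hfb).2]
  obtain ⟨d, hd0, hd⟩ := S.exists_pos_le_norm_sub hp
  -- Since `|x - p| ≥ d` on `M`, the point `T • (x - p)` lies outside the support of `φ` for every
  -- `x` on the surface.
  set T := R / d
  have hT0 : 0 < T := div_pos hR0 hd0
  have h2 : ∀ x ∈ S.carrier, f (radial (x - p)) * angleDensity S.normal p x =
      ∫ t in Ioc 0 T, inner ℝ (rayField φ e t (x - p)) (S.normal x) := by
    intro x hx
    have hz : 0 < ‖x - p‖ := hd0.trans_le (hd x hx)
    have hTz : R ≤ T * ‖x - p‖ := by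
      rw [div_mul_eq_mul_div, le_div_iff₀ hd0]
      exact mul_le_mul_of_nonneg_left (hd x hx) hR0.le
    -- Substituting `s = t |x - p|` produces exactly the power that cancels the denominator of the
    -- solid angle density.
    have h3 : f (radial (x - p)) = ‖x - p‖ ^ 3 *
        ∫ t in Ioc 0 T, t ^ 2 * fderiv ℝ φ (t • (x - p)) e := by
      have h4 := integral_comp_mul_right_Ioi
        (fun s => s ^ 2 * fderiv ℝ φ (s • (radial (x - p) : E3)) e) 0 hz
      simp only [zero_mul, mul_smul, norm_smul_radial, smul_eq_mul] at h4
      simp only [f]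
      rw [← hfR _ _ hT0 hTz, ← mul_inv_cancel_left₀ hz.ne' (∫ t in Ioi (0 : ℝ), _), ← h4,
        ← integral_const_mul, ← integral_const_mul]
      refine setIntegral_congr_fun measurableSet_Ioi fun t ht => ?_
      ring
    have h5 := integral_fderiv_ray hφ1 (x - p) T
    rw [(hR (T • (x - p)) (by rwa [norm_smul, Real.norm_of_nonneg hT0.le])).1, mul_zero,
      intervalIntegral.integral_of_le hT0.le] at h5
    have hc1 : Continuous fun t : ℝ => t ^ 2 * fderiv ℝ φ (t • (x - p)) e := by fun_prop
    have hc2 : Continuous fun t : ℝ => t ^ 2 * fderiv ℝ φ (t • (x - p)) (x - p) +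
        2 * t * φ (t • (x - p)) := by
      have h3 := hφ1.continuous_fderiv (by simp)
      have h4 := hφ1.continuous
      fun_prop
    have hi1 := (hc1.integrableOn_Icc (a := 0) (b := T) (μ := volume)).mono_set Ioc_subset_Icc_self
    have hi2 := (hc2.integrableOn_Icc (a := 0) (b := T) (μ := volume)).mono_set Ioc_subset_Icc_self
    have hin : ∀ t, inner ℝ (rayField φ e t (x - p)) (S.normal x) =
        t ^ 2 * fderiv ℝ φ (t • (x - p)) e * inner ℝ (x - p) (S.normal x) -
          (t ^ 2 * fderiv ℝ φ (t • (x - p)) (x - p) + 2 * t * φ (t • (x - p))) *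
            inner ℝ e (S.normal x) := fun t => by
      rw [rayField, inner_sub_left, real_inner_smul_left, real_inner_smul_left]
    simp only [hin]
    rw [integral_sub (hi1.mul_const _) (hi2.mul_const _), integral_mul_const, integral_mul_const,
      h5, h3, angleDensity]
    field_simp
    ring_nf
  rw [setIntegral_congr_fun S.isCompact_carrier.measurableSet h2,
    integral_integral_swap (S.integrable_rayField hp hφ1 e T)]
  exact setIntegral_eq_zero_of_forall_eq_zero fun t ht =>
    S.integral_rayField_eq_zero hp hφ hsupp e ht.1

end PiecewiseSmoothSurface

/-! ### From vanishing weak derivatives to almost everywhere constancy. -/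

/-- A function which is locally almost everywhere constant on a preconnected set is almost
everywhere constant there. -/
theorem IsPreconnected.ae_eq_const {α β : Type*} [TopologicalSpace α] [MeasurableSpace α]
    [SecondCountableTopology α] {μ : Measure α} [μ.IsOpenPosMeasure] {s : Set α}
    (hs : IsPreconnected s) (hne : s.Nonempty) {f : α → β}
    (h : ∀ x ∈ s, ∃ U ∈ 𝓝 x, ∃ c, ∀ᵐ z ∂μ, z ∈ U → f z = c) :
    ∃ c, ∀ᵐ z ∂μ, z ∈ s → f z = c := by
  obtain ⟨x₀, hx₀⟩ := hne
  obtain ⟨U₀, hU₀, c₀, hc₀⟩ := h x₀ hx₀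
  refine ⟨c₀, ?_⟩
  set A : Set α := {x | ∃ U ∈ 𝓝 x, ∀ᵐ z ∂μ, z ∈ U → f z = c₀}
  set B : Set α := {x | ∃ U ∈ 𝓝 x, ∃ c, c ≠ c₀ ∧ ∀ᵐ z ∂μ, z ∈ U → f z = c}
  have hA : IsOpen A := by
    rw [isOpen_iff_mem_nhds]
    rintro x ⟨U, hU, hf⟩
    filter_upwards [eventually_mem_nhds_iff.2 hU] with y hy using ⟨U, hy, hf⟩
  have hB : IsOpen B := by
    rw [isOpen_iff_mem_nhds]
    rintro x ⟨U, hU, c, hc, hf⟩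
    filter_upwards [eventually_mem_nhds_iff.2 hU] with y hy using ⟨U, hy, c, hc, hf⟩
  -- A neighbourhood of a point has positive measure, so it cannot carry two different constants
  -- almost everywhere.
  have hAB : Disjoint A B := by
    rw [disjoint_left]
    rintro x ⟨U, hU, hf⟩ ⟨V, hV, c, hc, hg⟩
    have : μ (U ∩ V) = 0 := by
      refine measure_mono_null (fun z hz => ?_) ((hf.and hg : ∀ᵐ z ∂μ, _))
      rintro ⟨h1, h2⟩
      exact hc ((h2 hz.2).symm.trans (h1 hz.1))
    exact (Measure.measure_pos_of_mem_nhds μ (Filter.inter_mem hU hV)).ne' this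
  have hsub : s ⊆ A := by
    refine hs.subset_left_of_subset_union hA hB hAB (fun x hx => ?_) ⟨x₀, hx₀, U₀, hU₀, hc₀⟩
    obtain ⟨U, hU, c, hc⟩ := h x hx
    by_cases hcc : c = c₀
    · exact .inl ⟨U, hU, by rwa [hcc] at hc⟩
    · exact .inr ⟨U, hU, c, hcc, hc⟩
  have hnull : μ {z | z ∈ s ∧ f z ≠ c₀} = 0 := by
    refine measure_null_of_locally_null _ fun x hx => ?_
    obtain ⟨U, hU, hf⟩ := hsub hx.1
    refine ⟨_, Filter.inter_mem (mem_nhdsWithin_of_mem_nhds hU) self_mem_nhdsWithin, ?_⟩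
    exact measure_mono_null (t := {z | ¬(z ∈ U → f z = c₀)}) (fun z hz hzU => hz.2.2 (hzU hz.1)) hf
  filter_upwards [measure_eq_zero_iff_ae_notMem.1 hnull] with z hz hzs
  by_contra hne
  exact hz ⟨hzs, hne⟩

/-- A locally integrable function with vanishing weak derivative on a ball is almost everywhere
constant on every concentric smaller ball. -/
theorem ae_const_of_weak_fderiv_eq_zero {X : E3 → ℝ} (hX : LocallyIntegrable X) {z₀ : E3} {r : ℝ}
    (hr : 0 < r)
    (h : ∀ φ : E3 → ℝ, ContDiff ℝ ∞ φ → HasCompactSupport φ → tsupport φ ⊆ Metric.ball z₀ (2 * r) →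
      ∀ e, ∫ z, X z * fderiv ℝ φ z e = 0) :
    ∃ z₁, ∀ᵐ z, z ∈ Metric.ball z₀ r → X z = X z₁ := by
  -- The ratio of the radii is fixed at `2`, as Lebesgue differentiation requires, and the outer
  -- radius stays below `r`, so translates centred in the ball of radius `r` are supported in that
  -- of radius `2 * r`.
  let φ : ℕ → ContDiffBump (0 : E3) := fun i =>
    ⟨r / 4 / (i + 1), r / 2 / (i + 1), by positivity, by gcongr; linarith⟩
  have hrOut : ∀ i, (φ i).rOut < r := fun i => by
    have h1 : r / 2 / ((i : ℝ) + 1) ≤ r / 2 := div_le_self (by positivity) (by simp)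
    have h2 : (φ i).rOut = r / 2 / ((i : ℝ) + 1) := rfl
    linarith
  have hlim : ∀ᵐ z, Filter.Tendsto
      (fun i => ((φ i).normed volume ⋆[ContinuousLinearMap.lsmul ℝ ℝ, volume] X) z) Filter.atTop
      (𝓝 (X z)) := by
    refine ContDiffBump.ae_convolution_tendsto_right_of_locallyIntegrable (K := 2) ?_ ?_ hX
    · have := (tendsto_one_div_add_atTop_nhds_zero_nat (𝕜 := ℝ)).const_mul (r / 2)
      rw [mul_zero] at this
      exact this.congr fun n => mul_one_div _ _
    · refine .of_forall fun i => le_of_eq ?_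
      change r / 2 / ((i : ℝ) + 1) = 2 * (r / 4 / ((i : ℝ) + 1))
      ring
  have hconst : ∀ i, ∀ z ∈ Metric.ball z₀ r,
      ((φ i).normed volume ⋆[ContinuousLinearMap.lsmul ℝ ℝ, volume] X) z =
      ((φ i).normed volume ⋆[ContinuousLinearMap.lsmul ℝ ℝ, volume] X) z₀ := by
    intro i z hz
    set ψ := (φ i).normed (volume : Measure E3)
    have hψ : ContDiff ℝ ∞ ψ := (φ i).contDiff_normed
    have hψc : HasCompactSupport ψ := (φ i).hasCompactSupport_normed
    rw [← convolution_flip]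
    set L := (ContinuousLinearMap.lsmul ℝ ℝ : ℝ →L[ℝ] ℝ →L[ℝ] ℝ).flip
    have hd : ∀ x, HasFDerivAt (X ⋆[L, volume] ψ)
        ((X ⋆[L.precompR E3, volume] fderiv ℝ ψ) x) x := fun x =>
      hψc.hasFDerivAt_convolution_right L hX (hψ.of_le (by simp)) x
    refine Metric.isOpen_ball.is_const_of_fderiv_eq_zero (𝕜 := ℝ)
      (convex_ball z₀ r).isPreconnected
      (fun x _ => (hd x).differentiableAt.differentiableWithinAt) (fun x hx => ?_) hz
      (Metric.mem_ball_self hr)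
    rw [(hd x).fderiv]
    ext1 e
    rw [convolution_precompR_apply L hX (hψc.fderiv ℝ) (hψ.continuous_fderiv (by simp)),
      convolution_def]
    have h1 : ContDiff ℝ ∞ fun t => ψ (x - t) := hψ.comp (contDiff_const.sub contDiff_id)
    have h2 : HasCompactSupport fun t => ψ (x - t) :=
      hψc.comp_homeomorph (Homeomorph.subLeft x)
    have h3 : tsupport (fun t => ψ (x - t)) ⊆ Metric.ball z₀ (2 * r) := by
      have hcl : tsupport (fun t => ψ (x - t)) ⊆ Metric.closedBall x (φ i).rOut := by
        refine closure_minimal (fun t ht => ?_) Metric.isClosed_closedBall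
        have : x - t ∈ Function.support ψ := ht
        rw [(φ i).support_normed_eq, mem_ball_zero_iff] at this
        rw [Metric.mem_closedBall, dist_comm, dist_eq_norm]
        exact this.le
      intro t ht
      have h4 := Metric.mem_closedBall.1 (hcl ht)
      have h5 := Metric.mem_ball.1 hx
      rw [Metric.mem_ball]
      linarith [dist_triangle t x z₀, hrOut i]
    have h6 : ∀ t, fderiv ℝ (fun t => ψ (x - t)) t e = - fderiv ℝ ψ (x - t) e := fun t => by
      have := ((hψ.differentiable (by simp)) (x - t)).hasFDerivAt.comp t
        ((hasFDerivAt_id t).const_sub x)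
      rw [show (fun t => ψ (x - t)) = ψ ∘ HSub.hSub x from rfl, this.fderiv]
      simp
    have h7 := h _ h1 h2 h3 e
    simp only [h6, mul_neg, integral_neg, neg_eq_zero] at h7
    simpa [L, mul_comm] using h7
  -- The mollified functions are constant on the ball, but the constant depends on `i`; one point of
  -- convergence in the ball identifies the limit as a value of `X`.
  have hex : ∃ z₁ ∈ Metric.ball z₀ r, Filter.Tendsto
      (fun i => ((φ i).normed volume ⋆[ContinuousLinearMap.lsmul ℝ ℝ, volume] X) z₁) Filter.atTop
      (𝓝 (X z₁)) := by
    by_contra! hno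
    exact (Metric.measure_ball_pos volume z₀ hr).ne'
      (measure_mono_null (fun z hz => hno z hz) hlim)
  obtain ⟨z₁, hz₁, hl₁⟩ := hex
  refine ⟨z₁, ?_⟩
  filter_upwards [hlim] with z hz hzb
  refine tendsto_nhds_unique hz (hl₁.congr fun i => ?_)
  rw [hconst i z hzb, hconst i z₁ hz₁]

/-- The complement of a line in space is connected, having codimension two. The map `w ↦ z₀ + r w /
(1 + |w|)` carries it onto the punctured ball, since the line passes through the centre `z₀` and is
preserved. -/
theorem isPreconnected_ball_diff_line (z₀ : E3) {r : ℝ} (hr : 0 < r) :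
    IsPreconnected (Metric.ball z₀ r \ (ℝ ∙ z₀ : Submodule ℝ E3)) := by
  have hcodim : 1 < Module.rank ℝ (E3 ⧸ (ℝ ∙ z₀ : Submodule ℝ E3)) := by
    have h1 := Submodule.finrank_quotient_add_finrank (ℝ ∙ z₀ : Submodule ℝ E3)
    have h2 := finrank_span_le_card (R := ℝ) ({z₀} : Set E3)
    have h3 : Module.finrank ℝ E3 = 3 := by simp
    rw [← Module.finrank_eq_rank]
    rw [toFinset_singleton, Finset.card_singleton] at h2
    exact_mod_cast (by omega : 1 < Module.finrank ℝ (E3 ⧸ (ℝ ∙ z₀ : Submodule ℝ E3)))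
  have hpos : ∀ w : E3, 0 < 1 + ‖w‖ := fun w => by positivity
  have hc : Continuous fun w : E3 => z₀ + (r / (1 + ‖w‖)) • w :=
    continuous_const.add ((continuous_const.div (by fun_prop) fun w => (hpos w).ne').smul
      continuous_id)
  have himg := (isConnected_compl_of_one_lt_codim hcodim).isPreconnected.image _ hc.continuousOn
  have hmem : ∀ (a : ℝ) (w : E3), a ≠ 0 →
      (z₀ + a • w ∈ (ℝ ∙ z₀ : Submodule ℝ E3) ↔ w ∈ (ℝ ∙ z₀ : Submodule ℝ E3)) := by
    intro a w ha
    rw [Submodule.add_mem_iff_right _ (Submodule.mem_span_singleton_self z₀),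
      Submodule.smul_mem_iff _ ha]
  convert himg using 1
  ext z
  constructor
  · rintro ⟨hz, hzl⟩
    rw [Metric.mem_ball, dist_eq_norm] at hz
    have h1 : 0 < r - ‖z - z₀‖ := by linarith
    have h2 : z = z₀ + (r / (1 + ‖(r - ‖z - z₀‖)⁻¹ • (z - z₀)‖)) • (r - ‖z - z₀‖)⁻¹ • (z - z₀) := by
      rw [norm_smul, norm_inv, Real.norm_of_nonneg h1.le, smul_smul]
      have : r / (1 + (r - ‖z - z₀‖)⁻¹ * ‖z - z₀‖) * (r - ‖z - z₀‖)⁻¹ = 1 := by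
        field_simp
        simp
      rw [this, one_smul, add_sub_cancel]
    refine ⟨(r - ‖z - z₀‖)⁻¹ • (z - z₀), fun hl => hzl ?_, h2.symm⟩
    rw [h2]
    exact (hmem _ _ (div_pos hr (hpos _)).ne').2 hl
  · rintro ⟨w, hw, rfl⟩
    refine ⟨?_, fun hl => hw ((hmem _ _ (div_pos hr (hpos _)).ne').1 hl)⟩
    rw [mem_ball_iff_norm, add_sub_cancel_left, norm_smul, Real.norm_of_nonneg
      (div_pos hr (hpos w)).le, div_mul_eq_mul_div, div_lt_iff₀ (hpos w)]
    nlinarith [norm_nonneg w]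

/-! ### Constancy of the intersection number on connected sets of directions. -/

namespace PiecewiseSmoothSurface

variable (S : PiecewiseSmoothSurface) {p : E3}

theorem ae_const_chi_off_vertices (hp : p ∉ S.carrier) {z₀ : E3} {r : ℝ} (hr : 0 < r)
    (hball : ∀ z ∈ Metric.ball z₀ (2 * r),
      radial z ∉ (fun x => radial (x - p)) '' (S.boundary ∪ S.vertices)) :
    ∃ c, ∀ᵐ z, z ∈ Metric.ball z₀ r → S.chi p (radial z) = c := by
  obtain ⟨z₁, hz₁⟩ := ae_const_of_weak_fderiv_eq_zero
    (locallyIntegrable_comp_radial (S.ae_finite_rayInter_and_integral_chi hp).2.1) hr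
    fun φ hφ hφc hφs e => S.integral_chi_fderiv_eq_zero hp hφ hφc (fun z hz => hball z (hφs hz)) e
  -- The constant is a value of `χ`, hence an integer.
  refine ⟨S.chi p (radial z₁), ?_⟩
  filter_upwards [hz₁] with z hz hzb
  exact_mod_cast hz hzb

/-- Near every direction off the projection of the boundary, including those of the vertices, the
number of signed intersections is almost everywhere constant. -/
theorem exists_nhds_ae_const_chi (hp : p ∉ S.carrier) {z₀ : E3} (hz₀ : z₀ ≠ 0)
    (hb : radial z₀ ∉ S.boundaryProj p) :
    ∃ U ∈ 𝓝 z₀, ∃ c, ∀ᵐ z, z ∈ U → S.chi p (radial z) = c := by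
  -- Vertex directions other than that of `z₀` are avoided by shrinking the ball. If `z₀` itself
  -- points to a vertex, the bad points in the ball lie on the line `ℝ ∙ z₀`, which is null and does
  -- not disconnect the ball.
  set P : Set UnitSphere := S.boundaryProj p ∪
    ((fun x => radial (x - p)) '' S.vertices) \ {radial z₀}
  have hP : IsClosed P :=
    (S.isClosed_boundaryProj hp).union ((S.finite_vertices.image _).sdiff.isClosed)
  have hz₀P : radial z₀ ∉ P := by
    rintro (h | h)
    · exact hb h
    · exact h.2 rfl
  have hnhds : {z : E3 | z ≠ 0 ∧ radial z ∉ P} ∈ 𝓝 z₀ :=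
    Filter.inter_mem (isOpen_ne.mem_nhds hz₀)
      ((continuousOn_radial.continuousAt (isOpen_ne.mem_nhds hz₀)).preimage_mem_nhds
        (hP.isOpen_compl.mem_nhds hz₀P))
  obtain ⟨r, hr, hball⟩ := Metric.mem_nhds_iff.1 hnhds
  have hline : ∀ z : E3, z ≠ 0 → radial z = radial z₀ → z ∈ (ℝ ∙ z₀ : Submodule ℝ E3) := by
    intro z hz h
    rw [Submodule.mem_span_singleton]
    refine ⟨‖z‖ * ‖z₀‖⁻¹, ?_⟩
    rw [mul_smul, ← coe_radial hz₀, ← h, norm_smul_radial]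
  have hopen : IsOpen (Metric.ball z₀ r \ (ℝ ∙ z₀ : Submodule ℝ E3)) :=
    Metric.isOpen_ball.sdiff (Submodule.closed_of_finiteDimensional _)
  have hloc : ∀ z ∈ Metric.ball z₀ r \ (ℝ ∙ z₀ : Submodule ℝ E3),
      ∃ U ∈ 𝓝 z, ∃ c, ∀ᵐ z, z ∈ U → S.chi p (radial z) = c := by
    intro z hz
    obtain ⟨ε, hε, hεb⟩ := Metric.isOpen_iff.1 hopen z hz
    obtain ⟨c, hc⟩ := S.ae_const_chi_off_vertices hp (z₀ := z) (half_pos hε) fun w hw => by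
      rw [mul_div_cancel₀ _ two_ne_zero] at hw
      obtain ⟨hw1, hw2⟩ := hεb hw
      obtain ⟨hw0, hwP⟩ := hball hw1
      rw [image_union, ← S.boundaryProj_eq hp]
      rintro (h | h)
      · exact hwP (.inl h)
      · exact hwP (.inr ⟨h, fun heq => hw2 (hline w hw0 heq)⟩)
    exact ⟨_, Metric.ball_mem_nhds z (half_pos hε), c, hc⟩
  have hnull : volume ((ℝ ∙ z₀ : Submodule ℝ E3) : Set E3) = 0 := by
    refine Measure.addHaar_submodule _ _ fun h => ?_
    have h2 := finrank_span_le_card (R := ℝ) ({z₀} : Set E3)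
    rw [h, finrank_top] at h2
    simp at h2
  have hne : (Metric.ball z₀ r \ (ℝ ∙ z₀ : Submodule ℝ E3)).Nonempty := by
    by_contra hemp
    rw [not_nonempty_iff_eq_empty, sdiff_eq_empty] at hemp
    exact (Metric.measure_ball_pos volume z₀ hr).ne' (measure_mono_null hemp hnull)
  obtain ⟨c, hc⟩ := (isPreconnected_ball_diff_line z₀ hr).ae_eq_const hne hloc
  refine ⟨_, Metric.ball_mem_nhds z₀ hr, c, ?_⟩
  filter_upwards [hc, measure_eq_zero_iff_ae_notMem.1 hnull] with z hz hzl hzb using hz ⟨hzb, hzl⟩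

/-- The open cone over `A` is connected, so the local result in space spreads over it. A null
exceptional set in the cone gives a null exceptional set of directions. -/
theorem ae_const_chi_of_isPreconnected (hp : p ∉ S.carrier) {A : Set UnitSphere}
    (hA : IsPreconnected A) (hne : A.Nonempty) (hAb : A ⊆ (S.boundaryProj p)ᶜ) :
    ∃ c, ∀ᵐ q ∂sphereArea, q ∈ A → S.chi p q = c := by
  set K : Set E3 := (fun y : ℝ × UnitSphere => y.1 • (y.2 : E3)) '' (Ioi 0 ×ˢ A)
  have hK : IsPreconnected K :=
    (isPreconnected_Ioi.prod hA).image _ (by fun_prop)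
  have hKne : K.Nonempty := ((nonempty_Ioi (a := (0 : ℝ))).prod hne).image _
  obtain ⟨c, hc⟩ := hK.ae_eq_const (μ := volume) (f := fun z => S.chi p (radial z)) hKne <| by
    rintro _ ⟨⟨t, q⟩, ⟨ht, hq⟩, rfl⟩
    have ht0 : 0 < t := ht
    refine S.exists_nhds_ae_const_chi hp (smul_ne_zero ht0.ne' (ne_zero_of_mem_unit_sphere q)) ?_
    rw [radial_smul ht0, radial_coe]
    exact hAb hq
  refine ⟨c, ?_⟩
  have h0 : sphereArea {q | q ∈ A ∧ S.chi p q ≠ c} = 0 := by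
    refine sphereArea_eq_zero_of_cone (measure_mono_null ?_ hc)
    rintro _ ⟨t, ht, _, ⟨q, hq, rfl⟩, rfl⟩ h
    refine hq.2 ?_
    have := h ⟨(t, q), ⟨ht.1, hq.1⟩, rfl⟩
    simpa only [smul_eq_mul, radial_smul ht.1, radial_coe] using this
  filter_upwards [measure_eq_zero_iff_ae_notMem.1 h0] with q hq hqA
  by_contra h
  exact hq ⟨hqA, h⟩

end PiecewiseSmoothSurface

/-! ### The regions and the sum over them. -/

instance : LocallyConnectedSpace UnitSphere :=
  haveI : Fact (Module.finrank ℝ E3 = 2 + 1) := ⟨by simp⟩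
  ChartedSpace.locallyConnectedSpace (EuclideanSpace ℝ (Fin 2)) UnitSphere

namespace PiecewiseSmoothSurface

variable (S : PiecewiseSmoothSurface) {p : E3}

theorem isOpen_of_mem_regions (hp : p ∉ S.carrier) {A : Set UnitSphere} (hA : A ∈ S.regions p) :
    IsOpen A := by
  obtain ⟨q, -, rfl⟩ := hA
  -- Components of an open subset of a locally connected space are open.
  exact (S.isClosed_boundaryProj hp).isOpen_compl.connectedComponentIn

theorem nonempty_of_mem_regions {A : Set UnitSphere} (hA : A ∈ S.regions p) : A.Nonempty := by
  obtain ⟨q, hq, rfl⟩ := hA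
  exact ⟨q, mem_connectedComponentIn hq⟩

theorem pairwiseDisjoint_regions : (S.regions p).PairwiseDisjoint id := by
  rintro _ ⟨q, hq, rfl⟩ _ ⟨q', hq', rfl⟩ hne
  refine disjoint_left.2 fun x hx hx' => hne ?_
  exact (connectedComponentIn_eq hx).trans (connectedComponentIn_eq hx').symm

theorem countable_regions (hp : p ∉ S.carrier) : (S.regions p).Countable :=
  S.pairwiseDisjoint_regions.countable_of_isOpen (fun _ hA => S.isOpen_of_mem_regions hp hA)
    fun _ hA => S.nonempty_of_mem_regions hA

theorem iUnion_regions : ⋃ A : S.regions p, (A : Set UnitSphere) = (S.boundaryProj p)ᶜ := by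
  rw [← sUnion_eq_iUnion]
  refine (sUnion_subset ?_).antisymm fun q hq =>
    ⟨_, ⟨q, hq, rfl⟩, mem_connectedComponentIn hq⟩
  rintro _ ⟨q, -, rfl⟩
  exact connectedComponentIn_subset _ _

theorem exists_ae_const_on_regions (hp : p ∉ S.carrier) : ∃ c : Set UnitSphere → ℤ,
    ∀ A ∈ S.regions p, ∀ᵐ q ∂sphereArea, q ∈ A → S.chi p q = c A := by
  have h : ∀ A ∈ S.regions p, ∃ c, ∀ᵐ q ∂sphereArea, q ∈ A → S.chi p q = c := by
    intro A hA
    have hne := S.nonempty_of_mem_regions hA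
    obtain ⟨q, -, rfl⟩ := hA
    exact S.ae_const_chi_of_isPreconnected hp isPreconnected_connectedComponentIn hne
      (connectedComponentIn_subset _ _)
  choose! c hc using h
  exact ⟨c, hc⟩

/-- The regions are countably many disjoint open sets which miss only the null projection of the
boundary, so the integral of `χ` splits over them. -/
theorem hasSum_regions (hp : p ∉ S.carrier) {c : Set UnitSphere → ℤ}
    (hc : ∀ A ∈ S.regions p, ∀ᵐ q ∂sphereArea, q ∈ A → S.chi p q = c A) :
    HasSum (fun A : S.regions p => sphereArea.real (A : Set UnitSphere) * (c A : ℝ))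
      (∫ q, (S.chi p q : ℝ) ∂sphereArea) := by
  have hint := (S.ae_finite_rayInter_and_integral_chi hp).2.1
  have : Countable (S.regions p) := (S.countable_regions hp).to_subtype
  have hm : ∀ A : S.regions p, MeasurableSet (A : Set UnitSphere) := fun A =>
    (S.isOpen_of_mem_regions hp A.2).measurableSet
  have h := hasSum_integral_iUnion hm
    (fun A B hAB => S.pairwiseDisjoint_regions A.2 B.2 (Subtype.coe_injective.ne hAB))
    hint.integrableOn
  have hnull : sphereArea (S.boundaryProj p) = 0 := by
    rw [S.boundaryProj_eq hp]
    exact S.sphereArea_boundary hp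
  rw [S.iUnion_regions, setIntegral_congr_set (ae_eq_univ.2 (by rwa [compl_compl])),
    setIntegral_univ] at h
  have heq : (fun A : S.regions p => sphereArea.real (A : Set UnitSphere) * (c A : ℝ)) =
      fun A : S.regions p => ∫ q in (A : Set UnitSphere), (S.chi p q : ℝ) ∂sphereArea := by
    ext1 A
    rw [setIntegral_congr_ae (hm A) (g := fun _ => (c A : ℝ)) ?_, setIntegral_const, smul_eq_mul]
    filter_upwards [hc A A.2] with q hq hqA
    rw [hq hqA]
  rw [heq]
  exact h

theorem windingNumber_eq_integral_chi (hp : p ∉ S.carrier) :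
    S.windingNumber p = 1 / (4 * Real.pi) * ∫ q, (S.chi p q : ℝ) ∂sphereArea := by
  have h := ((S.ae_finite_rayInter_and_integral_chi hp).2.2 (fun _ => 1) measurable_const
    ⟨1, by simp⟩).2
  simp only [mul_one, one_mul] at h
  rw [h]
  rfl

end PiecewiseSmoothSurface

end

theorem lemma1 (S : PiecewiseSmoothSurface) (p : E3) (hp : p ∉ S.carrier) :
    (∀ A ∈ S.regions p, IsOpen A) ∧
    (∀ᵐ q ∂sphereArea, (S.rayInter p q).Finite) ∧
    IntegrableOn (S.solidAngleDensity p) S.carrier μHE[2] ∧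
    Integrable (fun q => (S.chi p q : ℝ)) sphereArea ∧
    S.windingNumber p = 1 / (4 * Real.pi) * ∫ q, (S.chi p q : ℝ) ∂sphereArea ∧
    ∃ c : Set UnitSphere → ℤ,
      (∀ A ∈ S.regions p, ∀ᵐ q ∂sphereArea, q ∈ A → S.chi p q = c A) ∧
      Summable (fun A : S.regions p => sphereArea.real (A : Set UnitSphere) * (c A : ℝ)) ∧
      S.windingNumber p =
        1 / (4 * Real.pi) *
          ∑' A : S.regions p, sphereArea.real (A : Set UnitSphere) * (c A : ℝ) := by
  obtain ⟨hfin, hint, -⟩ := S.ae_finite_rayInter_and_integral_chi hp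
  obtain ⟨c, hc⟩ := S.exists_ae_const_on_regions hp
  have hsum := S.hasSum_regions hp hc
  refine ⟨fun A hA => S.isOpen_of_mem_regions hp hA, hfin, S.integrableOn_angleDensity hp, hint,
    S.windingNumber_eq_integral_chi hp, c, hc, hsum.summable, ?_⟩
  rw [hsum.tsum_eq, S.windingNumber_eq_integral_chi hp]
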